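/- Let $d\ge 2$ be an integer, $\tfrac12<H<1$ and $t\ge 0$. Let $B^H=\{B^H_s,\ s\ge 0\}$ be a $d$-dimensional fractional Brownian motion with Hurst parameter $H$, that is, a (jointly measurable) centered Gaussian process in $\mathbb R^d$ whose one-dimensional component processes $B^{H,1},\dots,B^{H,d}$ are independent, with $$\mathbb E\big(B^{H,i}_sB^{H,i}_r\big)=\tfrac12\big(s^{2H}+r^{2H}-|s-r|^{2H}\big)\qquad(s,r\ge 0,\ 1\le i\le d).$$ For $\varepsilon>0$ let $p_\varepsilon(x)=(2\pi\varepsilon)^{-d/2}e^{-|x|^2/(2\varepsilon)}$, $x\in\mathbb R^d$, be the heat kernel, fix a coordinate $j\in\{1,\dots,d\}$ (for instance $j=1$), and put $$\alpha^{(1)}_{t,\varepsilon}(0)=-\int_0^t\int_0^s \frac{\partial p_\varepsilon}{\partial x_j}\big(B^H_s-B^H_r\big)\,\mathrm dr\,\mathrm ds .$$ Then, as $\varepsilon\downarrow 0$, $$\varepsilon^{\frac d2+1-\frac1H}\,\alpha^{(1)}_{t,\varepsilon}(0)\ \xrightarrow{\ \mathrm{law}\ }\ \mathcal N(0,\sigma^2),\qquad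 \sigma^2=\frac{t^{2H}}{2^{d+2}\pi^d H^2}\,B\Big(\frac1H,\frac d2+1-\frac1H\Big)^2,$$ where $B(\cdot,\cdot)$ denotes the Beta function. -/

import Mathlib

open MeasureTheory ProbabilityTheory Filter Topology
open scoped NNReal

/-- `B` is a `d`-dimensional fractional Brownian motion with Hurst parameter `H` under `P`:
a centered Gaussian process with values in `ℝ^d` whose one-dimensional component processes are
independent, each with covariance `(t ^ (2H) + s ^ (2H) - |t - s| ^ (2H)) / 2`. -/
structure IsFractionalBrownianMotion {Ω : Type*} [MeasurableSpace Ω] {d : ℕ} (H : ℝ)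
    (B : ℝ≥0 → Ω → EuclideanSpace ℝ (Fin d)) (P : Measure Ω) : Prop where
  isGaussianProcess : IsGaussianProcess B P
  centered : ∀ (t : ℝ≥0) (i : Fin d), ∫ ω, B t ω i ∂P = 0
  covariance : ∀ (t s : ℝ≥0) (i : Fin d),
    ∫ ω, B t ω i * B s ω i ∂P =
      1 / 2 * ((t : ℝ) ^ (2 * H) + (s : ℝ) ^ (2 * H) - |(t : ℝ) - (s : ℝ)| ^ (2 * H))
  iIndepFun_components : iIndepFun (fun (i : Fin d) (ω : Ω) (t : ℝ≥0) ↦ B t ω i) P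

/-- The heat kernel `p_ε(x) = (2πε)^(-d/2) exp(-|x|² / (2ε))` on `ℝ^d`. -/
noncomputable def heatKernel {d : ℕ} (ε : ℝ) (x : EuclideanSpace ℝ (Fin d)) : ℝ :=
  (2 * Real.pi * ε) ^ (-((d : ℝ) / 2)) * Real.exp (-(‖x‖ ^ 2 / (2 * ε)))

/-- The partial derivative `∂p_ε/∂x_j`. -/
noncomputable def heatKernelPartial {d : ℕ} (ε : ℝ) (j : Fin d)
    (x : EuclideanSpace ℝ (Fin d)) : ℝ :=
  lineDeriv ℝ (heatKernel ε) x (EuclideanSpace.single j 1)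

/-- The approximation at level `ε` and at the spatial point `x` of the derivative in the `j`-th
coordinate of the self-intersection local time of `B` on `[0, t]`:
`-∫_0^t ∫_0^s (∂p_ε/∂x_j)(B_s - B_r - x) dr ds`. -/
noncomputable def approxDSLT {Ω : Type*} {d : ℕ} (B : ℝ≥0 → Ω → EuclideanSpace ℝ (Fin d))
    (j : Fin d) (t ε : ℝ) (x : EuclideanSpace ℝ (Fin d)) (ω : Ω) : ℝ :=
  -∫ s in (0 : ℝ)..t, ∫ r in (0 : ℝ)..s,
    heatKernelPartial ε j (B s.toNNReal ω - B r.toNNReal ω - x)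

/-- The limiting variance
`t^(2H) B(1/H, d/2 + 1 - 1/H)² / (2^(d+2) π^d H²)`, with `B(·,·)` the Beta function. -/
noncomputable def limitVariance (d : ℕ) (H t : ℝ) : ℝ :=
  t ^ (2 * H) / (2 ^ (d + 2) * Real.pi ^ d * H ^ 2) *
    ProbabilityTheory.beta (1 / H) ((d : ℝ) / 2 + 1 - 1 / H) ^ 2

/-! The limit is already visible on the given probability space: the rescaled functional converges
in mean square to `c * B_t^j` for a deterministic constant `c`, so the limit law is that of a
Gaussian variable.

By self-similarity the functional at level `ε` on `[0, t]` is a multiple of the level-one functional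
`A_T = ∫∫ x_j exp(-|x|²/2)` evaluated at increments, over the long interval `[0, T]` with `T = t
ε^(-1/(2H))` (`rpow_mul_approxDSLT`). It then suffices that `E (A_T - m B_T^j)² = o(T^q)`, where `q
= 2H`, `p = d/2 + 1` and `m = ∫_0^∞ u (1 + u^q)^(-p) du`, a Beta integral
(`integral_id_mul_one_add_rpow_neg`).

This mean square is an explicit deterministic expression (`integral_selfIntersection_sub_sq`).
Gaussian integration gives `E A_T² = ∫∫ μ D^(-p)`, where `μ` is the covariance of two increments of
lengths `u`, `v` and `D = (1 + u^q)(1 + v^q) - μ²`. Replacing `D` by the product `(1 + u^q)(1 +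
v^q)` leaves the variance of the first chaos. That variance telescopes, because `μ` is a second
difference of the covariance function, and is at most `T^q m_T²` with `m_T → m`
(`integral_incrCov_weight_le`). The cross term `E A_T B_T^j` telescopes likewise, to at least `T^q
m_T - o(T^q)` (`le_integral_fbmCov_weight`).

The main work is to show that the higher chaoses are negligible (`exists_kernel_bound`). For
intervals far apart relative to their lengths, `μ²` is small against `u^q v^q` and the ratio of the
two kernels is at most `1 + ε`. For nearby intervals a quantitative strict Cauchy–Schwarz inequality
(`exists_evenPow_gap`) keeps `D` away from degeneracy, and the contribution is `O(T)`. This is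
`o(T^q)` because `q > 1`. Collecting terms, `(1 + δ) m² - 2 m² + m² = δ m²` with `δ` arbitrary. -/

/-! ### Gaussian integrals in one and two variables. -/

/-- Exponential tilting of a centered Gaussian measure by a shifted Gaussian weight. -/
theorem integral_mul_exp_neg_sq_gaussianReal (f : ℝ → ℝ) (κ v : ℝ≥0) (m : ℝ) :
    ∫ w, f w * Real.exp (-(κ * (m + w) ^ 2 / 2)) ∂gaussianReal 0 v =
      (√(1 + κ * v))⁻¹ * Real.exp (-(κ * m ^ 2 / (2 * (1 + κ * v)))) *
        ∫ w, f w ∂gaussianReal (-(m * κ * v / (1 + κ * v))) (v / (1 + κ * v)) := by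
  -- Variance zero is a Dirac mass, which has no density, so it is treated apart.
  rcases eq_or_ne v 0 with rfl | hv
  · simp [mul_comm]
  have hκ : (0 : ℝ) < 1 + κ * v := by positivity
  have hκ' : (1 + κ * v : ℝ≥0) ≠ 0 := by positivity
  have hv0 : (0 : ℝ) < v := by positivity
  rw [integral_gaussianReal_eq_integral_smul hv,
    integral_gaussianReal_eq_integral_smul (div_ne_zero hv hκ'), ← integral_const_mul]
  congr 1 with w
  simp only [gaussianPDFReal, smul_eq_mul, NNReal.coe_div, NNReal.coe_add, NNReal.coe_one,
    NNReal.coe_mul]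
  have h1 : √(2 * Real.pi * v) = √(1 + κ * v) * √(2 * Real.pi * (v / (1 + κ * v))) := by
    rw [← Real.sqrt_mul hκ.le]
    congr 1
    field_simp
  have h2 : Real.exp (-(w - 0) ^ 2 / (2 * v)) * Real.exp (-(κ * (m + w) ^ 2 / 2)) =
      Real.exp (-(κ * m ^ 2 / (2 * (1 + κ * v)))) *
        Real.exp (-(w - -(m * κ * v / (1 + κ * v))) ^ 2 / (2 * (v / (1 + κ * v)))) := by
    rw [← Real.exp_add, ← Real.exp_add]
    congr 1
    field_simp
    ring
  rw [h1, mul_inv]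
  linear_combination ((√(1 + κ * v))⁻¹ * (√(2 * Real.pi * (v / (1 + κ * v))))⁻¹ * f w) * h2

theorem integral_sq_gaussianReal (v : ℝ≥0) : ∫ x, x ^ 2 ∂gaussianReal 0 v = v := by
  have h := variance_id_gaussianReal (μ := 0) (v := v)
  rw [variance_of_integral_eq_zero aemeasurable_id (by simp)] at h
  simpa using h

theorem integral_exp_neg_sq_gaussianReal (κ v : ℝ≥0) (m : ℝ) :
    ∫ w, Real.exp (-(κ * (m + w) ^ 2 / 2)) ∂gaussianReal 0 v =
      (√(1 + κ * v))⁻¹ * Real.exp (-(κ * m ^ 2 / (2 * (1 + κ * v)))) := by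
  simpa using integral_mul_exp_neg_sq_gaussianReal (fun _ ↦ 1) κ v m

theorem integral_add_mul_exp_neg_sq_gaussianReal (v : ℝ≥0) (m : ℝ) :
    ∫ w, (m + w) * Real.exp (-((m + w) ^ 2 / 2)) ∂gaussianReal 0 v =
      (√(1 + v))⁻¹ * Real.exp (-(m ^ 2 / (2 * (1 + v)))) * (m / (1 + v)) := by
  have h := integral_mul_exp_neg_sq_gaussianReal (fun w ↦ m + w) 1 v m
  have hi : Integrable (fun w : ℝ ↦ w) (gaussianReal (-(m * v / (1 + v))) (v / (1 + v))) :=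
    (memLp_id_gaussianReal 1).integrable le_rfl
  simp only [NNReal.coe_one, one_mul, mul_one] at h
  rw [h, integral_add (integrable_const _) hi, integral_id_gaussianReal]
  simp only [integral_const, probReal_univ, smul_eq_mul, one_mul]
  have : (0 : ℝ) < 1 + v := by positivity
  field_simp
  ring

theorem integral_sq_mul_exp_neg_sq_gaussianReal (κ v : ℝ≥0) :
    ∫ x, x ^ 2 * Real.exp (-(κ * x ^ 2 / 2)) ∂gaussianReal 0 v =
      (√(1 + κ * v))⁻¹ * (v / (1 + κ * v)) := by
  have h := integral_mul_exp_neg_sq_gaussianReal (fun w ↦ w ^ 2) κ v 0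
  simpa [integral_sq_gaussianReal] using h

theorem abs_mul_exp_neg_sq_le_one (x : ℝ) : |x * Real.exp (-(x ^ 2 / 2))| ≤ 1 := by
  rw [abs_mul, Real.abs_exp, Real.exp_neg, ← div_eq_mul_inv, div_le_one (Real.exp_pos _)]
  have h1 := Real.add_one_le_exp (x ^ 2 / 2)
  have h2 : |x| ^ 2 = x ^ 2 := sq_abs x
  nlinarith [sq_nonneg (|x| - 1)]

/-- Linear regression for a centered Gaussian pair. -/
theorem map_gaussian_pair_eq {Ω : Type*} [MeasurableSpace Ω] {P : Measure Ω}
    [IsProbabilityMeasure P] {X Y : Ω → ℝ} (h : HasGaussianLaw (fun ω ↦ (X ω, Y ω)) P)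
    (hX : ∫ ω, X ω ∂P = 0) (hY : ∫ ω, Y ω ∂P = 0) {a b c : ℝ}
    (ha : ∫ ω, X ω * X ω ∂P = a) (hb : ∫ ω, Y ω * Y ω ∂P = b) (hc : ∫ ω, X ω * Y ω ∂P = c) :
    ∃ (l τ : ℝ≥0) (k : ℝ), (l : ℝ) = a ∧ k * a = c ∧ τ + k ^ 2 * a = b ∧
      P.map (fun ω ↦ (X ω, Y ω)) =
        ((gaussianReal 0 l).prod (gaussianReal 0 τ)).map (fun z ↦ (z.1, k * z.1 + z.2)) := by
  have hX2 : MemLp X 2 P := h.fst.memLp_two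
  have hY2 : MemLp Y 2 P := h.snd.memLp_two
  have hXm := h.fst.aemeasurable
  have hYm := h.snd.aemeasurable
  have hXX : Integrable (fun ω ↦ X ω * X ω) P := hX2.integrable_mul hX2
  have hXY : Integrable (fun ω ↦ X ω * Y ω) P := hX2.integrable_mul hY2
  have hYY : Integrable (fun ω ↦ Y ω * Y ω) P := hY2.integrable_mul hY2
  have ha0 : 0 ≤ a := ha ▸ integral_nonneg fun ω ↦ mul_self_nonneg _
  obtain ⟨k, hk⟩ : ∃ k : ℝ, k * a = c := by
    -- If `X` has variance zero it vanishes almost surely, hence so does the covariance `c`, and any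
    -- slope serves.
    rcases eq_or_ne a 0 with h0 | h0
    · refine ⟨0, ?_⟩
      rw [h0] at ha
      have h1 := (integral_eq_zero_iff_of_nonneg (fun ω ↦ mul_self_nonneg (X ω)) hXX).1 ha
      rw [← hc, zero_mul, integral_eq_zero_of_ae]
      filter_upwards [h1] with ω hω
      have : X ω = 0 := by simpa using hω
      simp [this]
    · exact ⟨c / a, by field_simp⟩
  have hjoint : HasGaussianLaw (fun ω ↦ (X ω, Y ω - k * X ω)) P :=
    h.map_fun ((ContinuousLinearMap.fst ℝ ℝ ℝ).prod
      (ContinuousLinearMap.snd ℝ ℝ ℝ - k • ContinuousLinearMap.fst ℝ ℝ ℝ))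
  have hW2 : MemLp (fun ω ↦ Y ω - k * X ω) 2 P := hjoint.snd.memLp_two
  have hW0 : ∫ ω, (Y ω - k * X ω) ∂P = 0 := by
    rw [integral_sub (hY2.integrable one_le_two) ((hX2.integrable one_le_two).const_mul k),
      integral_const_mul, hX, hY]
    simp
  have hcov : cov[X, fun ω ↦ Y ω - k * X ω; P] = 0 := by
    rw [covariance_eq_sub hX2 hW2, hX, zero_mul, sub_zero]
    have : ∀ ω, (X * fun ω ↦ Y ω - k * X ω) ω = X ω * Y ω - k * (X ω * X ω) := fun ω ↦ by
      simp only [Pi.mul_apply]; ring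
    simp_rw [this]
    rw [integral_sub hXY (hXX.const_mul k), integral_const_mul, ha, hc, hk, sub_self]
  have hind := hjoint.indepFun_of_covariance_eq_zero hcov
  have hWm := hjoint.snd.aemeasurable
  have hvX : Var[X; P] = a := by
    rw [variance_of_integral_eq_zero hXm hX, ← ha]
    simp only [sq]
  have hvW : Var[fun ω ↦ Y ω - k * X ω; P] = b - k ^ 2 * a := by
    rw [variance_of_integral_eq_zero hWm hW0]
    have : ∀ ω, ((fun ω ↦ Y ω - k * X ω) ω) ^ 2 =
        Y ω * Y ω - 2 * k * (X ω * Y ω) + k ^ 2 * (X ω * X ω) := fun ω ↦ by ring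
    simp_rw [this]
    rw [integral_add (f := fun ω ↦ Y ω * Y ω - 2 * k * (X ω * Y ω))
      (hYY.sub (hXY.const_mul _)) (hXX.const_mul _),
      integral_sub hYY (hXY.const_mul _), integral_const_mul, integral_const_mul, ha, hb, hc, ← hk]
    ring
  have hlawX := h.fst.map_eq_gaussianReal
  have hlawW := hjoint.snd.map_eq_gaussianReal
  rw [hX, hvX] at hlawX
  rw [hW0, hvW] at hlawW
  have hτ : 0 ≤ b - k ^ 2 * a := hvW ▸ variance_nonneg _ _
  refine ⟨a.toNNReal, (b - k ^ 2 * a).toNNReal, k, Real.coe_toNNReal _ ha0, hk, ?_, ?_⟩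
  · rw [Real.coe_toNNReal _ hτ]; ring
  rw [← hlawX, ← hlawW, ← (indepFun_iff_map_prod_eq_prod_map_map hXm hWm).1 hind,
    AEMeasurable.map_map_of_aemeasurable (by fun_prop) (hXm.prodMk hWm)]
  congr 1
  ext ω <;> simp

section Pair

variable {Ω : Type*} [MeasurableSpace Ω] {P : Measure Ω} [IsProbabilityMeasure P] {X Y : Ω → ℝ}
  {a b c : ℝ}

/-- Write `Y = kX + W` with `W` independent of `X` and of variance `τ`. Integrating `W` out first
only changes the Gaussian weight of `X` from `1` to `κ = 1 + k²/(1 + τ)`, so a one-dimensional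
integral remains. The quantity `(1 + a)(1 + b) - c²` is the determinant of identity plus covariance
matrix, and it factors as `(1 + τ)(1 + κ a)`. -/
theorem integral_exp_gaussian_pair (h : HasGaussianLaw (fun ω ↦ (X ω, Y ω)) P)
    (hX : ∫ ω, X ω ∂P = 0) (hY : ∫ ω, Y ω ∂P = 0)
    (ha : ∫ ω, X ω * X ω ∂P = a) (hb : ∫ ω, Y ω * Y ω ∂P = b) (hc : ∫ ω, X ω * Y ω ∂P = c) :
    0 < (1 + a) * (1 + b) - c ^ 2 ∧
    ∫ ω, Real.exp (-(X ω ^ 2 / 2)) * Real.exp (-(Y ω ^ 2 / 2)) ∂P =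
      (√((1 + a) * (1 + b) - c ^ 2))⁻¹ ∧
    ∫ ω, (X ω * Real.exp (-(X ω ^ 2 / 2))) * (Y ω * Real.exp (-(Y ω ^ 2 / 2))) ∂P =
      (√((1 + a) * (1 + b) - c ^ 2))⁻¹ * (c / ((1 + a) * (1 + b) - c ^ 2)) := by
  obtain ⟨l, τ, k, rfl, rfl, rfl, hmap⟩ := map_gaussian_pair_eq h hX hY ha hb hc
  have hm : AEMeasurable (fun ω ↦ (X ω, Y ω)) P := h.aemeasurable
  have hD : (1 + l : ℝ) * (1 + (τ + k ^ 2 * l)) - (k * l) ^ 2 =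
      (1 + τ) * (1 + (1 + k ^ 2 / (1 + τ)) * l) := by
    have : (0 : ℝ) < 1 + τ := by positivity
    field_simp
    ring
  have hτ : (0 : ℝ) < 1 + τ := by positivity
  have hκ : (0 : ℝ) < 1 + (1 + k ^ 2 / (1 + τ)) * l := by positivity
  obtain ⟨κ, hκ'⟩ : ∃ κ : ℝ≥0, (κ : ℝ) = 1 + k ^ 2 / (1 + τ) := ⟨⟨_, by positivity⟩, rfl⟩
  rw [hD]
  refine ⟨by positivity, ?_, ?_⟩
  · have h1 := integral_map (μ := P) hm (f := fun z : ℝ × ℝ ↦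
      Real.exp (-(z.1 ^ 2 / 2)) * Real.exp (-(z.2 ^ 2 / 2)))
      (Continuous.aestronglyMeasurable (by fun_prop))
    rw [← h1, hmap, integral_map (by fun_prop) (Continuous.aestronglyMeasurable (by fun_prop)),
      integral_prod]
    · simp only [integral_const_mul]
      have h2 : ∀ x : ℝ, ∫ w, Real.exp (-((k * x + w) ^ 2 / 2)) ∂gaussianReal 0 τ =
          (√(1 + τ))⁻¹ * Real.exp (-((k * x) ^ 2 / (2 * (1 + τ)))) := fun x ↦ by
        simpa using integral_exp_neg_sq_gaussianReal 1 τ (k * x)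
      simp_rw [h2]
      have h3 := integral_exp_neg_sq_gaussianReal κ l 0
      simp only [hκ', zero_add] at h3
      have h4 : ∀ x : ℝ, Real.exp (-(x ^ 2 / 2)) *
          ((√(1 + τ))⁻¹ * Real.exp (-((k * x) ^ 2 / (2 * (1 + τ))))) =
          (√(1 + τ))⁻¹ * Real.exp (-((1 + k ^ 2 / (1 + τ)) * x ^ 2 / 2)) := fun x ↦ by
        rw [mul_left_comm, ← Real.exp_add]
        congr 2
        field_simp
        ring
      simp_rw [h4]
      rw [integral_const_mul, h3, Real.sqrt_mul hτ.le, mul_inv]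
      simp
    · refine Integrable.of_bound (C := 1) (Continuous.aestronglyMeasurable (by fun_prop)) ?_
      filter_upwards with z
      rw [Real.norm_eq_abs, abs_of_pos (by positivity), ← Real.exp_add, Real.exp_le_one_iff]
      nlinarith [sq_nonneg z.1, sq_nonneg (k * z.1 + z.2)]
  · have h1 := integral_map (μ := P) hm (f := fun z : ℝ × ℝ ↦
      (z.1 * Real.exp (-(z.1 ^ 2 / 2))) * (z.2 * Real.exp (-(z.2 ^ 2 / 2))))
      (Continuous.aestronglyMeasurable (by fun_prop))
    rw [← h1, hmap, integral_map (by fun_prop) (Continuous.aestronglyMeasurable (by fun_prop)),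
      integral_prod]
    · simp only [integral_const_mul, integral_add_mul_exp_neg_sq_gaussianReal]
      have h3 := integral_sq_mul_exp_neg_sq_gaussianReal κ l
      rw [hκ'] at h3
      have h4 : ∀ x : ℝ, x * Real.exp (-(x ^ 2 / 2)) *
          ((√(1 + τ))⁻¹ * Real.exp (-((k * x) ^ 2 / (2 * (1 + τ)))) * (k * x / (1 + τ))) =
          (√(1 + τ))⁻¹ * (k / (1 + τ)) *
            (x ^ 2 * Real.exp (-((1 + k ^ 2 / (1 + τ)) * x ^ 2 / 2))) := fun x ↦ by
        have : Real.exp (-((1 + k ^ 2 / (1 + τ)) * x ^ 2 / 2)) =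
            Real.exp (-(x ^ 2 / 2)) * Real.exp (-((k * x) ^ 2 / (2 * (1 + τ)))) := by
          rw [← Real.exp_add]
          congr 1
          field_simp
          ring
        rw [this]
        ring
      simp_rw [h4]
      rw [integral_const_mul, h3, Real.sqrt_mul hτ.le, mul_inv]
      field_simp
    · refine Integrable.of_bound (C := 1) (Continuous.aestronglyMeasurable (by fun_prop)) ?_
      filter_upwards with z
      rw [norm_mul, Real.norm_eq_abs, Real.norm_eq_abs]
      exact mul_le_one₀ (abs_mul_exp_neg_sq_le_one _) (abs_nonneg _)
        (abs_mul_exp_neg_sq_le_one _)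

/-- Here `Y` carries no exponential weight. The second formula feeds the correlation of the
functional with the end point of the process; the independent part of `Y` contributes nothing,
having mean zero. -/
theorem integral_exp_gaussian (h : HasGaussianLaw (fun ω ↦ (X ω, Y ω)) P)
    (hX : ∫ ω, X ω ∂P = 0) (hY : ∫ ω, Y ω ∂P = 0)
    (ha : ∫ ω, X ω * X ω ∂P = a) (hb : ∫ ω, Y ω * Y ω ∂P = b) (hc : ∫ ω, X ω * Y ω ∂P = c) :
    ∫ ω, Real.exp (-(X ω ^ 2 / 2)) ∂P = (√(1 + a))⁻¹ ∧
    ∫ ω, X ω * Real.exp (-(X ω ^ 2 / 2)) * Y ω ∂P = (√(1 + a))⁻¹ * (c / (1 + a)) := by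
  obtain ⟨l, τ, k, rfl, rfl, rfl, hmap⟩ := map_gaussian_pair_eq h hX hY ha hb hc
  have hm : AEMeasurable (fun ω ↦ (X ω, Y ω)) P := h.aemeasurable
  constructor
  · have h1 := integral_map (μ := P) hm (f := fun z : ℝ × ℝ ↦ Real.exp (-(z.1 ^ 2 / 2)))
      (Continuous.aestronglyMeasurable (by fun_prop))
    rw [← h1, hmap, integral_map (by fun_prop) (Continuous.aestronglyMeasurable (by fun_prop))]
    have := integral_fun_fst (μ := gaussianReal 0 l) (ν := gaussianReal 0 τ)
      (fun x ↦ Real.exp (-(x ^ 2 / 2)))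
    simp only at this ⊢
    rw [this]
    simpa using integral_exp_neg_sq_gaussianReal 1 l 0
  · have h1 := integral_map (μ := P) hm (f := fun z : ℝ × ℝ ↦
      z.1 * Real.exp (-(z.1 ^ 2 / 2)) * z.2)
      (Continuous.aestronglyMeasurable (by fun_prop))
    rw [← h1, hmap, integral_map (by fun_prop) (Continuous.aestronglyMeasurable (by fun_prop))]
    have hi : Integrable (fun x : ℝ ↦ x ^ 2 * Real.exp (-(x ^ 2 / 2))) (gaussianReal 0 l) := by
      have := (memLp_id_gaussianReal (μ := 0) (v := l) 2).integrable_sq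
      refine this.mul_bdd (c := 1) (Continuous.aestronglyMeasurable (by fun_prop)) ?_
      filter_upwards with x
      rw [Real.norm_eq_abs, Real.abs_exp, Real.exp_le_one_iff]
      nlinarith [sq_nonneg x]
    have hi2 : Integrable (fun x : ℝ ↦ x * Real.exp (-(x ^ 2 / 2))) (gaussianReal 0 l) := by
      refine Integrable.of_bound (C := 1) (Continuous.aestronglyMeasurable (by fun_prop)) ?_
      filter_upwards with z
      exact abs_mul_exp_neg_sq_le_one _
    have hi3 : Integrable (fun w : ℝ ↦ w) (gaussianReal 0 τ) :=
      (memLp_id_gaussianReal 1).integrable le_rfl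
    have h2 : ∀ z : ℝ × ℝ, z.1 * Real.exp (-(z.1 ^ 2 / 2)) * (k * z.1 + z.2) =
        k * (z.1 ^ 2 * Real.exp (-(z.1 ^ 2 / 2)) * 1) +
          z.1 * Real.exp (-(z.1 ^ 2 / 2)) * z.2 := fun z ↦ by ring
    simp only [h2]
    rw [integral_add ((hi.mul_prod (integrable_const 1)).const_mul k) (hi2.mul_prod hi3),
      integral_const_mul,
      integral_prod_mul (fun x ↦ x ^ 2 * Real.exp (-(x ^ 2 / 2))) (fun _ ↦ (1 : ℝ)),
      integral_prod_mul (fun x ↦ x * Real.exp (-(x ^ 2 / 2))) (fun x ↦ x)]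
    have h3 := integral_sq_mul_exp_neg_sq_gaussianReal 1 l
    simp only [NNReal.coe_one, one_mul] at h3
    simp only [h3, integral_id_gaussianReal]
    simp
    ring

end Pair

/-! ### The Beta integral giving the constant in the limit variance. -/

/-- The Beta integral `∫_0^∞ u (1 + u^q)^(-p) du = B(2/q, p - 2/q) / q`. -/
theorem integral_id_mul_one_add_rpow_neg {p q : ℝ} (hq : 0 < q) (hpq : 2 / q < p) :
    ∫ u in Set.Ioi (0 : ℝ), u * (1 + u ^ q) ^ (-p) =
      1 / q * ProbabilityTheory.beta (2 / q) (p - 2 / q) := by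
  have h2q : 0 < 2 / q := by positivity
  have hp : 0 < p := h2q.trans hpq
  have hG := Real.Gamma_pos_of_pos hp
  -- The negative power is written as a Gamma integral in `x`; after exchanging the order, the
  -- `u`-integral is again of Gamma type.
  have key1 : ∀ u ∈ Set.Ioi (0 : ℝ), u * (1 + u ^ q) ^ (-p) = (Real.Gamma p)⁻¹ *
      ∫ x in Set.Ioi (0 : ℝ), u * (x ^ (p - 1) * Real.exp (-((1 + u ^ q) * x))) := by
    intro u hu
    have hu0 : 0 < u := hu
    have h1 : 0 < 1 + u ^ q := by positivity
    rw [integral_const_mul, Real.integral_rpow_mul_exp_neg_mul_Ioi hp h1, one_div,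
      Real.inv_rpow h1.le, Real.rpow_neg h1.le]
    field_simp
  have key2 : ∀ x ∈ Set.Ioi (0 : ℝ),
      ∫ u in Set.Ioi (0 : ℝ), u * (x ^ (p - 1) * Real.exp (-((1 + u ^ q) * x))) =
      1 / q * Real.Gamma (2 / q) * (x ^ (p - 2 / q - 1) * Real.exp (-(1 * x))) := by
    intro x hx
    have hx0 : 0 < x := hx
    have h1 := integral_rpow_mul_exp_neg_mul_rpow hq (q := 1) (by norm_num) hx0
    have h2 : ∀ u : ℝ, u * (x ^ (p - 1) * Real.exp (-((1 + u ^ q) * x))) =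
        x ^ (p - 1) * Real.exp (-x) * (u ^ (1 : ℝ) * Real.exp (-x * u ^ q)) := fun u ↦ by
      rw [Real.rpow_one, show -((1 + u ^ q) * x) = -x + -x * u ^ q by ring, Real.exp_add]
      ring
    simp_rw [h2]
    rw [integral_const_mul, h1, show p - 2 / q - 1 = (p - 1) + (-(1 + 1) / q) by ring,
      Real.rpow_add hx0]
    norm_num
    ring
  rw [setIntegral_congr_fun measurableSet_Ioi key1, integral_const_mul]
  have hmeas : AEStronglyMeasurable (Function.uncurry fun u x : ℝ ↦
      u * (x ^ (p - 1) * Real.exp (-((1 + u ^ q) * x))))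
      ((volume.restrict (Set.Ioi 0)).prod (volume.restrict (Set.Ioi 0))) := by
    apply Measurable.aestronglyMeasurable
    unfold Function.uncurry
    fun_prop
  rw [integral_integral_swap, setIntegral_congr_fun measurableSet_Ioi key2, integral_const_mul,
    Real.integral_rpow_mul_exp_neg_mul_Ioi (by linarith) one_pos, ProbabilityTheory.beta]
  · simp
    field_simp
  · have hcongr : ∀ x ∈ Set.Ioi (0 : ℝ),
        ∫ u in Set.Ioi (0 : ℝ), ‖u * (x ^ (p - 1) * Real.exp (-((1 + u ^ q) * x)))‖ =
        1 / q * Real.Gamma (2 / q) * (x ^ (p - 2 / q - 1) * Real.exp (-(1 * x))) := by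
      intro x hx
      rw [← key2 x hx]
      refine setIntegral_congr_fun measurableSet_Ioi fun u hu ↦ ?_
      have hx0 : 0 < x := hx
      have hu0 : 0 < u := hu
      exact Real.norm_of_nonneg (by positivity)
    rw [integrable_prod_iff' hmeas]
    constructor
    · filter_upwards [ae_restrict_mem measurableSet_Ioi] with x hx
      have hx0 : 0 < x := hx
      -- The Bochner integral of a non-integrable function is zero, so a positive value of the
      -- integral proves integrability.
      refine Integrable.of_integral_ne_zero ?_
      have := key2 x hx
      simp only [Function.uncurry_apply_pair]
      rw [this]
      have := Real.Gamma_pos_of_pos h2q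
      positivity
    · refine Integrable.of_integral_ne_zero ?_
      simp only [Function.uncurry_apply_pair]
      rw [setIntegral_congr_fun measurableSet_Ioi hcongr, integral_const_mul,
        Real.integral_rpow_mul_exp_neg_mul_Ioi (by linarith) one_pos]
      have := Real.Gamma_pos_of_pos h2q
      have := Real.Gamma_pos_of_pos (show 0 < p - 2 / q by linarith)
      positivity

/-! ### Convexity inequalities for `|x + y|^q + |x - y|^q` with `1 < q < 2`. -/

/-- A convex function has larger sum of values at the outer pair of points. -/
theorem ConvexOn.add_le_add_of_add_eq {s : Set ℝ} {f : ℝ → ℝ} (hf : ConvexOn ℝ s f)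
    {a b c d : ℝ} (ha : a ∈ s) (hd : d ∈ s) (hab : a ≤ b) (hbd : b ≤ d) (h : a + d = b + c) :
    f b + f c ≤ f a + f d := by
  rcases eq_or_lt_of_le (hab.trans hbd) with had | had
  · have hb : b = a := le_antisymm (hbd.trans had.ge) hab
    have hc : c = d := by linarith
    rw [hb, hc]
  have hda : 0 < d - a := by linarith
  set t := (b - a) / (d - a) with ht
  have ht0 : 0 ≤ t := div_nonneg (by linarith) hda.le
  have ht1 : t ≤ 1 := (div_le_one hda).2 (by linarith)
  have htd : t * (d - a) = b - a := by rw [ht]; field_simp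
  have hb : b = (1 - t) * a + t * d := by linear_combination -htd
  have hc : c = t * a + (1 - t) * d := by linear_combination htd - h
  have h1 := hf.2 ha hd (sub_nonneg.2 ht1) ht0 (by ring)
  have h2 := hf.2 ha hd ht0 (sub_nonneg.2 ht1) (by ring)
  simp only [smul_eq_mul] at h1 h2
  rw [← hb] at h1
  rw [← hc] at h2
  linarith

theorem ConcaveOn.add_le_add_of_add_eq {s : Set ℝ} {f : ℝ → ℝ} (hf : ConcaveOn ℝ s f)
    {a b c d : ℝ} (ha : a ∈ s) (hd : d ∈ s) (hab : a ≤ b) (hbd : b ≤ d) (h : a + d = b + c) :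
    f a + f d ≤ f b + f c := by
  have := hf.neg.add_le_add_of_add_eq ha hd hab hbd h
  simp only [Pi.neg_apply] at this
  linarith

theorem convexOn_abs_rpow {q : ℝ} (hq : 1 ≤ q) : ConvexOn ℝ Set.univ fun x : ℝ ↦ |x| ^ q := by
  have h : ConvexOn ℝ Set.univ (fun x : ℝ ↦ |x|) := by
    exact convexOn_univ_norm (E := ℝ)
  have himg : (fun x : ℝ ↦ |x|) '' Set.univ ⊆ Set.Ici 0 := by
    rintro _ ⟨x, -, rfl⟩
    exact abs_nonneg x
  exact ConvexOn.comp (g := fun x : ℝ ↦ x ^ q)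
    ((convexOn_rpow hq).subset himg (by
      rw [Set.image_univ]
      have : Set.range (fun x : ℝ ↦ |x|) = Set.Ici 0 := by
        ext y
        exact ⟨fun ⟨x, hx⟩ ↦ hx ▸ abs_nonneg x, fun hy ↦ ⟨y, abs_of_nonneg hy⟩⟩
      rw [this]
      exact convex_Ici 0)) h
    (fun x hx y _ hxy ↦ Real.rpow_le_rpow (himg hx) hxy (by linarith))

/-- The even function `y ↦ |x + y|^q + |x - y|^q`. -/
noncomputable def evenPow (q x y : ℝ) : ℝ := |x + y| ^ q + |x - y| ^ q

theorem evenPow_comm (q x y : ℝ) : evenPow q x y = evenPow q y x := by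
  rw [evenPow, evenPow, add_comm x y, abs_sub_comm]

theorem evenPow_abs_right (q x y : ℝ) : evenPow q x |y| = evenPow q x y := by
  rcases abs_choice y with h | h <;> rw [h]
  rw [evenPow, evenPow, sub_neg_eq_add, ← sub_eq_add_neg, add_comm]

theorem evenPow_abs_left (q x y : ℝ) : evenPow q |x| y = evenPow q x y := by
  rw [evenPow_comm, evenPow_abs_right, evenPow_comm]

theorem evenPow_zero_left (q : ℝ) {y : ℝ} (hy : 0 ≤ y) : evenPow q 0 y = 2 * y ^ q := by
  rw [evenPow, zero_add, zero_sub, abs_neg, abs_of_nonneg hy, two_mul]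

theorem evenPow_mono {q c x y : ℝ} (hq : 1 ≤ q) (hx : 0 ≤ x) (hxy : x ≤ y) :
    evenPow q c x ≤ evenPow q c y := by
  have := (convexOn_abs_rpow hq).add_le_add_of_add_eq (a := c - y) (d := c + y) (b := c + x)
    (c := c - x) (Set.mem_univ _) (Set.mem_univ _) (by linarith) (by linarith) (by ring)
  rw [evenPow, evenPow]
  linarith

theorem abs_rpow_mul_self {q x : ℝ} (hq : 1 < q) (hx : 0 ≤ x) : |x| ^ (q - 2) * x = x ^ (q - 1) := by
  rcases eq_or_lt_of_le hx with rfl | hx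
  · rw [mul_zero, Real.zero_rpow (by linarith)]
  · rw [abs_of_pos hx, show q - 1 = q - 2 + 1 by ring, Real.rpow_add_one hx.ne']

theorem hasDerivAt_evenPow_left {q : ℝ} (hq : 1 < q) (c y : ℝ) :
    HasDerivAt (fun c ↦ evenPow q c y)
      (q * (|c + y| ^ (q - 2) * (c + y) + |c - y| ^ (q - 2) * (c - y))) c := by
  have h1 := (hasDerivAt_abs_rpow (c + y) hq).comp c ((hasDerivAt_id c).add_const y)
  have h2 := (hasDerivAt_abs_rpow (c - y) hq).comp c ((hasDerivAt_id c).sub_const y)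
  have h3 := h1.add h2
  convert! h3 using 1
  ring

/-- Up to the factor `q` these are derivatives in `c` of `evenPow`. The odd function `|z|^(q-2) z`
is concave on the half line since `q - 1 < 1`. Comparing an inner with an outer pair of points of
equal sum gives the cases `y ≤ c` and `c ≤ x`; the mixed case passes through the point `c`. -/
theorem oddPow_add_le {q c x y : ℝ} (hq : 1 < q) (hq2 : q < 2) (hc : 0 ≤ c) (hx : 0 ≤ x)
    (hxy : x ≤ y) :
    |c + y| ^ (q - 2) * (c + y) + |c - y| ^ (q - 2) * (c - y) ≤
      |c + x| ^ (q - 2) * (c + x) + |c - x| ^ (q - 2) * (c - x) := by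
  have hconc : ConcaveOn ℝ (Set.Ici 0) fun x : ℝ ↦ x ^ (q - 1) :=
    Real.concaveOn_rpow (by linarith) (by linarith)
  have hneg : ∀ z : ℝ, |c - z| ^ (q - 2) * (c - z) = -(|z - c| ^ (q - 2) * (z - c)) := fun z ↦ by
    rw [abs_sub_comm]; ring
  have case1 : ∀ {x y : ℝ}, 0 ≤ x → x ≤ y → y ≤ c →
      |c + y| ^ (q - 2) * (c + y) + |c - y| ^ (q - 2) * (c - y) ≤
      |c + x| ^ (q - 2) * (c + x) + |c - x| ^ (q - 2) * (c - x) := by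
    intro x y hx hxy hyc
    rw [abs_rpow_mul_self hq (by linarith), abs_rpow_mul_self hq (by linarith),
      abs_rpow_mul_self hq (by linarith), abs_rpow_mul_self hq (by linarith)]
    have := hconc.add_le_add_of_add_eq (a := c - y) (d := c + y) (b := c - x) (c := c + x)
      (Set.mem_Ici.2 (by linarith)) (Set.mem_Ici.2 (by linarith)) (by linarith) (by linarith)
      (by ring)
    linarith
  have case2 : ∀ {x y : ℝ}, c ≤ x → x ≤ y →
      |c + y| ^ (q - 2) * (c + y) + |c - y| ^ (q - 2) * (c - y) ≤
      |c + x| ^ (q - 2) * (c + x) + |c - x| ^ (q - 2) * (c - x) := by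
    intro x y hcx hxy
    rw [hneg x, hneg y, abs_rpow_mul_self hq (by linarith), abs_rpow_mul_self hq (by linarith),
      abs_rpow_mul_self hq (by linarith), abs_rpow_mul_self hq (by linarith)]
    have := hconc.add_le_add_of_add_eq (a := x - c) (d := c + y) (b := y - c) (c := c + x)
      (Set.mem_Ici.2 (by linarith)) (Set.mem_Ici.2 (by linarith)) (by linarith) (by linarith)
      (by ring)
    linarith
  rcases le_total y c with h | h
  · exact case1 hx hxy h
  · rcases le_total c x with h' | h'
    · exact case2 h' hxy
    · exact (case2 le_rfl h).trans (case1 hx h' le_rfl)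

/-- In probabilistic terms, the covariance of two increments of fixed lengths decreases as their
centres move apart. The sign of the derivative in `c` is `oddPow_add_le`. -/
theorem evenPow_sub_antitoneOn {q x y : ℝ} (hq : 1 < q) (hq2 : q < 2) (hx : 0 ≤ x)
    (hxy : x ≤ y) : AntitoneOn (fun c ↦ evenPow q c y - evenPow q c x) (Set.Ici 0) := by
  have hd : ∀ c, HasDerivAt (fun c ↦ evenPow q c y - evenPow q c x) _ c := fun c ↦
    (hasDerivAt_evenPow_left hq c y).sub (hasDerivAt_evenPow_left hq c x)
  refine antitoneOn_of_deriv_nonpos (convex_Ici 0) (fun c _ ↦ (hd c).continuousAt.continuousWithinAt)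
    (fun c _ ↦ (hd c).differentiableAt.differentiableWithinAt) fun c hc ↦ ?_
  rw [interior_Ici, Set.mem_Ioi] at hc
  rw [(hd c).deriv, ← mul_sub]
  exact mul_nonpos_of_nonneg_of_nonpos (by linarith)
    (sub_nonpos.2 (oddPow_add_le hq hq2 hc.le hx hxy))

/-- Strict subadditivity of `x ^ θ`, quantitatively. -/
theorem rpow_add_rpow_sub_le {θ y z : ℝ} (hθ : 0 ≤ θ) (hθ1 : θ ≤ 1) (hy : 0 ≤ y) (hz : 0 ≤ z) :
    (2 - 2 ^ θ) * min (y ^ θ) (z ^ θ) ≤ y ^ θ + z ^ θ - (y + z) ^ θ := by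
  have aux : ∀ {y z : ℝ}, 0 ≤ y → y ≤ z → (2 - 2 ^ θ) * y ^ θ ≤ y ^ θ + z ^ θ - (y + z) ^ θ := by
    intro y z hy hyz
    have := (Real.concaveOn_rpow hθ hθ1).add_le_add_of_add_eq (a := y) (d := y + z) (b := z)
      (c := 2 * y) (Set.mem_Ici.2 hy) (Set.mem_Ici.2 (by linarith)) hyz (by linarith) (by ring)
    simp only [Real.mul_rpow zero_le_two hy] at this
    linarith
  rcases le_total y z with h | h
  · rw [min_eq_left (Real.rpow_le_rpow hy h hθ)]
    exact aux hy h
  · rw [min_eq_right (Real.rpow_le_rpow hz h hθ)]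
    have := aux hz h
    rw [add_comm z y] at this
    linarith

theorem rpow_eq_sq_rpow {q x : ℝ} (hx : 0 ≤ x) : x ^ q = (x ^ 2) ^ (q / 2) := by
  rw [← Real.rpow_natCast, ← Real.rpow_mul hx]
  congr 1
  push_cast
  ring

/-- Monotonicity in the distance, applied to the pair `x ≤ c / 2` between distances `0` and `c`,
reduces to `x = c / 2`, where both sides agree. -/
theorem le_evenPow_of_le_half {q c x : ℝ} (hq : 1 < q) (hq2 : q < 2) (hx : 0 ≤ x)
    (hxc : x ≤ c / 2) :
    ((3 / 2) ^ q - (1 / 2) ^ q) * c ^ q ≤ evenPow q c x - 2 * x ^ q := by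
  have hc : 0 ≤ c := by linarith
  have h := evenPow_sub_antitoneOn hq hq2 hx hxc (Set.mem_Ici.2 le_rfl) (Set.mem_Ici.2 hc) hc
  simp only at h
  rw [evenPow_zero_left q hx, evenPow_zero_left q (hx.trans hxc)] at h
  have h2 : evenPow q c (c / 2) = (3 / 2) ^ q * c ^ q + (1 / 2) ^ q * c ^ q := by
    rw [evenPow, abs_of_nonneg (by linarith), abs_of_nonneg (by linarith),
      ← Real.mul_rpow (by norm_num) hc, ← Real.mul_rpow (by norm_num) hc]
    congr 2 <;> ring
  have h3 : (c / 2) ^ q = (1 / 2) ^ q * c ^ q := by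
    rw [← Real.mul_rpow (by norm_num) hc]
    congr 1
    ring
  rw [h2, h3] at h
  linarith

/-- The squares `(c ± x)²` have mean `x² + c²`. Concavity of `z^(q/2)` bounds the mean of their
powers, and then `(1 + s)^(q/2) ≤ 1 + s` for `s ≥ 0`. -/
theorem evenPow_sub_le {q c x : ℝ} (hq : 0 ≤ q) (hq2 : q ≤ 2) (hx : 0 < x) :
    evenPow q c x - 2 * x ^ q ≤ 2 * x ^ (q - 2) * c ^ 2 := by
  have hθ : 0 ≤ q / 2 := by linarith
  have hθ1 : q / 2 ≤ 1 := by linarith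
  have h1 := (Real.concaveOn_rpow hθ hθ1).2 (Set.mem_Ici.2 (sq_nonneg |c + x|))
    (Set.mem_Ici.2 (sq_nonneg |c - x|)) (by norm_num : (0 : ℝ) ≤ 1 / 2)
    (by norm_num : (0 : ℝ) ≤ 1 / 2) (by norm_num)
  simp only [smul_eq_mul, sq_abs] at h1
  have h2 : 1 / 2 * (c + x) ^ 2 + 1 / 2 * (c - x) ^ 2 = x ^ 2 * (1 + c ^ 2 / x ^ 2) := by
    field_simp
    ring
  have h3 : (1 + c ^ 2 / x ^ 2) ^ (q / 2) ≤ 1 + c ^ 2 / x ^ 2 := by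
    have : 1 ≤ 1 + c ^ 2 / x ^ 2 := by
      have : 0 ≤ c ^ 2 / x ^ 2 := by positivity
      linarith
    simpa using Real.rpow_le_rpow_of_exponent_le this hθ1
  have hxq : 0 < x ^ q := Real.rpow_pos_of_pos hx q
  rw [h2, Real.mul_rpow (sq_nonneg x) (by positivity), ← rpow_eq_sq_rpow hx.le] at h1
  have h4 : x ^ (q - 2) = x ^ q / x ^ 2 := by
    rw [Real.rpow_sub hx]
    norm_cast
  have h5 : x ^ q * (1 + c ^ 2 / x ^ 2) ^ (q / 2) ≤ x ^ q * (1 + c ^ 2 / x ^ 2) :=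
    mul_le_mul_of_nonneg_left h3 hxq.le
  rw [evenPow, h4]
  have h6 : 2 * (x ^ q / x ^ 2) * c ^ 2 = 2 * (x ^ q * (1 + c ^ 2 / x ^ 2)) - 2 * x ^ q := by
    field_simp
    ring
  have h7 : ∀ z : ℝ, |z| ^ q = (z ^ 2) ^ (q / 2) := fun z ↦ by
    rw [rpow_eq_sq_rpow (abs_nonneg z), sq_abs]
  rw [h6, h7, h7]
  linarith

/-- Increments over distant intervals. -/
theorem evenPow_sub_le_of_le_half {q c x y : ℝ} (hq : 1 < q) (hq2 : q < 2) (hx : 0 ≤ x)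
    (hxy : x ≤ y) (hy : y ≤ c / 2) :
    evenPow q c y - evenPow q c x ≤ 2 * (c / 2) ^ (q - 2) * (y ^ 2 - x ^ 2) := by
  rcases eq_or_lt_of_le (show 0 ≤ c by linarith) with rfl | hc
  · have hx0 : x = 0 := by linarith
    have hy0 : y = 0 := by linarith
    simp [hx0, hy0]
  set K : ℝ := 2 * (c / 2) ^ (q - 2) with hK
  -- It suffices that `evenPow q c z - K z²` decreases on `[0, c/2]`, that is, that its derivative
  -- is nonpositive there.
  have hd : ∀ z, HasDerivAt (fun z ↦ evenPow q c z - K * z ^ 2) _ z := fun z ↦ by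
    have h1 := hasDerivAt_evenPow_left hq z c
    simp only [evenPow_comm q _ c] at h1
    exact h1.sub ((hasDerivAt_pow 2 z).const_mul K)
  have hanti : AntitoneOn (fun z ↦ evenPow q c z - K * z ^ 2) (Set.Icc 0 (c / 2)) := by
    refine antitoneOn_of_deriv_nonpos (convex_Icc _ _)
      (fun c _ ↦ (hd c).continuousAt.continuousWithinAt)
      (fun c _ ↦ (hd c).differentiableAt.differentiableWithinAt) fun z hz ↦ ?_
    rw [interior_Icc, Set.mem_Ioo] at hz
    obtain ⟨hz0, hz1⟩ := hz
    rw [(hd z).deriv]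
    have hcz : 0 < c - z := by linarith
    have e1 : |z - c| ^ (q - 2) * (z - c) = -(c - z) ^ (q - 1) := by
      rw [abs_sub_comm, ← abs_rpow_mul_self hq hcz.le]; ring
    rw [e1, abs_rpow_mul_self hq (by linarith)]
    -- Bernoulli's inequality for the exponent `q - 1 ≤ 1`, with `1 + s = (c + z)/(c - z)`.
    have e2 : (z + c) ^ (q - 1) ≤ (c - z) ^ (q - 1) + (q - 1) * (2 * z) * (c - z) ^ (q - 2) := by
      have := rpow_one_add_le_one_add_mul_self (s := 2 * z / (c - z)) (p := q - 1)
        ((by norm_num : (-1 : ℝ) ≤ 0).trans (by positivity)) (by linarith) (by linarith)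
      have e3 : z + c = (c - z) * (1 + 2 * z / (c - z)) := by field_simp; ring
      have e4 : (c - z) ^ (q - 1) = (c - z) ^ (q - 2) * (c - z) := by
        rw [show q - 1 = q - 2 + 1 by ring, Real.rpow_add_one hcz.ne']
      rw [e3, Real.mul_rpow hcz.le (by positivity)]
      calc _ ≤ (c - z) ^ (q - 1) * (1 + (q - 1) * (2 * z / (c - z))) := by gcongr
        _ = _ := by rw [e4]; field_simp
    have e5 : (c - z) ^ (q - 2) ≤ (c / 2) ^ (q - 2) :=
      Real.rpow_le_rpow_of_nonpos (by linarith) (by linarith) (by linarith)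
    have e6 : 0 < (c / 2) ^ (q - 2) := by positivity
    have e7 : (q - 1) * (2 * z) * (c - z) ^ (q - 2) ≤ (q - 1) * (2 * z) * (c / 2) ^ (q - 2) := by
      apply mul_le_mul_of_nonneg_left e5
      nlinarith
    have e8 : q * (q - 1) ≤ 2 := by nlinarith
    have e9 : q * ((z + c) ^ (q - 1) + -(c - z) ^ (q - 1)) ≤
        q * ((q - 1) * (2 * z) * (c / 2) ^ (q - 2)) := by
      apply mul_le_mul_of_nonneg_left _ (by linarith)
      linarith
    have e10 : q * ((q - 1) * (2 * z) * (c / 2) ^ (q - 2)) ≤ 2 * (2 * z * (c / 2) ^ (q - 2)) := by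
      have : 0 ≤ 2 * z * (c / 2) ^ (q - 2) := by positivity
      calc _ = (q * (q - 1)) * (2 * z * (c / 2) ^ (q - 2)) := by ring
        _ ≤ _ := mul_le_mul_of_nonneg_right e8 this
    rw [hK]
    norm_num
    linarith
  have := hanti ⟨hx, hxy.trans hy⟩ ⟨hx.trans hxy, hy⟩ hxy
  simp only at this
  linarith

/-- Upper bound at the concentric position: the Cauchy-Schwarz inequality for increments. -/
theorem evenPow_sub_le_of_nonneg {q c x y : ℝ} (hq : 1 < q) (hq2 : q < 2) (hx : 0 ≤ x)
    (hxy : x ≤ y) (hc : 0 ≤ c) : evenPow q c y - evenPow q c x ≤ 2 * (y ^ q - x ^ q) := by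
  have h := evenPow_sub_antitoneOn hq hq2 hx hxy (Set.mem_Ici.2 le_rfl) (Set.mem_Ici.2 hc) hc
  simp only [evenPow_zero_left q hx, evenPow_zero_left q (hx.trans hxy)] at h
  linarith

/-- The term at `x` gains at least `k0 c^q`, while the term at `y` costs at most `2 y^(q-2) c²`. The
smallness of `η` makes this cost at most half of the gain when `c ≤ η y`. -/
theorem le_evenPow_sub_evenPow {q k0 η c x y : ℝ} (hq : 1 < q) (hq2 : q < 2)
    (hk0 : k0 = (3 / 2) ^ q - (1 / 2) ^ q) (hη0 : 0 < η) (hη : η ^ (2 - q) ≤ k0 / 4)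
    (hx : 0 ≤ x) (hy : 0 < y) (hc : 0 ≤ c) (hxc : x ≤ c / 2) (hcy : c ≤ η * y) :
    k0 / 2 * c ^ q ≤ (evenPow q c x - 2 * x ^ q) - (evenPow q c y - 2 * y ^ q) := by
  have h2 := le_evenPow_of_le_half hq hq2 hx hxc
  rw [← hk0] at h2
  have h3 := evenPow_sub_le (c := c) (by linarith : 0 ≤ q) hq2.le hy
  have h4 : 2 * y ^ (q - 2) * c ^ 2 ≤ k0 / 2 * c ^ q := by
    rcases eq_or_lt_of_le hc with rfl | hc
    · simp [Real.zero_rpow (by linarith : q ≠ 0)]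
    have h5 : c ^ 2 = c ^ q * c ^ (2 - q) := by
      rw [← Real.rpow_add hc, show q + (2 - q) = (2 : ℕ) by norm_num, Real.rpow_natCast]
    have h6 : c ^ (2 - q) ≤ η ^ (2 - q) * y ^ (2 - q) := by
      rw [← Real.mul_rpow hη0.le hy.le]
      exact Real.rpow_le_rpow hc.le hcy (by linarith)
    have h7 : y ^ (q - 2) * y ^ (2 - q) = 1 := by
      rw [← Real.rpow_add hy]; simp
    have h8 : 0 < c ^ q := by positivity
    have h9 : 0 < y ^ (q - 2) := by positivity
    calc 2 * y ^ (q - 2) * c ^ 2 = 2 * y ^ (q - 2) * c ^ q * c ^ (2 - q) := by rw [h5]; ring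
      _ ≤ 2 * y ^ (q - 2) * c ^ q * (η ^ (2 - q) * y ^ (2 - q)) := by gcongr
      _ = 2 * c ^ q * η ^ (2 - q) * (y ^ (q - 2) * y ^ (2 - q)) := by ring
      _ ≤ 2 * c ^ q * (k0 / 4) := by rw [h7, mul_one]; gcongr
      _ = _ := by ring
  linarith

set_option maxHeartbeats 400000 in
/-- Quantitative strict Cauchy-Schwarz inequality for increments of fractional Brownian motion. -/
theorem exists_evenPow_gap {q : ℝ} (hq : 1 < q) (hq2 : q < 2) :
    ∃ k : ℝ, 0 < k ∧ k ≤ 1 ∧ ∀ x y c : ℝ, 0 ≤ x → x < y → 0 ≤ c →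
      k * (y ^ 2 - x ^ 2) ^ (q / 2) ≤
          (y ^ 2 - x ^ 2) ^ (q / 2) - 1 / 2 * (evenPow q c y - evenPow q c x) ∨
        (k * (c ^ q + x ^ q) ≤
          (y ^ 2 - x ^ 2) ^ (q / 2) - 1 / 2 * (evenPow q c y - evenPow q c x) ∧
          c ≤ 2 * y ∧ y ^ 2 ≤ 2 * (y ^ 2 - x ^ 2)) := by
  set θ := q / 2 with hθ
  have hθ0 : 0 < θ := by linarith
  have hθ1 : θ < 1 := by linarith
  set k0 : ℝ := (3 / 2) ^ q - (1 / 2) ^ q with hk0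
  have hk0pos : 0 < k0 := sub_pos.2 (Real.rpow_lt_rpow (by norm_num) (by norm_num) (by linarith))
  set a : ℝ := 2 - 2 ^ θ with ha
  have hapos : 0 < a := by
    have : (2 : ℝ) ^ θ < 2 ^ (1 : ℝ) := Real.rpow_lt_rpow_of_exponent_lt (by norm_num) hθ1
    rw [Real.rpow_one] at this
    linarith
  obtain ⟨η, hη0, hη1, hη⟩ : ∃ η : ℝ, 0 < η ∧ η ≤ 1 ∧ η ^ (2 - q) ≤ k0 / 4 := by
    refine ⟨min 1 ((k0 / 4) ^ (1 / (2 - q))), by positivity, min_le_left _ _, ?_⟩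
    calc (min 1 ((k0 / 4) ^ (1 / (2 - q)))) ^ (2 - q)
        ≤ ((k0 / 4) ^ (1 / (2 - q))) ^ (2 - q) :=
          Real.rpow_le_rpow (by positivity) (min_le_right _ _) (by linarith)
      _ = k0 / 4 := by
          rw [← Real.rpow_mul (by positivity), one_div_mul_cancel (by linarith), Real.rpow_one]
  -- With `κ = (η/2)²`, failure of `κ (y² - x²) ≤ x²` forces `x ≤ η y / 2`, which is what `hWlow`
  -- needs at the distance `η y`.
  set κ : ℝ := η ^ 2 / 4 with hκ
  have hκpos : 0 < κ := by positivity
  have hκ1 : κ ≤ 1 := by nlinarith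
  have hκθ : 0 < κ ^ θ := by positivity
  have hκθ1 : κ ^ θ ≤ 1 := Real.rpow_le_one hκpos.le hκ1 hθ0.le
  have hηq : 0 < η ^ q := by positivity
  set k : ℝ := min 1 (min (a * κ ^ θ) (min (a / 5) (min (k0 / 4) (k0 / 4 * η ^ q)))) with hk
  have hk1 : k ≤ 1 := min_le_left _ _
  have hk2 : k ≤ a * κ ^ θ := (min_le_right _ _).trans (min_le_left _ _)
  have hk3 : k ≤ a / 5 := (min_le_right _ _).trans ((min_le_right _ _).trans (min_le_left _ _))
  have hk4 : k ≤ k0 / 4 := (min_le_right _ _).trans ((min_le_right _ _).trans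
    ((min_le_right _ _).trans (min_le_left _ _)))
  have hk5 : k ≤ k0 / 4 * η ^ q := (min_le_right _ _).trans ((min_le_right _ _).trans
    ((min_le_right _ _).trans (min_le_right _ _)))
  have hkpos : 0 < k := by positivity
  refine ⟨k, hkpos, hk1, fun x y c hx hxy hc ↦ ?_⟩
  have hy : 0 < y := hx.trans_lt hxy
  have hz : 0 < y ^ 2 - x ^ 2 := by nlinarith
  set Q := (y ^ 2 - x ^ 2) ^ θ with hQ
  have hQpos : 0 < Q := by positivity
  have hxq : x ^ q = (x ^ 2) ^ θ := rpow_eq_sq_rpow hx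
  have hyq : y ^ q = (y ^ 2) ^ θ := rpow_eq_sq_rpow hy.le
  have hxq0 : 0 ≤ x ^ q := Real.rpow_nonneg hx q
  have hcq0 : 0 ≤ c ^ q := Real.rpow_nonneg hc q
  have hV1 : a * min (x ^ q) Q ≤ x ^ q + Q - y ^ q := by
    have := rpow_add_rpow_sub_le hθ0.le hθ1.le (sq_nonneg x) hz.le
    rw [← hxq, add_sub_cancel, ← hyq] at this
    exact this
  -- The gap splits into the part `x^q + Q - y^q` present for concentric intervals and half of `W
  -- c`, the part caused by moving the centres apart.
  set W : ℝ → ℝ := fun c ↦ (evenPow q c x - 2 * x ^ q) - (evenPow q c y - 2 * y ^ q) with hW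
  have hWmono : MonotoneOn W (Set.Ici 0) := fun s hs t ht hst ↦ by
    have := evenPow_sub_antitoneOn hq hq2 hx hxy.le hs ht hst
    simp only at this
    simp only [hW]
    linarith
  have hW0 : W 0 = 0 := by
    simp only [hW, evenPow_zero_left q hx, evenPow_zero_left q hy.le]
    ring
  have hWnn : 0 ≤ W c := hW0 ▸ hWmono (Set.mem_Ici.2 le_rfl) (Set.mem_Ici.2 hc) hc
  have hVW : Q - 1 / 2 * (evenPow q c y - evenPow q c x) = (x ^ q + Q - y ^ q) + 1 / 2 * W c := by
    simp only [hW]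
    ring
  rw [hVW]
  -- For intervals of half-sum of lengths `y` and half-difference `x`, this is the case of
  -- appreciably different lengths: strict subadditivity alone yields a multiple of `Q`.
  rcases le_or_gt (κ * (y ^ 2 - x ^ 2)) (x ^ 2) with h1 | h1
  · left
    have h2 : κ ^ θ * Q ≤ x ^ q := by
      rw [hxq, hQ, ← Real.mul_rpow hκpos.le hz.le]
      exact Real.rpow_le_rpow (by positivity) h1 hθ0.le
    have h3 : κ ^ θ * Q ≤ min (x ^ q) Q := le_min h2 (mul_le_of_le_one_left hQpos.le hκθ1)
    calc k * Q ≤ a * κ ^ θ * Q := by gcongr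
      _ ≤ a * min (x ^ q) Q := by rw [mul_assoc]; gcongr
      _ ≤ _ := by linarith
  have hxz : x ^ 2 ≤ y ^ 2 - x ^ 2 := h1.le.trans (mul_le_of_le_one_left hz.le hκ1)
  have hmin : min (x ^ q) Q = x ^ q := min_eq_left (by
    rw [hxq]; exact Real.rpow_le_rpow (sq_nonneg x) hxz hθ0.le)
  rw [hmin] at hV1
  have hy2 : y ^ 2 ≤ 2 * (y ^ 2 - x ^ 2) := by linarith
  have hWlow : ∀ c, 0 ≤ c → x ≤ c / 2 → c ≤ η * y → k0 / 2 * c ^ q ≤ W c := fun c hc hxc hcy ↦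
    le_evenPow_sub_evenPow hq hq2 hk0 hη0 hη hx hy hc hxc hcy
  -- For `c ≤ 2x` the concentric gap `a x^q` also controls `c^q`. For `2x < c ≤ η y` the term in
  -- `c^q` comes from `W`. Beyond `η y`, monotonicity of `W` brings the distance back to `η y`,
  -- where `W` is of order `y^q ≥ Q`.
  rcases le_or_gt c (2 * x) with h2 | h2
  · right
    refine ⟨?_, by linarith, hy2⟩
    have h3 : c ^ q ≤ 4 * x ^ q := by
      calc c ^ q ≤ (2 * x) ^ q := Real.rpow_le_rpow hc h2 (by linarith)
        _ = 2 ^ q * x ^ q := Real.mul_rpow (by norm_num) hx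
        _ ≤ 4 * x ^ q := by
          gcongr
          calc (2 : ℝ) ^ q ≤ 2 ^ (2 : ℝ) :=
                Real.rpow_le_rpow_of_exponent_le (by norm_num) hq2.le
            _ = 4 := by norm_num
    calc k * (c ^ q + x ^ q) ≤ a / 5 * (4 * x ^ q + x ^ q) := by gcongr
      _ = a * x ^ q := by ring
      _ ≤ _ := by linarith
  rcases le_or_gt c (η * y) with h3 | h3
  · right
    refine ⟨?_, by nlinarith, hy2⟩
    have h4 := hWlow c hc (by linarith) h3
    have h5 : k * c ^ q ≤ k0 / 4 * c ^ q := by gcongr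
    have h6 : k * x ^ q ≤ a * x ^ q := by
      gcongr
      linarith
    linarith
  · left
    have h4 : x ≤ η * y / 2 := by
      rw [← pow_le_pow_iff_left₀ hx (by positivity) two_ne_zero]
      have h5 : κ * (y ^ 2 - x ^ 2) ≤ κ * y ^ 2 :=
        mul_le_mul_of_nonneg_left (sub_le_self _ (sq_nonneg x)) hκpos.le
      have h6 : (η * y / 2) ^ 2 = κ * y ^ 2 := by rw [hκ]; ring
      linarith
    have h5 := hWlow (η * y) (by positivity) h4 le_rfl
    have h6 := hWmono (Set.mem_Ici.2 (by positivity : 0 ≤ η * y)) (Set.mem_Ici.2 hc) h3.le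
    have h7 : Q ≤ y ^ q := by
      rw [hyq]
      exact Real.rpow_le_rpow hz.le (by nlinarith [sq_nonneg x]) hθ0.le
    rw [Real.mul_rpow hη0.le hy.le] at h5
    have h8 : k * Q ≤ k0 / 4 * η ^ q * y ^ q := by gcongr
    have h9 : 0 ≤ a * x ^ q := by positivity
    linarith

/-! ### Bounds on the covariance of two increments. -/

section Kernel

variable {q p u v c : ℝ}

/-- The covariance of two increments of lengths `u`, `v` with centres at distance `|c|`. -/
noncomputable def incrCov (q u v c : ℝ) : ℝ :=
  1 / 2 * (evenPow q c ((u + v) / 2) - evenPow q c ((u - v) / 2))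

theorem incrCov_abs (q u v c : ℝ) : incrCov q u v |c| = incrCov q u v c := by
  rw [incrCov, incrCov, evenPow_abs_left, evenPow_abs_left]

theorem incrCov_eq (q u v c : ℝ) :
    incrCov q u v c = 1 / 2 * (evenPow q c ((u + v) / 2) - evenPow q c (|u - v| / 2)) := by
  rw [incrCov, ← evenPow_abs_right q c ((u - v) / 2), abs_div, abs_two]

theorem abs_sub_lt_add (hu : 0 < u) (hv : 0 < v) : |u - v| / 2 < (u + v) / 2 := by
  rcases abs_cases (u - v) with ⟨h, -⟩ | ⟨h, -⟩ <;> rw [h] <;> linarith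

theorem half_add_sq_sub (u v : ℝ) : ((u + v) / 2) ^ 2 - (|u - v| / 2) ^ 2 = u * v := by
  rw [div_pow |u - v|, sq_abs]; ring

theorem incrCov_nonneg (hq : 1 < q) (hu : 0 < u) (hv : 0 < v) : 0 ≤ incrCov q u v c := by
  rw [incrCov_eq]
  have := evenPow_mono (c := c) hq.le (by positivity) (abs_sub_lt_add hu hv).le
  linarith

/-- The concentric position is the worst, and there the bound is `y^q ≤ x^q + (uv)^(q/2)`,
subadditivity applied to `y² = x² + uv`. This is Cauchy–Schwarz for increments. -/
theorem incrCov_le_rpow (hq : 1 < q) (hq2 : q < 2) (hu : 0 < u) (hv : 0 < v) :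
    incrCov q u v c ≤ (u * v) ^ (q / 2) := by
  rw [← incrCov_abs, incrCov_eq]
  have h1 := evenPow_sub_le_of_nonneg hq hq2 (by positivity) (abs_sub_lt_add hu hv).le
    (abs_nonneg c)
  have h2 := rpow_add_rpow_sub_le (θ := q / 2) (by linarith) (by linarith)
    (sq_nonneg (|u - v| / 2)) (mul_pos hu hv).le
  rw [← half_add_sq_sub u v, add_sub_cancel, ← rpow_eq_sq_rpow (by positivity),
    ← rpow_eq_sq_rpow (by positivity)] at h2
  rw [← half_add_sq_sub u v]
  have h3 : 0 ≤ 2 - (2 : ℝ) ^ (q / 2) := by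
    have : (2 : ℝ) ^ (q / 2) ≤ 2 ^ (1 : ℝ) :=
      Real.rpow_le_rpow_of_exponent_le (by norm_num) (by linarith)
    rw [Real.rpow_one] at this
    linarith
  have h4 : 0 ≤ (2 - (2 : ℝ) ^ (q / 2)) * min ((|u - v| / 2) ^ q)
      ((((u + v) / 2) ^ 2 - (|u - v| / 2) ^ 2) ^ (q / 2)) := by
    refine mul_nonneg h3 (le_min (by positivity) ?_)
    rw [half_add_sq_sub]
    positivity
  linarith

theorem sq_rpow_half (hu : 0 < u) (hv : 0 < v) : ((u * v) ^ (q / 2)) ^ 2 = u ^ q * v ^ q := by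
  rw [← Real.rpow_natCast, ← Real.rpow_mul (by positivity), ← Real.mul_rpow hu.le hv.le]
  congr 1
  push_cast
  ring

/-- The gain of a factor `(u + v)/2` compensates later for the length, proportional to `u + v`, of
the set of nearby centres. It comes from bounding `y^q - x^q` by `q y^(q-1) (y - x)`, where `y - x =
min u v`. -/
theorem half_add_mul_incrCov_le (hq : 1 < q) (hq2 : q < 2) (hu : 0 < u) (hv : 0 < v) :
    (u + v) / 2 * incrCov q u v c ≤ 2 * (u * v ^ q + u ^ q * v) := by
  have hy : 0 < (u + v) / 2 := by positivity
  have h1 : incrCov q u v c ≤ ((u + v) / 2) ^ q - (|u - v| / 2) ^ q := by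
    rw [← incrCov_abs, incrCov_eq]
    have := evenPow_sub_le_of_nonneg hq hq2 (by positivity) (abs_sub_lt_add hu hv).le
      (abs_nonneg c)
    linarith
  have hmin : (u + v) / 2 - |u - v| / 2 = min u v := by
    rcases le_total u v with h | h
    · rw [min_eq_left h, abs_of_nonpos (by linarith)]; ring
    · rw [min_eq_right h, abs_of_nonneg (by linarith)]; ring
  set y := (u + v) / 2 with hy'
  set x := |u - v| / 2 with hx'
  -- Bernoulli's inequality: the convex power lies above its tangent at `y`.
  have h2 : y ^ q - x ^ q ≤ q * y ^ q * (y - x) / y := by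
    have h3 := one_add_mul_self_le_rpow_one_add (s := -((y - x) / y)) (p := q)
      (neg_le_neg ((div_le_one hy).2 (by have : 0 ≤ x := by positivity
                                         linarith))) hq.le
    have h4 : x ^ q = y ^ q * (1 + -((y - x) / y)) ^ q := by
      rw [← Real.mul_rpow hy.le]
      · congr 1
        field_simp
        ring
      · have : 1 + -((y - x) / y) = x / y := by field_simp; ring
        rw [this]
        positivity
    have h5 : y ^ q * (1 + q * -((y - x) / y)) ≤ x ^ q := by
      rw [h4]
      exact mul_le_mul_of_nonneg_left h3 (by positivity)
    have h6 : y ^ q * (1 + q * -((y - x) / y)) = y ^ q - q * y ^ q * (y - x) / y := by ring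
    linarith
  have h7 : y ^ q * min u v ≤ u * v ^ q + u ^ q * v := by
    rcases le_total u v with h | h
    · rw [min_eq_left h]
      have : y ^ q ≤ v ^ q := Real.rpow_le_rpow hy.le (by rw [hy']; linarith) (by linarith)
      have h8 : 0 < u ^ q * v := by positivity
      nlinarith
    · rw [min_eq_right h]
      have : y ^ q ≤ u ^ q := Real.rpow_le_rpow hy.le (by rw [hy']; linarith) (by linarith)
      have h8 : 0 < u * v ^ q := by positivity
      nlinarith
  have h9 : 0 ≤ y ^ q * min u v := by positivity
  calc y * incrCov q u v c ≤ y * (q * y ^ q * (y - x) / y) := by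
        gcongr
        exact h1.trans h2
    _ = q * (y ^ q * min u v) := by rw [hmin]; field_simp
    _ ≤ 2 * (u * v ^ q + u ^ q * v) := by nlinarith

/-- Increments over distant intervals are weakly correlated. -/
theorem incrCov_le_of_far (hq : 1 < q) (hq2 : q < 2) (hu : 0 < u) (hv : 0 < v) {K : ℝ}
    (hK : 2 ≤ K) (hc : K * ((u + v) / 2) ≤ c) :
    incrCov q u v c ≤ (K / 2) ^ (q - 2) * (u * v) ^ (q / 2) := by
  rw [incrCov_eq]
  have hy : 0 < (u + v) / 2 := by positivity
  set y := (u + v) / 2 with hy'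
  have h1 := evenPow_sub_le_of_le_half (c := c) hq hq2 (by positivity) (abs_sub_lt_add hu hv).le
    (by rw [← hy']; nlinarith)
  rw [half_add_sq_sub, ← hy'] at h1
  have h2 : (c / 2) ^ (q - 2) ≤ (K / 2) ^ (q - 2) * y ^ (q - 2) := by
    rw [← Real.mul_rpow (by linarith) hy.le]
    exact Real.rpow_le_rpow_of_nonpos (by positivity) (by linarith) (by linarith)
  have huv : 0 < u * v := by positivity
  have h3 : y ^ (q - 2) ≤ (u * v) ^ ((q - 2) / 2) := by
    rw [rpow_eq_sq_rpow hy.le]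
    refine Real.rpow_le_rpow_of_nonpos huv ?_ (by linarith)
    rw [hy']
    nlinarith [sq_nonneg (u - v)]
  have h4 : (u * v) ^ (q / 2) = (u * v) ^ ((q - 2) / 2) * (u * v) := by
    rw [← Real.rpow_add_one huv.ne']
    congr 1
    ring
  have hK0 : 0 < (K / 2) ^ (q - 2) := by positivity
  calc _ ≤ (c / 2) ^ (q - 2) * (u * v) := by linarith
    _ ≤ (K / 2) ^ (q - 2) * (u * v) ^ ((q - 2) / 2) * (u * v) := by
        gcongr
        exact h2.trans (by gcongr)
    _ = _ := by rw [h4]; ring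

end Kernel

/-! ### The determinant of the pair of increments and the comparison of kernels. -/

section Kernel

variable {q p u v c : ℝ}

/-- The Gaussian determinant of the regularised pair of increments. -/
noncomputable def covDet (q u v c : ℝ) : ℝ := (1 + u ^ q) * (1 + v ^ q) - incrCov q u v c ^ 2

/-- The integrable weight `1 / (1 + |x|^q)`. -/
noncomputable def invWeight (q x : ℝ) : ℝ := (1 + |x| ^ q)⁻¹

theorem invWeight_pos (q x : ℝ) : 0 < invWeight q x := by
  unfold invWeight
  positivity

/-- Since `u^q v^q` is the square of `(uv)^(q/2)`, the determinant contains a difference of squares;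
one factor is the Cauchy–Schwarz gap, the other is at least `(uv)^(q/2)`. -/
theorem le_covDet (hq : 1 < q) (hu : 0 < u) (hv : 0 < v) :
    1 + u ^ q + v ^ q + (u * v) ^ (q / 2) * ((u * v) ^ (q / 2) - incrCov q u v c) ≤
      covDet q u v c ∨ (u * v) ^ (q / 2) < incrCov q u v c := by
  rcases le_or_gt (incrCov q u v c) ((u * v) ^ (q / 2)) with h | h
  · left
    have h0 := incrCov_nonneg (c := c) hq hu hv
    have h1 := sq_rpow_half (q := q) hu hv
    rw [covDet]
    nlinarith
  · exact Or.inr h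

theorem le_covDet' (hq : 1 < q) (hq2 : q < 2) (hu : 0 < u) (hv : 0 < v) :
    1 + u ^ q + v ^ q + (u * v) ^ (q / 2) * ((u * v) ^ (q / 2) - incrCov q u v c) ≤
      covDet q u v c :=
  (le_covDet hq hu hv).resolve_right (not_lt.2 (incrCov_le_rpow hq hq2 hu hv))

theorem one_le_covDet (hq : 1 < q) (hq2 : q < 2) (hu : 0 < u) (hv : 0 < v) :
    1 ≤ covDet q u v c := by
  have h1 := le_covDet' (c := c) hq hq2 hu hv
  have h2 := incrCov_le_rpow (c := c) hq hq2 hu hv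
  have h3 : 0 ≤ (u * v) ^ (q / 2) * ((u * v) ^ (q / 2) - incrCov q u v c) :=
    mul_nonneg (by positivity) (by linarith)
  have h4 : 0 < u ^ q := by positivity
  have h5 : 0 < v ^ q := by positivity
  linarith

/-- Either the increments are uniformly non-degenerate, or the intervals nearly coincide. -/
theorem exists_covDet_bound (hq : 1 < q) (hq2 : q < 2) :
    ∃ k : ℝ, 0 < k ∧ ∀ u v c : ℝ, 0 < u → 0 < v → 0 ≤ c →
      k * ((1 + u ^ q) * (1 + v ^ q)) ≤ covDet q u v c ∨
      (k * ((1 + u ^ q) * (1 + c ^ q + |(u - v) / 2| ^ q)) ≤ covDet q u v c ∧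
        incrCov q u v c ≤ 16 * u ^ q) := by
  obtain ⟨k, hk0, hk1, hk⟩ := exists_evenPow_gap hq hq2
  refine ⟨k / 160, by positivity, fun u v c hu hv hc ↦ ?_⟩
  have hD := le_covDet' (c := c) hq hq2 hu hv
  have hx : 0 ≤ |u - v| / 2 := by positivity
  have hxy := abs_sub_lt_add hu hv
  have hu0 : 0 < u ^ q := by positivity
  have hv0 : 0 < v ^ q := by positivity
  -- The gap inequality is used with `x = |u - v|/2` and `y = (u + v)/2`, so that `y² - x² = uv`.
  have h := hk _ _ c hx hxy hc
  rw [half_add_sq_sub, ← incrCov_eq] at h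
  have hQ : 0 < (u * v) ^ (q / 2) := by positivity
  rcases h with h | ⟨h1, h2, h3⟩
  · left
    have h1 := mul_le_mul_of_nonneg_left h hQ.le
    have h2 : (u * v) ^ (q / 2) * (k * (u * v) ^ (q / 2)) = k * (u ^ q * v ^ q) := by
      rw [← sq_rpow_half hu hv]; ring
    have h3 : 0 < u ^ q * v ^ q := by positivity
    nlinarith
  · right
    have habs : |(u - v) / 2| = |u - v| / 2 := by rw [abs_div, abs_two]
    rw [habs]
    set x := |u - v| / 2 with hx'
    set y := (u + v) / 2 with hy'
    have hy : 0 < y := hx.trans_lt hxy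
    have huy : u ≤ 2 * y := by rw [hy']; linarith
    -- In this alternative `u`, `y` and `(uv)^(1/2)` are all comparable, and `c` and `x` are at most
    -- of that size. Hence `c^q + x^q ≤ 80 u^q`, the origin of `160 = 2 * 80`.
    have hyu : y ≤ 4 * u := by
      have : v ≤ 2 * y := by rw [hy']; linarith
      have : u * v ≤ u * (2 * y) := by gcongr
      have : y * y ≤ 4 * u * y := by nlinarith
      exact le_of_mul_le_mul_right this hy
    have h2q : (2 : ℝ) ^ q ≤ 4 := by
      calc (2 : ℝ) ^ q ≤ 2 ^ (2 : ℝ) := Real.rpow_le_rpow_of_exponent_le (by norm_num) hq2.le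
        _ = 4 := by norm_num
    have h4q : (4 : ℝ) ^ q ≤ 16 := by
      calc (4 : ℝ) ^ q ≤ 4 ^ (2 : ℝ) := Real.rpow_le_rpow_of_exponent_le (by norm_num) hq2.le
        _ = 16 := by norm_num
    have hyq : y ^ q ≤ 16 * u ^ q := by
      calc y ^ q ≤ (4 * u) ^ q := Real.rpow_le_rpow hy.le hyu (by linarith)
        _ = 4 ^ q * u ^ q := Real.mul_rpow (by norm_num) hu.le
        _ ≤ 16 * u ^ q := by gcongr
    have hyq2 : (y ^ 2) ^ (q / 2) = y ^ q := (rpow_eq_sq_rpow hy.le).symm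
    have huvy : u * v ≤ y ^ 2 := by rw [hy']; nlinarith [sq_nonneg (u - v)]
    have hQy : (u * v) ^ (q / 2) ≤ y ^ q := by
      rw [← hyq2]
      exact Real.rpow_le_rpow (by positivity) huvy (by linarith)
    have huq : u ^ q ≤ 4 * y ^ q := by
      calc u ^ q ≤ (2 * y) ^ q := Real.rpow_le_rpow hu.le huy (by linarith)
        _ = 2 ^ q * y ^ q := Real.mul_rpow (by norm_num) hy.le
        _ ≤ 4 * y ^ q := by gcongr
    have hyQ : y ^ q ≤ 2 * (u * v) ^ (q / 2) := by
      calc y ^ q = (y ^ 2) ^ (q / 2) := hyq2.symm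
        _ ≤ (2 * (u * v)) ^ (q / 2) := Real.rpow_le_rpow (by positivity) h3 (by linarith)
        _ = 2 ^ (q / 2) * (u * v) ^ (q / 2) := Real.mul_rpow (by norm_num) (by positivity)
        _ ≤ 2 * (u * v) ^ (q / 2) := by
          gcongr
          calc (2 : ℝ) ^ (q / 2) ≤ 2 ^ (1 : ℝ) :=
                Real.rpow_le_rpow_of_exponent_le (by norm_num) (by linarith)
            _ = 2 := by norm_num
    have hcq : c ^ q ≤ 64 * u ^ q := by
      calc c ^ q ≤ (2 * y) ^ q := Real.rpow_le_rpow hc h2 (by linarith)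
        _ = 2 ^ q * y ^ q := Real.mul_rpow (by norm_num) hy.le
        _ ≤ 4 * (16 * u ^ q) := by gcongr
        _ = 64 * u ^ q := by ring
    have hxq : x ^ q ≤ 16 * u ^ q := (Real.rpow_le_rpow hx hxy.le (by linarith)).trans hyq
    refine ⟨?_, (incrCov_le_rpow hq hq2 hu hv).trans (hQy.trans hyq)⟩
    have hxq0 : 0 ≤ x ^ q := by positivity
    have hcq0 : 0 ≤ c ^ q := by positivity
    set Z := c ^ q + x ^ q with hZ
    have hZ0 : 0 ≤ Z := by positivity
    have hZu : Z ≤ 80 * u ^ q := by rw [hZ]; linarith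
    have hQu : u ^ q / 8 ≤ (u * v) ^ (q / 2) := by linarith
    have e1 : (u * v) ^ (q / 2) * (k * Z) ≤
        (u * v) ^ (q / 2) * ((u * v) ^ (q / 2) - incrCov q u v c) :=
      mul_le_mul_of_nonneg_left h1 hQ.le
    have e2 : u ^ q / 8 * (k * Z) ≤ (u * v) ^ (q / 2) * (k * Z) :=
      mul_le_mul_of_nonneg_right hQu (by positivity)
    have e3 : k * Z ≤ k * (80 * u ^ q) := mul_le_mul_of_nonneg_left hZu hk0.le
    have e4 : k * u ^ q ≤ u ^ q := mul_le_of_le_one_left hu0.le hk1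
    have e5 : 0 ≤ k * (u ^ q * Z) := by positivity
    rw [show (1 : ℝ) + c ^ q + x ^ q = 1 + Z by rw [hZ]; ring]
    nlinarith

/-- The condition `p ≥ 2` is `d ≥ 2` for `p = d/2 + 1`. Of the two powers of decay, one absorbs a
factor `u` or `u^q`, or is shared with a second variable; what is left is an integrable weight. -/
theorem rpow_neg_le_inv_sq {A p : ℝ} (hA : 1 ≤ A) (hp : 2 ≤ p) : A ^ (-p) ≤ (A ^ 2)⁻¹ := by
  have hA0 : 0 < A := by linarith
  rw [Real.rpow_neg hA0.le, ← Real.rpow_natCast]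
  gcongr
  exact_mod_cast hp

theorem invWeight_of_pos (hu : 0 < u) : invWeight q u = (1 + u ^ q)⁻¹ := by
  rw [invWeight, abs_of_pos hu]

theorem rpow_mul_rpow_neg_le_invWeight (hp : 2 ≤ p) (hu : 0 < u) :
    u ^ q * (1 + u ^ q) ^ (-p) ≤ invWeight q u := by
  have hu0 : 0 < u ^ q := by positivity
  rw [invWeight_of_pos hu]
  calc u ^ q * (1 + u ^ q) ^ (-p) ≤ (1 + u ^ q) * ((1 + u ^ q) ^ 2)⁻¹ := by
        gcongr
        · linarith
        · exact rpow_neg_le_inv_sq (by linarith) hp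
    _ = (1 + u ^ q)⁻¹ := by field_simp

theorem le_one_add_rpow (hq : 1 < q) (hu : 0 < u) : u ≤ 1 + u ^ q := by
  have hu0 : 0 < u ^ q := by positivity
  rcases le_total u 1 with h | h
  · linarith
  · have := Real.rpow_le_rpow_of_exponent_le h hq.le
    rw [Real.rpow_one] at this
    linarith

theorem mul_rpow_neg_le_invWeight (hq : 1 < q) (hp : 2 ≤ p) (hu : 0 < u) :
    u * (1 + u ^ q) ^ (-p) ≤ invWeight q u := by
  have hu0 : 0 < u ^ q := by positivity
  rw [invWeight_of_pos hu]
  calc u * (1 + u ^ q) ^ (-p) ≤ (1 + u ^ q) * ((1 + u ^ q) ^ 2)⁻¹ := by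
        gcongr
        · exact le_one_add_rpow hq hu
        · exact rpow_neg_le_inv_sq (by linarith) hp
    _ = (1 + u ^ q)⁻¹ := by field_simp

theorem incrCov_mul_le_invWeight (hq : 1 < q) (hq2 : q < 2) (hp : 2 ≤ p) (hu : 0 < u)
    (hv : 0 < v) :
    incrCov q u v c * ((1 + u ^ q) ^ (-p) * (1 + v ^ q) ^ (-p)) ≤
      4 * (invWeight q u * invWeight q v / ((u + v) / 2)) := by
  have hy : 0 < (u + v) / 2 := by positivity
  rw [← mul_div_assoc, le_div_iff₀ hy]
  have h1 := half_add_mul_incrCov_le (c := c) hq hq2 hu hv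
  set a := (1 + u ^ q) ^ (-p) with ha
  set b := (1 + v ^ q) ^ (-p) with hb
  have ha0 : 0 < a := by positivity
  have hb0 : 0 < b := by positivity
  have e1 : (u * a) * (v ^ q * b) ≤ invWeight q u * invWeight q v := by
    have := rpow_mul_rpow_neg_le_invWeight (q := q) hp hv
    have := mul_rpow_neg_le_invWeight hq hp hu
    have := (invWeight_pos q u).le
    gcongr
  have e2 : (u ^ q * a) * (v * b) ≤ invWeight q u * invWeight q v := by
    have := rpow_mul_rpow_neg_le_invWeight (q := q) hp hu
    have := mul_rpow_neg_le_invWeight hq hp hv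
    have := (invWeight_pos q u).le
    gcongr
  calc incrCov q u v c * (a * b) * ((u + v) / 2)
      = ((u + v) / 2 * incrCov q u v c) * (a * b) := by ring
    _ ≤ (2 * (u * v ^ q + u ^ q * v)) * (a * b) := by gcongr
    _ = 2 * ((u * a) * (v ^ q * b) + (u ^ q * a) * (v * b)) := by ring
    _ ≤ _ := by linarith

/-- At distance at least `K` times the mean length the correlation is at most `(K/2)^(q-2)`, which
tends to zero since `q < 2`; the determinant is then nearly the product. -/
theorem exists_far_bound (hq2 : q < 2) (p : ℝ) {ε : ℝ} (hε : 0 < ε) :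
    ∃ K : ℝ, 2 ≤ K ∧ ((K / 2) ^ (q - 2)) ^ 2 < 1 ∧ (1 - ((K / 2) ^ (q - 2)) ^ 2) ^ (-p) ≤ 1 + ε := by
  have h1 : Tendsto (fun K : ℝ ↦ ((K / 2) ^ (q - 2)) ^ 2) atTop (𝓝 0) := by
    have : Tendsto (fun K : ℝ ↦ K ^ (-(2 - q))) atTop (𝓝 0) :=
      tendsto_rpow_neg_atTop (by linarith)
    have h2 := (this.comp (tendsto_id.atTop_div_const (zero_lt_two' ℝ))).pow 2
    simpa [Function.comp_def] using h2
  have h2 : Tendsto (fun K : ℝ ↦ (1 - ((K / 2) ^ (q - 2)) ^ 2) ^ (-p)) atTop (𝓝 1) := by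
    have := (tendsto_const_nhds (x := (1 : ℝ))).sub h1
    rw [sub_zero] at this
    have := this.rpow_const (p := -p) (Or.inl one_ne_zero)
    simpa using this
  obtain ⟨K, hK1, hK2, hK3⟩ := ((eventually_ge_atTop (2 : ℝ)).and ((h1.eventually_lt_const one_pos).and
    (h2.eventually_le_const (show (1 : ℝ) < 1 + ε by linarith)))).exists
  exact ⟨K, hK1, hK2, hK3⟩

/-- Pointwise comparison of the covariance kernel with its first chaos part. -/
theorem exists_kernel_bound (hq : 1 < q) (hq2 : q < 2) (hp : 2 ≤ p) {ε : ℝ} (hε : 0 < ε) :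
    ∃ K C : ℝ, 0 < K ∧ 0 < C ∧ ∀ u v c : ℝ, 0 < u → 0 < v →
      incrCov q u v c * covDet q u v c ^ (-p) ≤
        (1 + ε) * (incrCov q u v c * ((1 + u ^ q) ^ (-p) * (1 + v ^ q) ^ (-p))) +
        C * ((if |c| < K * ((u + v) / 2) then
            invWeight q u * invWeight q v / ((u + v) / 2) else 0) +
          invWeight q u * invWeight q c * invWeight q ((u - v) / 2)) := by
  obtain ⟨k, hk0, hk⟩ := exists_covDet_bound hq hq2
  obtain ⟨K, hK2, hK1, hKε⟩ := exists_far_bound hq2 p hε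
  refine ⟨K, k ^ (-p) * 16, by linarith, by positivity, fun u v c hu hv ↦ ?_⟩
  rw [← incrCov_abs q u v c, show covDet q u v c = covDet q u v |c| by
    rw [covDet, covDet, incrCov_abs], show invWeight q c = invWeight q |c| by
    rw [invWeight, invWeight, abs_abs]]
  have hc := abs_nonneg c
  generalize |c| = c at *
  have hμ := incrCov_nonneg (c := c) hq hu hv
  have hu0 : 0 < u ^ q := by positivity
  have hv0 : 0 < v ^ q := by positivity
  have hju := invWeight_pos q u
  have hjv := invWeight_pos q v
  have hjc := invWeight_pos q c
  have hjx := invWeight_pos q ((u - v) / 2)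
  have hkp : 0 < k ^ (-p) := by positivity
  have hT1 : 0 ≤ (1 + ε) * (incrCov q u v c * ((1 + u ^ q) ^ (-p) * (1 + v ^ q) ^ (-p))) := by
    positivity
  have hT2 : 0 ≤ (if c < K * ((u + v) / 2) then
      invWeight q u * invWeight q v / ((u + v) / 2) else 0) := by
    split_ifs <;> positivity
  have hT3 : 0 < invWeight q u * invWeight q c * invWeight q ((u - v) / 2) := by positivity
  -- Only distant intervals need the sharp constant `1 + ε`; for the others any multiple of the
  -- error terms will do.
  rcases le_or_gt (K * ((u + v) / 2)) c with hfar | hnear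
  · have h1 := incrCov_le_of_far hq hq2 hu hv hK2 hfar
    set a := (K / 2) ^ (q - 2) with ha
    have h2 : incrCov q u v c ^ 2 ≤ a ^ 2 * (u ^ q * v ^ q) := by
      rw [← sq_rpow_half hu hv, ← mul_pow]
      gcongr
    have h3 : (1 - a ^ 2) * ((1 + u ^ q) * (1 + v ^ q)) ≤ covDet q u v c := by
      rw [covDet]
      have : 0 ≤ a ^ 2 * (1 + u ^ q + v ^ q) := by positivity
      nlinarith
    have h4 : covDet q u v c ^ (-p) ≤ (1 + ε) * ((1 + u ^ q) ^ (-p) * (1 + v ^ q) ^ (-p)) := by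
      have h5 : 0 < 1 - a ^ 2 := by linarith
      calc covDet q u v c ^ (-p) ≤ ((1 - a ^ 2) * ((1 + u ^ q) * (1 + v ^ q))) ^ (-p) :=
            Real.rpow_le_rpow_of_nonpos (by positivity) h3 (by linarith)
        _ = (1 - a ^ 2) ^ (-p) * ((1 + u ^ q) ^ (-p) * (1 + v ^ q) ^ (-p)) := by
            rw [Real.mul_rpow h5.le (by positivity), Real.mul_rpow (by positivity) (by positivity)]
        _ ≤ _ := by gcongr
    have h5 := mul_le_mul_of_nonneg_left h4 hμ
    have : 0 ≤ k ^ (-p) * 16 * ((if c < K * ((u + v) / 2) then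
      invWeight q u * invWeight q v / ((u + v) / 2) else 0) +
          invWeight q u * invWeight q c * invWeight q ((u - v) / 2)) := by positivity
    linarith
  · rw [if_pos hnear]
    have hT2' : 0 < invWeight q u * invWeight q v / ((u + v) / 2) := by positivity
    -- Nondegenerate pairs are paid for by the first error term. Nearly coinciding intervals are
    -- paid for by the second, whose three weights localise `u`, `c` and `u - v`.
    rcases hk u v c hu hv hc with h | ⟨h, h'⟩
    · have h1 : covDet q u v c ^ (-p) ≤ k ^ (-p) * ((1 + u ^ q) ^ (-p) * (1 + v ^ q) ^ (-p)) := by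
        calc covDet q u v c ^ (-p) ≤ (k * ((1 + u ^ q) * (1 + v ^ q))) ^ (-p) :=
              Real.rpow_le_rpow_of_nonpos (by positivity) h (by linarith)
          _ = _ := by
              rw [Real.mul_rpow hk0.le (by positivity),
                Real.mul_rpow (by positivity) (by positivity)]
      have h2 := mul_le_mul_of_nonneg_left h1 hμ
      have h3 := incrCov_mul_le_invWeight (c := c) hq hq2 hp hu hv
      have h4 := mul_le_mul_of_nonneg_left h3 hkp.le
      have h5 : 0 < k ^ (-p) * (invWeight q u * invWeight q v / ((u + v) / 2)) := by positivity
      have h6 : 0 < k ^ (-p) * (invWeight q u * invWeight q c * invWeight q ((u - v) / 2)) := by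
        positivity
      nlinarith
    · set x := |(u - v) / 2| with hx
      have hx0 : 0 ≤ x ^ q := by positivity
      have hc0 : 0 ≤ c ^ q := by positivity
      have h1 : covDet q u v c ^ (-p) ≤
          k ^ (-p) * ((1 + u ^ q) ^ (-p) * (1 + c ^ q + x ^ q) ^ (-p)) := by
        calc covDet q u v c ^ (-p) ≤ (k * ((1 + u ^ q) * (1 + c ^ q + x ^ q))) ^ (-p) :=
              Real.rpow_le_rpow_of_nonpos (by positivity) h (by linarith)
          _ = _ := by
              rw [Real.mul_rpow hk0.le (by positivity),
                Real.mul_rpow (by positivity) (by positivity)]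
      have h2 : (1 + c ^ q + x ^ q) ^ (-p) ≤ invWeight q c * invWeight q ((u - v) / 2) := by
        refine (rpow_neg_le_inv_sq (by linarith) hp).trans ?_
        rw [invWeight, invWeight, abs_of_nonneg hc, ← hx, ← mul_inv]
        gcongr
        nlinarith
      have h3 := rpow_mul_rpow_neg_le_invWeight (q := q) hp hu
      calc incrCov q u v c * covDet q u v c ^ (-p)
          ≤ 16 * u ^ q * (k ^ (-p) * ((1 + u ^ q) ^ (-p) *
            (invWeight q c * invWeight q ((u - v) / 2)))) := by
            have : (1 + u ^ q) ^ (-p) * (1 + c ^ q + x ^ q) ^ (-p) ≤ (1 + u ^ q) ^ (-p) *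
              (invWeight q c * invWeight q ((u - v) / 2)) := by gcongr
            have h1' := h1.trans (mul_le_mul_of_nonneg_left this hkp.le)
            have : 0 ≤ covDet q u v c ^ (-p) :=
              Real.rpow_nonneg (zero_le_one.trans (one_le_covDet hq hq2 hu hv)) _
            exact mul_le_mul h' h1' this (by positivity)
        _ = k ^ (-p) * 16 * ((u ^ q * (1 + u ^ q) ^ (-p)) * invWeight q c *
            invWeight q ((u - v) / 2)) := by ring
        _ ≤ k ^ (-p) * 16 * (invWeight q u * invWeight q c * invWeight q ((u - v) / 2)) := by
            gcongr
        _ ≤ _ := by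
            have h6 : 0 < k ^ (-p) * 16 * (invWeight q u * invWeight q v / ((u + v) / 2)) := by
              positivity
            linarith

end Kernel

/-! ### Integration of the error term over pairs of intervals: a contribution of order `T`. -/

theorem continuous_abs_rpow {q : ℝ} (hq : 0 ≤ q) : Continuous fun x : ℝ ↦ |x| ^ q :=
  continuous_abs.rpow_const fun _ ↦ Or.inr hq

theorem continuous_invWeight {q : ℝ} (hq : 0 ≤ q) : Continuous (invWeight q) := by
  refine (continuous_const.add (continuous_abs_rpow hq)).inv₀ fun x ↦ ?_
  have : 0 < 1 + |x| ^ q := by positivity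
  exact this.ne'

theorem integrable_invWeight {q : ℝ} (hq : 1 < q) (hq2 : q ≤ 2) : Integrable (invWeight q) := by
  have h := (integrable_one_add_norm (E := ℝ) (μ := volume) (r := q) (by simpa using hq)).const_mul 4
  refine h.mono' (continuous_invWeight (by linarith)).aestronglyMeasurable
    (Eventually.of_forall fun x ↦ ?_)
  rw [Real.norm_of_nonneg (invWeight_pos q x).le, invWeight, Real.norm_eq_abs,
    Real.rpow_neg (by positivity), ← div_eq_mul_inv, inv_eq_one_div,
    div_le_div_iff₀ (by positivity) (by positivity), one_mul]
  have hx := abs_nonneg x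
  have h1 : 1 + |x| ≤ 2 * max 1 |x| := by
    have := le_max_left 1 |x|
    have := le_max_right 1 |x|
    linarith
  have h2 : max 1 |x| ^ q ≤ 1 + |x| ^ q := by
    rcases le_total 1 |x| with h | h
    · rw [max_eq_right h]; linarith
    · rw [max_eq_left h, Real.one_rpow]
      have : 0 ≤ |x| ^ q := by positivity
      linarith
  calc (1 + |x|) ^ q ≤ (2 * max 1 |x|) ^ q := Real.rpow_le_rpow (by positivity) h1 (by linarith)
    _ = 2 ^ q * max 1 |x| ^ q := Real.mul_rpow (by norm_num) (by positivity)
    _ ≤ 4 * (1 + |x| ^ q) := by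
      gcongr
      calc (2 : ℝ) ^ q ≤ 2 ^ (2 : ℝ) := Real.rpow_le_rpow_of_exponent_le (by norm_num) hq2
        _ = 4 := by norm_num

theorem lintegral_invWeight {q : ℝ} (hq : 1 < q) (hq2 : q ≤ 2) :
    ∫⁻ x, ENNReal.ofReal (invWeight q x) = ENNReal.ofReal (∫ x, invWeight q x) :=
  (ofReal_integral_eq_lintegral_ofReal (integrable_invWeight hq hq2)
    (Eventually.of_forall fun x ↦ (invWeight_pos q x).le)).symm

/-- The pairs `(s, u)` such that `[s - u, s]` is a nondegenerate subinterval of `[0, T]`. -/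
def incrDomain (T : ℝ) : Set (ℝ × ℝ) := {z | 0 < z.2 ∧ z.2 ≤ z.1 ∧ z.1 ≤ T}

theorem measurableSet_incrDomain (T : ℝ) : MeasurableSet (incrDomain T) :=
  (measurableSet_lt measurable_const measurable_snd).inter
    ((measurableSet_le measurable_snd measurable_fst).inter
      (measurableSet_le measurable_fst measurable_const))

theorem incrDomain_subset (T : ℝ) : incrDomain T ⊆ Set.Ioc 0 T ×ˢ Set.Ioi 0 :=
  fun _ hz ↦ ⟨⟨hz.1.trans_le hz.2.1, hz.2.2⟩, hz.1⟩

theorem incrDomain_subset_Icc (T : ℝ) : incrDomain T ⊆ Set.Icc 0 T ×ˢ Set.Icc 0 T :=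
  fun _ hz ↦ ⟨⟨(hz.1.trans_le hz.2.1).le, hz.2.2⟩, ⟨hz.1.le, hz.2.1.trans hz.2.2⟩⟩

/-- Lebesgue measure on `incrDomain T`. -/
noncomputable def incrMeasure (T : ℝ) : Measure (ℝ × ℝ) := volume.restrict (incrDomain T)

instance (T : ℝ) : IsFiniteMeasure (incrMeasure T) := by
  refine ⟨?_⟩
  rw [incrMeasure, Measure.restrict_apply_univ]
  exact (measure_mono (incrDomain_subset_Icc T)).trans_lt
    (isCompact_Icc.prod isCompact_Icc).measure_lt_top

theorem ae_incrMeasure (T : ℝ) : ∀ᵐ z ∂incrMeasure T, z ∈ incrDomain T :=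
  ae_restrict_mem (measurableSet_incrDomain T)

theorem ae_incrMeasure_prod (T : ℝ) :
    ∀ᵐ x ∂(incrMeasure T).prod (incrMeasure T), x.1 ∈ incrDomain T ∧ x.2 ∈ incrDomain T := by
  rw [incrMeasure, Measure.prod_restrict]
  exact ae_restrict_mem ((measurableSet_incrDomain T).prod (measurableSet_incrDomain T))

theorem incrMeasure_le (T : ℝ) :
    incrMeasure T ≤ (volume.restrict (Set.Ioc 0 T)).prod (volume.restrict (Set.Ioi 0)) := by
  rw [incrMeasure, Measure.prod_restrict]
  exact Measure.restrict_mono_set _ (incrDomain_subset T)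

/-- The difference of the centres of two intervals. -/
noncomputable def centreDiff (x : (ℝ × ℝ) × (ℝ × ℝ)) : ℝ := (x.1.1 - x.1.2 / 2) - (x.2.1 - x.2.2 / 2)

theorem continuous_centreDiff : Continuous centreDiff := by unfold centreDiff; fun_prop

/-- The error term in `exists_kernel_bound`. -/
noncomputable def kernelError (q K u v c : ℝ) : ℝ :=
  (if |c| < K * ((u + v) / 2) then invWeight q u * invWeight q v / ((u + v) / 2) else 0) +
    invWeight q u * invWeight q c * invWeight q ((u - v) / 2)

theorem measurable_kernelError {q : ℝ} (hq : 0 ≤ q) (K : ℝ) :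
    Measurable fun x : (ℝ × ℝ) × (ℝ × ℝ) ↦ kernelError q K x.1.2 x.2.2 (centreDiff x) := by
  have hj := (continuous_invWeight hq).measurable
  have hc := continuous_centreDiff.measurable
  unfold kernelError
  refine Measurable.add (Measurable.ite (measurableSet_lt ?_ ?_) ?_ measurable_const) ?_
  all_goals fun_prop

/-- With the lengths fixed, the position `r` enters through the difference of centres only. The
indicator selects a ball of length `2K (u + v)/2`, cancelling the denominator, and the other term
integrates a translate of `invWeight`. -/
theorem lintegral_kernelError_le {q K : ℝ} (hq : 1 < q) (hq2 : q ≤ 2) (hK : 0 < K) {s u v : ℝ}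
    (hu : 0 < u) (hv : 0 < v) :
    ∫⁻ r, ENNReal.ofReal (kernelError q K u v (centreDiff ((s, u), (r, v)))) ≤
      ENNReal.ofReal (2 * K * (invWeight q u * invWeight q v) +
        invWeight q u * invWeight q ((u - v) / 2) * ∫ x, invWeight q x) := by
  have hju := invWeight_pos q u
  have hjv := invWeight_pos q v
  have hjx := invWeight_pos q ((u - v) / 2)
  have hy : 0 < (u + v) / 2 := by positivity
  have hJ : 0 ≤ ∫ x, invWeight q x := integral_nonneg fun x ↦ (invWeight_pos q x).le
  have hjm := (continuous_invWeight (q := q) (by linarith)).measurable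
  set b : ℝ := s - u / 2 + v / 2 with hb
  have hcd : ∀ r, centreDiff ((s, u), (r, v)) = b - r := fun r ↦ by
    simp only [centreDiff, hb]; ring
  have hsplit : ∀ r, ENNReal.ofReal (kernelError q K u v (centreDiff ((s, u), (r, v)))) =
      (Metric.ball b (K * ((u + v) / 2))).indicator
        (fun _ ↦ ENNReal.ofReal (invWeight q u * invWeight q v / ((u + v) / 2))) r +
      ENNReal.ofReal (invWeight q u * invWeight q ((u - v) / 2)) *
        ENNReal.ofReal (invWeight q (b - r)) := by
    intro r
    rw [hcd, kernelError, ENNReal.ofReal_add (by split_ifs <;> positivity)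
      (by have := invWeight_pos q (b - r); positivity), ← ENNReal.ofReal_mul (by positivity)]
    congr 1
    · split_ifs with h
      · rw [Set.indicator_of_mem]
        rwa [Metric.mem_ball, Real.dist_eq, abs_sub_comm]
      · rw [Set.indicator_of_notMem, ENNReal.ofReal_zero]
        rwa [Metric.mem_ball, Real.dist_eq, abs_sub_comm]
    · congr 1; ring
  simp_rw [hsplit]
  rw [lintegral_add_right _ (by fun_prop), lintegral_indicator measurableSet_ball,
    lintegral_const_mul _ (by fun_prop),
    lintegral_sub_left_eq_self (fun x ↦ ENNReal.ofReal (invWeight q x)) b,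
    lintegral_invWeight hq hq2, setLIntegral_const, Real.volume_ball,
    ← ENNReal.ofReal_mul (by positivity), ← ENNReal.ofReal_mul (by positivity),
    ← ENNReal.ofReal_add (by positivity) (by positivity)]
  apply ENNReal.ofReal_le_ofReal
  apply le_of_eq
  field_simp

theorem lintegral_invWeight_sub_half {q : ℝ} (hq : 1 < q) (hq2 : q ≤ 2) (u : ℝ) :
    ∫⁻ v, ENNReal.ofReal (invWeight q ((u - v) / 2)) =
      ENNReal.ofReal (2 * ∫ x, invWeight q x) := by
  have hi := ((integrable_invWeight hq hq2).comp_div two_ne_zero).comp_sub_left u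
  rw [← ofReal_integral_eq_lintegral_ofReal hi
    (Eventually.of_forall fun x ↦ (invWeight_pos q _).le),
    integral_sub_left_eq_self (fun v ↦ invWeight q (v / 2)) volume u,
    Measure.integral_comp_div]
  simp

/-- After the integration over `r`, the lengths `v` and `u` meet integrable weights on the whole
line, and the free position `s` contributes the factor `T`. -/
theorem exists_lintegral_kernelError_le {q K : ℝ} (hq : 1 < q) (hq2 : q ≤ 2) (hK : 0 < K) :
    ∃ C : ℝ, 0 ≤ C ∧ ∀ T : ℝ, 0 ≤ T →
      ∫⁻ x, ENNReal.ofReal (kernelError q K x.1.2 x.2.2 (centreDiff x))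
        ∂(incrMeasure T).prod (incrMeasure T) ≤ ENNReal.ofReal (C * T) := by
  set J := ∫ x, invWeight q x with hJdef
  have hJ : 0 ≤ J := integral_nonneg fun x ↦ (invWeight_pos q x).le
  have hjm := (continuous_invWeight (q := q) (by linarith)).measurable
  refine ⟨J * (2 * K * J + 2 * J ^ 2), by positivity, fun T hT ↦ ?_⟩
  have hmeas := measurable_kernelError (q := q) (by linarith) K
  have hmeas' : Measurable fun x : (ℝ × ℝ) × (ℝ × ℝ) ↦
    ENNReal.ofReal (kernelError q K x.1.2 x.2.2 (centreDiff x)) := hmeas.ennreal_ofReal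
  have hinner : ∀ s u : ℝ, 0 < u → ∫⁻ z', ENNReal.ofReal
      (kernelError q K u z'.2 (centreDiff ((s, u), z'))) ∂incrMeasure T ≤
      ENNReal.ofReal (2 * K * J + 2 * J ^ 2) * ENNReal.ofReal (invWeight q u) := by
    intro s u hu
    have hju := invWeight_pos q u
    have hm : Measurable fun z' : ℝ × ℝ ↦ ENNReal.ofReal
        (kernelError q K u z'.2 (centreDiff ((s, u), z'))) :=
      hmeas'.comp (measurable_prodMk_left (x := (s, u)))
    calc ∫⁻ z', ENNReal.ofReal (kernelError q K u z'.2 (centreDiff ((s, u), z'))) ∂incrMeasure T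
        ≤ ∫⁻ z', ENNReal.ofReal (kernelError q K u z'.2 (centreDiff ((s, u), z')))
            ∂(volume.prod (volume.restrict (Set.Ioi 0))) :=
          lintegral_mono' ((incrMeasure_le T).trans
            (Measure.prod_mono Measure.restrict_le_self le_rfl)) le_rfl
      _ = ∫⁻ v in Set.Ioi 0, ∫⁻ r, ENNReal.ofReal
            (kernelError q K u v (centreDiff ((s, u), (r, v)))) := by
          rw [lintegral_prod_symm _ hm.aemeasurable]
      _ ≤ ∫⁻ v in Set.Ioi 0, ENNReal.ofReal (2 * K * (invWeight q u * invWeight q v) +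
            invWeight q u * invWeight q ((u - v) / 2) * J) :=
          setLIntegral_mono' measurableSet_Ioi fun v hv ↦
            lintegral_kernelError_le hq hq2 hK hu hv
      _ ≤ ∫⁻ v, ENNReal.ofReal (2 * K * (invWeight q u * invWeight q v) +
            invWeight q u * invWeight q ((u - v) / 2) * J) := setLIntegral_le_lintegral _ _
      _ = ∫⁻ v, (ENNReal.ofReal (2 * K * invWeight q u) * ENNReal.ofReal (invWeight q v) +
            ENNReal.ofReal (invWeight q u * J) * ENNReal.ofReal (invWeight q ((u - v) / 2))) := by
          congr 1 with v
          have hjv := invWeight_pos q v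
          have hjx := invWeight_pos q ((u - v) / 2)
          rw [← ENNReal.ofReal_mul (by positivity), ← ENNReal.ofReal_mul (by positivity),
            ← ENNReal.ofReal_add (by positivity) (by positivity)]
          congr 1; ring
      _ = _ := by
          rw [lintegral_add_left (by fun_prop), lintegral_const_mul _ (by fun_prop),
            lintegral_const_mul _ (by fun_prop), lintegral_invWeight hq hq2,
            lintegral_invWeight_sub_half hq hq2, ← ENNReal.ofReal_mul (by positivity),
            ← ENNReal.ofReal_mul (by positivity), ← ENNReal.ofReal_mul (by positivity),
            ← ENNReal.ofReal_add (by positivity) (by positivity)]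
          congr 1; ring
  rw [lintegral_prod _ hmeas'.aemeasurable]
  calc _ ≤ ∫⁻ z, ENNReal.ofReal (2 * K * J + 2 * J ^ 2) * ENNReal.ofReal (invWeight q z.2)
        ∂incrMeasure T := by
        refine lintegral_mono_ae ?_
        filter_upwards [ae_incrMeasure T] with z hz
        exact hinner z.1 z.2 hz.1
    _ ≤ ∫⁻ z, ENNReal.ofReal (2 * K * J + 2 * J ^ 2) * ENNReal.ofReal (invWeight q z.2)
        ∂((volume.restrict (Set.Ioc 0 T)).prod volume) :=
        lintegral_mono' ((incrMeasure_le T).trans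
            (Measure.prod_mono le_rfl Measure.restrict_le_self)) le_rfl
    _ = _ := by
        rw [lintegral_prod _ (by fun_prop)]
        simp only [lintegral_const, Measure.restrict_apply_univ, Real.volume_Ioc, sub_zero]
        rw [lintegral_const_mul _ (by fun_prop), lintegral_invWeight hq hq2,
          ← ENNReal.ofReal_mul (by positivity), ← ENNReal.ofReal_mul (by positivity)]
        congr 1; ring

/-! ### The covariance of fractional Brownian motion. -/

/-- Covariance of one-dimensional fractional Brownian motion with Hurst parameter `q / 2`. -/
noncomputable def fbmCov (q s r : ℝ) : ℝ := 1 / 2 * (|s| ^ q + |r| ^ q - |s - r| ^ q)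

theorem fbmCov_comm (q s r : ℝ) : fbmCov q s r = fbmCov q r s := by
  rw [fbmCov, fbmCov, abs_sub_comm]; ring

theorem continuous_fbmCov {q : ℝ} (hq : 0 ≤ q) : Continuous fun x : ℝ × ℝ ↦ fbmCov q x.1 x.2 := by
  have h := continuous_abs_rpow hq
  have h1 : Continuous fun x : ℝ × ℝ ↦ |x.1| ^ q := h.comp continuous_fst
  have h2 : Continuous fun x : ℝ × ℝ ↦ |x.2| ^ q := h.comp continuous_snd
  have h3 : Continuous fun x : ℝ × ℝ ↦ |x.1 - x.2| ^ q := h.comp (continuous_fst.sub continuous_snd)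
  exact continuous_const.mul ((h1.add h2).sub h3)

/-- The link between the two descriptions of the kernel: lengths and distance of centres serve the
estimates, the second difference of the covariance serves the telescoping. -/
theorem incrCov_centreDiff (q s u r v : ℝ) :
    incrCov q u v (centreDiff ((s, u), (r, v))) =
      (fbmCov q s r - fbmCov q (s - u) r) - (fbmCov q s (r - v) - fbmCov q (s - u) (r - v)) := by
  simp only [incrCov, evenPow, centreDiff, fbmCov]
  rw [show s - u / 2 - (r - v / 2) + (u + v) / 2 = s - (r - v) by ring,
    show s - u / 2 - (r - v / 2) - (u + v) / 2 = s - u - r by ring,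
    show s - u / 2 - (r - v / 2) + (u - v) / 2 = s - r by ring,
    show s - u / 2 - (r - v / 2) - (u - v) / 2 = s - u - (r - v) by ring]
  ring

theorem fbmCov_zero_left {q : ℝ} (hq : 0 < q) (r : ℝ) : fbmCov q 0 r = 0 := by
  simp [fbmCov, Real.zero_rpow hq.ne']

theorem fbmCov_zero_right {q : ℝ} (hq : 0 < q) (r : ℝ) : fbmCov q r 0 = 0 := by
  rw [fbmCov_comm, fbmCov_zero_left hq]

theorem fbmCov_self {q : ℝ} (hq : 0 < q) {T : ℝ} (hT : 0 ≤ T) : fbmCov q T T = T ^ q := by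
  simp [fbmCov, Real.zero_rpow hq.ne', abs_of_nonneg hT]
  ring

/-- Increments are nonnegatively correlated for `q > 1`; one of them is taken over `[0, s]`. -/
theorem fbmCov_mono_right {q s r v : ℝ} (hq : 1 < q) (hs : 0 ≤ s) (hv : 0 < v) :
    fbmCov q s (r - v) ≤ fbmCov q s r := by
  have hq0 : 0 < q := by linarith
  rcases eq_or_lt_of_le hs with rfl | hs
  · rw [fbmCov_zero_left hq0, fbmCov_zero_left hq0]
  have h := incrCov_nonneg (c := centreDiff ((s, s), (r, v))) hq hs hv
  rw [incrCov_centreDiff, sub_self, fbmCov_zero_left hq0, fbmCov_zero_left hq0] at h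
  linarith

theorem fbmCov_nonneg {q s r : ℝ} (hq : 1 < q) (hs : 0 ≤ s) (hr : 0 ≤ r) : 0 ≤ fbmCov q s r := by
  rcases eq_or_lt_of_le hr with rfl | hr
  · rw [fbmCov_zero_right (by linarith)]
  · have := fbmCov_mono_right (r := r) hq hs hr
    rwa [sub_self, fbmCov_zero_right (by linarith)] at this

theorem fbmCov_le {q s r : ℝ} (hq : 1 < q) (hq2 : q < 2) (hs : 0 ≤ s) (hr : 0 ≤ r) :
    fbmCov q s r ≤ (s * r) ^ (q / 2) := by
  have hq0 : 0 < q := by linarith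
  have hh : 0 < q / 2 := by linarith
  rcases eq_or_lt_of_le hs with rfl | hs
  · rw [fbmCov_zero_left hq0, zero_mul, Real.zero_rpow hh.ne']
  rcases eq_or_lt_of_le hr with rfl | hr
  · rw [fbmCov_zero_right hq0, mul_zero, Real.zero_rpow hh.ne']
  have h := incrCov_le_rpow (c := centreDiff ((s, s), (r, r))) hq hq2 hs hr
  rw [incrCov_centreDiff, sub_self, sub_self, fbmCov_zero_left hq0, fbmCov_zero_left hq0,
    fbmCov_zero_right hq0] at h
  linarith

/-- Time reversal: the increment over `[T - s, T]` has the same covariance with the end point as the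
increment over `[0, s]`. -/
theorem fbmCov_sub_left {q s T : ℝ} (hs : s ≤ T) (hT : 0 ≤ T) (hs0 : 0 ≤ s) :
    fbmCov q (T - s) T = T ^ q - fbmCov q s T := by
  rw [fbmCov, fbmCov, abs_of_nonneg (sub_nonneg.2 hs), abs_of_nonneg hT, abs_of_nonneg hs0,
    sub_sub_cancel_left, abs_neg, abs_of_nonneg hs0, abs_sub_comm, abs_of_nonneg (sub_nonneg.2 hs)]
  ring

theorem mul_self_rpow_half {T : ℝ} (q : ℝ) (hT : 0 ≤ T) : (T * T) ^ (q / 2) = T ^ q := by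
  rw [← sq, ← rpow_eq_sq_rpow hT]

/-- The first chaos weight `(1 + |u|^q)^(-p)`. -/
noncomputable def chaosWeight (q p u : ℝ) : ℝ := (1 + |u| ^ q) ^ (-p)

theorem chaosWeight_pos (q p u : ℝ) : 0 < chaosWeight q p u := by
  unfold chaosWeight; positivity

theorem chaosWeight_of_pos {q p u : ℝ} (hu : 0 < u) : chaosWeight q p u = (1 + u ^ q) ^ (-p) := by
  rw [chaosWeight, abs_of_pos hu]

theorem continuous_chaosWeight {q : ℝ} (hq : 0 ≤ q) (p : ℝ) : Continuous (chaosWeight q p) :=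
  (continuous_const.add (continuous_abs_rpow hq)).rpow_const fun x ↦
    Or.inl (by have : 0 < 1 + |x| ^ q := by positivity
               exact this.ne')

theorem integrable_incrMeasure {f : ℝ × ℝ → ℝ} (hf : Continuous f) (T : ℝ) :
    Integrable f (incrMeasure T) :=
  (hf.continuousOn.integrableOn_compact (isCompact_Icc.prod isCompact_Icc)).mono_set
    (incrDomain_subset_Icc T)

theorem integrable_incrMeasure_prod {f : (ℝ × ℝ) × (ℝ × ℝ) → ℝ} (hf : Continuous f) (T : ℝ) :
    Integrable f ((incrMeasure T).prod (incrMeasure T)) := by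
  rw [incrMeasure, Measure.prod_restrict]
  exact (hf.continuousOn.integrableOn_compact ((isCompact_Icc.prod isCompact_Icc).prod
    (isCompact_Icc.prod isCompact_Icc))).mono_set
    (Set.prod_mono (incrDomain_subset_Icc T) (incrDomain_subset_Icc T))

theorem integral_incrMeasure {f : ℝ × ℝ → ℝ} {T : ℝ} (hT : 0 ≤ T)
    (hf : Integrable f (incrMeasure T)) :
    ∫ z, f z ∂incrMeasure T = ∫ u in (0 : ℝ)..T, ∫ s in u..T, f (s, u) := by
  have hm := measurableSet_incrDomain T
  rw [incrMeasure, ← integral_indicator hm, Measure.volume_eq_prod, integral_prod_symm _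
    ((integrable_indicator_iff hm).2 hf), intervalIntegral.integral_of_le hT,
    ← integral_indicator measurableSet_Ioc]
  congr 1 with u
  by_cases hu : u ∈ Set.Ioc 0 T
  · rw [Set.indicator_of_mem hu, intervalIntegral.integral_of_le hu.2,
      ← integral_Icc_eq_integral_Ioc, ← integral_indicator measurableSet_Icc]
    congr 1 with s
    simp only [Set.indicator_apply, incrDomain, Set.mem_ofPred_eq, Set.mem_Icc]
    simp [hu.1]
  · rw [Set.indicator_of_notMem hu, integral_eq_zero_of_ae]
    refine Eventually.of_forall fun s ↦ Set.indicator_of_notMem (fun h ↦ hu ?_) _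
    exact ⟨h.1, h.2.1.trans h.2.2⟩

theorem integral_incrMeasure_swap {f : ℝ × ℝ → ℝ} {T : ℝ} (hT : 0 ≤ T)
    (hf : Integrable f (incrMeasure T)) :
    ∫ z, f z ∂incrMeasure T = ∫ s in (0 : ℝ)..T, ∫ u in (0 : ℝ)..s, f (s, u) := by
  have hm := measurableSet_incrDomain T
  rw [incrMeasure, ← integral_indicator hm, Measure.volume_eq_prod, integral_prod _
    ((integrable_indicator_iff hm).2 hf), intervalIntegral.integral_of_le hT,
    ← integral_indicator measurableSet_Ioc]
  congr 1 with s
  by_cases hs : s ∈ Set.Ioc 0 T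
  · rw [Set.indicator_of_mem hs, intervalIntegral.integral_of_le hs.1.le,
      ← integral_indicator measurableSet_Ioc]
    congr 1 with u
    simp only [Set.indicator_apply, incrDomain, Set.mem_ofPred_eq, Set.mem_Ioc]
    simp [hs.2]
  · rw [Set.indicator_of_notMem hs, integral_eq_zero_of_ae]
    refine Eventually.of_forall fun u ↦ Set.indicator_of_notMem (fun h ↦ hs ?_) _
    exact ⟨h.1.trans_le h.2.1, h.2.2⟩

/-! ### Telescoping and the first chaos. -/

section Telescoping

variable {w F : ℝ → ℝ} {T A : ℝ}

/-- For fixed length `u` the integral of `F s - F (s - u)` over `[u, T]` leaves only the two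
boundary pieces. -/
theorem integral_incrMeasure_weight (hw : Continuous w) (hF : Continuous F) (hT : 0 ≤ T) :
    ∫ z, w z.2 * (F z.1 - F (z.1 - z.2)) ∂incrMeasure T =
      ∫ u in (0 : ℝ)..T, w u * ((∫ s in (T - u)..T, F s) - ∫ s in (0 : ℝ)..u, F s) := by
  rw [integral_incrMeasure hT (integrable_incrMeasure (by fun_prop) T)]
  refine intervalIntegral.integral_congr fun u _ ↦ ?_
  have hi : ∀ a b, IntervalIntegrable F volume a b := fun a b ↦ hF.intervalIntegrable a b
  have hi2 : IntervalIntegrable (fun s ↦ F (s - u)) volume u T :=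
    (hF.comp (by fun_prop)).intervalIntegrable _ _
  simp only [intervalIntegral.integral_const_mul]
  rw [intervalIntegral.integral_sub (hi u T) hi2, intervalIntegral.integral_comp_sub_right F u,
    sub_self, ← intervalIntegral.integral_interval_sub_left (hi 0 T) (hi 0 u),
    ← intervalIntegral.integral_interval_sub_left (hi 0 T) (hi 0 (T - u))]
  ring

/-- The piece near `0` is nonnegative and is dropped; the piece near `T` is at most `u A`. -/
theorem integral_incrMeasure_weight_le (hw : Continuous w) (hF : Continuous F) (hT : 0 ≤ T)
    (hw0 : ∀ u, 0 ≤ w u) (hF0 : ∀ s ∈ Set.Icc 0 T, 0 ≤ F s) (hFA : ∀ s ∈ Set.Icc 0 T, F s ≤ A) :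
    ∫ z, w z.2 * (F z.1 - F (z.1 - z.2)) ∂incrMeasure T ≤
      A * ∫ u in (0 : ℝ)..T, u * w u := by
  have hprim : Continuous fun u ↦ ∫ s in (0 : ℝ)..u, F s :=
    intervalIntegral.continuous_primitive (fun a b ↦ hF.intervalIntegrable a b) 0
  have hprim2 : Continuous fun u ↦ ∫ s in (T - u)..T, F s := by
    simp_rw [intervalIntegral.integral_symm T]
    exact ((intervalIntegral.continuous_primitive (fun a b ↦ hF.intervalIntegrable a b) T).comp
      (continuous_const.sub continuous_id)).neg
  rw [integral_incrMeasure_weight hw hF hT, ← intervalIntegral.integral_const_mul]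
  refine intervalIntegral.integral_mono_on hT
    ((hw.mul (hprim2.sub hprim)).intervalIntegrable _ _)
    (Continuous.intervalIntegrable (by fun_prop) _ _) fun u hu ↦ ?_
  have h1 : ∫ s in (T - u)..T, F s ≤ u * A := by
    calc ∫ s in (T - u)..T, F s ≤ ∫ _ in (T - u)..T, A :=
          intervalIntegral.integral_mono_on (by linarith [hu.1]) (hF.intervalIntegrable _ _)
            (continuous_const.intervalIntegrable _ _)
            fun s hs ↦ hFA s ⟨by linarith [hs.1, hu.2], hs.2⟩
      _ = u * A := by simp
  have h2 : 0 ≤ ∫ s in (0 : ℝ)..u, F s :=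
    intervalIntegral.integral_nonneg hu.1 fun s hs ↦ hF0 s ⟨hs.1, hs.2.trans hu.2⟩
  calc w u * ((∫ s in (T - u)..T, F s) - ∫ s in (0 : ℝ)..u, F s) ≤ w u * (u * A) := by
        gcongr
        · exact hw0 u
        · linarith
    _ = A * (u * w u) := by ring

end Telescoping

theorem integrable_incrCov_weight {q : ℝ} (hq0 : 0 ≤ q) {p : ℝ} (T : ℝ) :
    Integrable (fun x : (ℝ × ℝ) × (ℝ × ℝ) ↦
      incrCov q x.1.2 x.2.2 (centreDiff x) * (chaosWeight q p x.1.2 * chaosWeight q p x.2.2))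
      ((incrMeasure T).prod (incrMeasure T)) := by
  have hw := continuous_chaosWeight hq0 p
  refine integrable_incrMeasure_prod ?_ T
  have : ∀ x : (ℝ × ℝ) × (ℝ × ℝ), incrCov q x.1.2 x.2.2 (centreDiff x) = _ := fun x ↦
    incrCov_centreDiff q x.1.1 x.1.2 x.2.1 x.2.2
  simp_rw [this]
  have hR' : ∀ {f g : (ℝ × ℝ) × (ℝ × ℝ) → ℝ}, Continuous f → Continuous g →
      Continuous fun x ↦ fbmCov q (f x) (g x) := fun hf hg ↦
    (continuous_fbmCov hq0).comp (hf.prodMk hg)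
  exact (((hR' (by fun_prop) (by fun_prop)).sub (hR' (by fun_prop) (by fun_prop))).sub
    ((hR' (by fun_prop) (by fun_prop)).sub (hR' (by fun_prop) (by fun_prop)))).mul
    ((hw.comp (by fun_prop)).mul (hw.comp (by fun_prop)))

/-- The variance of the first chaos component is at most its expected limit. -/
theorem integral_incrCov_weight_le {q p T : ℝ} (hq : 1 < q) (hq2 : q < 2) (hT : 0 ≤ T) :
    ∫ x, incrCov q x.1.2 x.2.2 (centreDiff x) * (chaosWeight q p x.1.2 * chaosWeight q p x.2.2)
        ∂(incrMeasure T).prod (incrMeasure T) ≤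
      T ^ q * (∫ u in (0 : ℝ)..T, u * chaosWeight q p u) ^ 2 := by
  have hq0 : 0 < q := by linarith
  have hR := continuous_fbmCov hq0.le
  have hw := continuous_chaosWeight hq0.le p
  set w := chaosWeight q p with hwdef
  set M := ∫ u in (0 : ℝ)..T, u * w u with hM
  have hRc : ∀ s, Continuous fun r ↦ fbmCov q s r := fun s ↦
    hR.comp (continuous_const.prodMk continuous_id)
  -- `g s` is the covariance of the process at time `s` with the weighted sum of increments. The
  -- double integral is the same functional applied to `g`, so the telescoping bound is used twice.
  set g : ℝ → ℝ := fun s ↦ ∫ z, w z.2 * (fbmCov q s z.1 - fbmCov q s (z.1 - z.2)) ∂incrMeasure T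
    with hg
  have hgint : ∀ s, Integrable (fun z : ℝ × ℝ ↦ w z.2 * (fbmCov q s z.1 - fbmCov q s (z.1 - z.2)))
      (incrMeasure T) := fun s ↦ integrable_incrMeasure
    ((hw.comp continuous_snd).mul (((hRc s).comp continuous_fst).sub
      ((hRc s).comp (continuous_fst.sub continuous_snd)))) T
  have hgcont : Continuous g := by
    have : g = fun s ↦ ∫ u in (0 : ℝ)..T, ∫ r in u..T,
        w u * (fbmCov q s r - fbmCov q s (r - u)) := by
      ext s
      rw [hg]
      exact integral_incrMeasure hT (hgint s)
    rw [this]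
    have h1 : Continuous fun y : (ℝ × ℝ) × ℝ ↦
        w y.1.2 * (fbmCov q y.1.1 y.2 - fbmCov q y.1.1 (y.2 - y.1.2)) :=
      (hw.comp (by fun_prop)).mul ((hR.comp (f := fun y : (ℝ × ℝ) × ℝ ↦ (y.1.1, y.2))
        (by fun_prop)).sub
        (hR.comp (f := fun y : (ℝ × ℝ) × ℝ ↦ (y.1.1, y.2 - y.1.2)) (by fun_prop)))
    have h2 : Continuous fun x : ℝ × ℝ ↦ ∫ r in x.2..T,
        w x.2 * (fbmCov q x.1 r - fbmCov q x.1 (r - x.2)) := by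
      simp_rw [intervalIntegral.integral_symm T]
      exact (intervalIntegral.continuous_parametric_intervalIntegral_of_continuous
        (f := fun x : ℝ × ℝ ↦ fun r ↦ w x.2 * (fbmCov q x.1 r - fbmCov q x.1 (r - x.2)))
        h1 continuous_snd).neg
    exact intervalIntegral.continuous_parametric_intervalIntegral_of_continuous'
      (f := fun s u ↦ ∫ r in u..T, w u * (fbmCov q s r - fbmCov q s (r - u))) h2 0 T
  have hM0 : 0 ≤ M := intervalIntegral.integral_nonneg hT fun u hu ↦
    mul_nonneg hu.1 (chaosWeight_pos q p u).le
  have hg0 : ∀ s ∈ Set.Icc 0 T, 0 ≤ g s := fun s hs ↦ by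
    refine integral_nonneg_of_ae ?_
    filter_upwards [ae_incrMeasure T] with z hz
    exact mul_nonneg (chaosWeight_pos q p _).le
      (sub_nonneg.2 (fbmCov_mono_right hq hs.1 hz.1))
  have hgle : ∀ s ∈ Set.Icc 0 T, g s ≤ T ^ q * M := fun s hs ↦ by
    refine integral_incrMeasure_weight_le hw (hRc s) hT (fun u ↦ (chaosWeight_pos q p u).le)
      (fun r hr ↦ fbmCov_nonneg hq hs.1 hr.1) fun r hr ↦ ?_
    refine (fbmCov_le hq hq2 hs.1 hr.1).trans ?_
    rw [← mul_self_rpow_half q hT]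
    have := hs.1
    have := hr.1
    exact Real.rpow_le_rpow (by positivity) (mul_le_mul hs.2 hr.2 hr.1 hT) (by linarith)
  have hint := integrable_incrCov_weight (p := p) hq0.le T
  rw [← hwdef] at hint
  rw [integral_prod _ hint]
  have hinner : ∀ z : ℝ × ℝ, ∫ z', incrCov q z.2 z'.2 (centreDiff (z, z')) * (w z.2 * w z'.2)
      ∂incrMeasure T = w z.2 * (g z.1 - g (z.1 - z.2)) := by
    intro z
    rw [hg, ← integral_sub (hgint _) (hgint _), ← integral_const_mul]
    congr 1 with z'
    rw [show incrCov q z.2 z'.2 (centreDiff (z, z')) = _ from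
      incrCov_centreDiff q z.1 z.2 z'.1 z'.2]
    ring
  simp only [hinner]
  refine (integral_incrMeasure_weight_le hw hgcont hT (fun u ↦ (chaosWeight_pos q p u).le) hg0
    hgle).trans (le_of_eq ?_)
  rw [← hM]
  ring

/-- Lower bound for the covariance of the functional with the end point of the process. -/
theorem le_integral_fbmCov_weight {q p T : ℝ} (hq : 1 < q) (hq2 : q < 2) (hT : 0 ≤ T) :
    T ^ q * (∫ u in (0 : ℝ)..T, u * chaosWeight q p u) -
        2 * ∫ u in (0 : ℝ)..T, u * chaosWeight q p u * (u * T) ^ (q / 2) ≤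
      ∫ z, chaosWeight q p z.2 * (fbmCov q z.1 T - fbmCov q (z.1 - z.2) T) ∂incrMeasure T := by
  have hq0 : 0 < q := by linarith
  have hw := continuous_chaosWeight hq0.le p
  have hF : Continuous fun s ↦ fbmCov q s T :=
    (continuous_fbmCov hq0.le).comp (continuous_id.prodMk continuous_const)
  have hprim : Continuous fun u ↦ ∫ s in (0 : ℝ)..u, fbmCov q s T :=
    intervalIntegral.continuous_primitive (fun a b ↦ hF.intervalIntegrable a b) 0
  have hprim2 : Continuous fun u ↦ ∫ s in (T - u)..T, fbmCov q s T := by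
    simp_rw [intervalIntegral.integral_symm T]
    exact ((intervalIntegral.continuous_primitive (fun a b ↦ hF.intervalIntegrable a b) T).comp
      (continuous_const.sub continuous_id)).neg
  have hpow : Continuous fun u : ℝ ↦ (u * T) ^ (q / 2) :=
    (continuous_id.mul continuous_const).rpow_const fun _ ↦ Or.inr (by linarith)
  have hc1 : Continuous fun u ↦ u * chaosWeight q p u := by fun_prop
  have hc2 : Continuous fun u ↦ u * chaosWeight q p u * (u * T) ^ (q / 2) := hc1.mul hpow
  rw [integral_incrMeasure_weight hw hF hT, ← intervalIntegral.integral_const_mul,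
    ← intervalIntegral.integral_const_mul, ← intervalIntegral.integral_sub
      ((hc1.const_mul _).intervalIntegrable _ _)
      ((hc2.const_mul _).intervalIntegrable _ _)]
  refine intervalIntegral.integral_mono_on hT
    (((hc1.const_mul _).sub (hc2.const_mul _)).intervalIntegrable _ _)
    ((hw.mul (hprim2.sub hprim)).intervalIntegrable _ _) fun u hu ↦ ?_
  -- By time reversal the covariance with the end point on `[T - u, T]` falls short of `T^q` by at
  -- most `(uT)^(q/2)`. The piece near `0` costs the same amount, whence the factor `2`.
  have h1 : u * (T ^ q - (u * T) ^ (q / 2)) ≤ ∫ s in (T - u)..T, fbmCov q s T := by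
    calc u * (T ^ q - (u * T) ^ (q / 2)) = ∫ _ in (T - u)..T, (T ^ q - (u * T) ^ (q / 2)) := by
          simp
          ring
      _ ≤ _ := intervalIntegral.integral_mono_on (by linarith [hu.1])
            (continuous_const.intervalIntegrable _ _) (hF.intervalIntegrable _ _)
            fun s hs ↦ by
        have h2 : 0 ≤ T - s := sub_nonneg.2 hs.2
        have h3 : T - s ≤ u := by linarith [hs.1]
        have h4 := fbmCov_sub_left (q := q) (s := T - s) (T := T) (by linarith [hs.1, hu.2]) hT h2
        rw [sub_sub_cancel] at h4
        have h5 := fbmCov_le hq hq2 h2 hT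
        have h6 : ((T - s) * T) ^ (q / 2) ≤ (u * T) ^ (q / 2) :=
          Real.rpow_le_rpow (by positivity) (by gcongr) (by linarith)
        rw [h4]
        linarith
  have h2 : ∫ s in (0 : ℝ)..u, fbmCov q s T ≤ u * (u * T) ^ (q / 2) := by
    calc ∫ s in (0 : ℝ)..u, fbmCov q s T ≤ ∫ _ in (0 : ℝ)..u, (u * T) ^ (q / 2) :=
          intervalIntegral.integral_mono_on hu.1 (hF.intervalIntegrable _ _)
            (continuous_const.intervalIntegrable _ _) fun s hs ↦ by
            refine (fbmCov_le hq hq2 hs.1 hT).trans ?_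
            have := hs.1
            exact Real.rpow_le_rpow (by positivity) (by gcongr; exact hs.2) (by linarith)
      _ = _ := by simp
  have hw0 := (chaosWeight_pos q p u).le
  calc T ^ q * (u * chaosWeight q p u) - 2 * (u * chaosWeight q p u * (u * T) ^ (q / 2))
      = chaosWeight q p u * (u * (T ^ q - (u * T) ^ (q / 2)) - u * (u * T) ^ (q / 2)) := by ring
    _ ≤ _ := by gcongr

theorem integrableOn_mul_chaosWeight {q p : ℝ} (hq : 1 < q) (hq2 : q ≤ 2) (hp : 2 ≤ p) :
    IntegrableOn (fun u ↦ u * chaosWeight q p u) (Set.Ioi 0) := by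
  have hw := continuous_chaosWeight (q := q) (by linarith) p
  refine (integrable_invWeight hq hq2).integrableOn.mono'
    (Continuous.aestronglyMeasurable (by fun_prop)) ?_
  filter_upwards [ae_restrict_mem measurableSet_Ioi] with u hu
  rw [Real.norm_of_nonneg (mul_nonneg (Set.mem_Ioi.1 hu).le (chaosWeight_pos q p u).le),
    chaosWeight_of_pos hu]
  exact mul_rpow_neg_le_invWeight hq hp hu

theorem tendsto_integral_mul_chaosWeight {q p : ℝ} (hq : 1 < q) (hq2 : q ≤ 2) (hp : 2 ≤ p) :
    Tendsto (fun T ↦ ∫ u in (0 : ℝ)..T, u * chaosWeight q p u) atTop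
      (𝓝 (∫ u in Set.Ioi (0 : ℝ), u * (1 + u ^ q) ^ (-p))) := by
  have h := intervalIntegral_tendsto_integral_Ioi 0 (integrableOn_mul_chaosWeight hq hq2 hp)
    tendsto_id
  have h2 : ∫ u in Set.Ioi (0 : ℝ), u * chaosWeight q p u =
      ∫ u in Set.Ioi (0 : ℝ), u * (1 + u ^ q) ^ (-p) :=
    setIntegral_congr_fun measurableSet_Ioi fun u hu ↦ by
      simp only [chaosWeight_of_pos (Set.mem_Ioi.1 hu)]
  rw [← h2]
  exact h

/-- After normalisation the extra factor is `(u/T)^(q/2)`, at most `1` for `u ≤ T` and vanishing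
pointwise, so dominated convergence applies. -/
theorem tendsto_integral_mul_chaosWeight_rpow {q p : ℝ} (hq : 1 < q) (hq2 : q ≤ 2) (hp : 2 ≤ p) :
    Tendsto (fun T ↦ T ^ (-q) * ∫ u in (0 : ℝ)..T, u * chaosWeight q p u * (u * T) ^ (q / 2))
      atTop (𝓝 0) := by
  have hw := continuous_chaosWeight (q := q) (by linarith) p
  have hbound := integrableOn_mul_chaosWeight hq hq2 hp
  have key : Tendsto (fun T : ℝ ↦ ∫ u in Set.Ioi (0 : ℝ), (Set.Iic T).indicator
      (fun u ↦ u * chaosWeight q p u * (u / T) ^ (q / 2)) u) atTop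
      (𝓝 (∫ _ in Set.Ioi (0 : ℝ), (0 : ℝ))) := by
    refine tendsto_integral_filter_of_dominated_convergence (fun u ↦ u * chaosWeight q p u) ?_ ?_
      hbound ?_
    · refine Eventually.of_forall fun T ↦ Measurable.aestronglyMeasurable ?_
      have := hw.measurable
      exact Measurable.indicator (by fun_prop) measurableSet_Iic
    · filter_upwards [eventually_gt_atTop 0] with T hT
      filter_upwards [ae_restrict_mem measurableSet_Ioi] with u hu
      have hu0 : 0 < u := hu
      have hw0 := chaosWeight_pos q p u
      rw [Set.indicator_apply]
      split_ifs with h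
      · rw [Real.norm_of_nonneg (by positivity)]
        exact mul_le_of_le_one_right (by positivity)
          (Real.rpow_le_one (by positivity) ((div_le_one hT).2 h) (by linarith))
      · rw [norm_zero]; positivity
    · filter_upwards [ae_restrict_mem measurableSet_Ioi] with u hu
      have h1 : Tendsto (fun T : ℝ ↦ u * chaosWeight q p u * (u / T) ^ (q / 2)) atTop (𝓝 0) := by
        have h2 : Tendsto (fun T : ℝ ↦ u / T) atTop (𝓝 0) := tendsto_id.const_div_atTop u
        have h3 := (h2.rpow_const (p := q / 2) (Or.inr (by linarith))).const_mul
          (u * chaosWeight q p u)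
        rwa [Real.zero_rpow (by linarith), mul_zero] at h3
      refine h1.congr' ?_
      filter_upwards [eventually_ge_atTop u] with T hT
      rw [Set.indicator_of_mem (Set.mem_Iic.2 hT)]
  rw [integral_zero] at key
  refine key.congr' ?_
  filter_upwards [eventually_gt_atTop 0] with T hT
  rw [integral_indicator measurableSet_Iic, Measure.restrict_restrict measurableSet_Iic,
    Set.Iic_inter_Ioi, intervalIntegral.integral_of_le hT.le, ← integral_const_mul]
  refine setIntegral_congr_fun measurableSet_Ioc fun u hu ↦ ?_
  have h1 : T ^ (-q) * (u * T) ^ (q / 2) = (u / T) ^ (q / 2) := by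
    rw [Real.mul_rpow hu.1.le hT.le, Real.div_rpow hu.1.le hT.le, mul_left_comm,
      ← Real.rpow_add hT, show -q + q / 2 = -(q / 2) by ring, Real.rpow_neg hT.le, ← div_eq_mul_inv]
  rw [← h1]
  ring

/-! ### Asymptotics of the mean square error. -/

/-- The covariance kernel integrates to at most its first chaos part, up to a lower order term. -/
theorem exists_integral_covKernel_le {q p : ℝ} (hq : 1 < q) (hq2 : q < 2) (hp : 2 ≤ p) {ε : ℝ}
    (hε : 0 < ε) : ∃ C : ℝ, ∀ T : ℝ, 0 ≤ T →
      ∫ x, incrCov q x.1.2 x.2.2 (centreDiff x) *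
          covDet q x.1.2 x.2.2 (centreDiff x) ^ (-p) ∂(incrMeasure T).prod (incrMeasure T) ≤
        (1 + ε) * (T ^ q * (∫ u in (0 : ℝ)..T, u * chaosWeight q p u) ^ 2) + C * T := by
  obtain ⟨K, C₁, hK, hC₁, hbound⟩ := exists_kernel_bound hq hq2 hp hε
  obtain ⟨C₂, hC₂, hint⟩ := exists_lintegral_kernelError_le hq hq2.le hK
  refine ⟨C₁ * C₂, fun T hT ↦ ?_⟩
  have herr0 : ∀ᵐ x ∂(incrMeasure T).prod (incrMeasure T),
      0 ≤ kernelError q K x.1.2 x.2.2 (centreDiff x) := by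
    filter_upwards [ae_incrMeasure_prod T] with x hx
    have := hx.1.1
    have := hx.2.1
    have := invWeight_pos q x.1.2
    have := invWeight_pos q x.2.2
    have := invWeight_pos q (centreDiff x)
    have := invWeight_pos q ((x.1.2 - x.2.2) / 2)
    unfold kernelError
    split_ifs <;> positivity
  have herrm := (measurable_kernelError (q := q) (by linarith) K).aestronglyMeasurable
    (μ := (incrMeasure T).prod (incrMeasure T))
  have herri : Integrable (fun x : (ℝ × ℝ) × (ℝ × ℝ) ↦
      kernelError q K x.1.2 x.2.2 (centreDiff x)) ((incrMeasure T).prod (incrMeasure T)) := by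
    refine ⟨herrm, ?_⟩
    rw [hasFiniteIntegral_iff_ofReal herr0]
    exact (hint T hT).trans_lt ENNReal.ofReal_lt_top
  have herr : ∫ x, kernelError q K x.1.2 x.2.2 (centreDiff x)
      ∂(incrMeasure T).prod (incrMeasure T) ≤ C₂ * T := by
    rw [integral_eq_lintegral_of_nonneg_ae herr0 herrm]
    exact ENNReal.toReal_le_of_le_ofReal (by positivity) (hint T hT)
  have hchaosi := integrable_incrCov_weight (p := p) (by linarith : 0 ≤ q) T
  calc _ ≤ ∫ x, ((1 + ε) * (incrCov q x.1.2 x.2.2 (centreDiff x) *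
          (chaosWeight q p x.1.2 * chaosWeight q p x.2.2)) +
          C₁ * kernelError q K x.1.2 x.2.2 (centreDiff x))
          ∂(incrMeasure T).prod (incrMeasure T) := by
        refine integral_mono_of_nonneg ?_ ((hchaosi.const_mul _).add (herri.const_mul _)) ?_
        · filter_upwards [ae_incrMeasure_prod T] with x hx
          exact mul_nonneg (incrCov_nonneg hq hx.1.1 hx.2.1)
            (Real.rpow_nonneg (zero_le_one.trans (one_le_covDet hq hq2 hx.1.1 hx.2.1)) _)
        · filter_upwards [ae_incrMeasure_prod T] with x hx
          rw [chaosWeight_of_pos hx.1.1, chaosWeight_of_pos hx.2.1]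
          exact hbound _ _ _ hx.1.1 hx.2.1
    _ ≤ _ := by
        rw [integral_add (hchaosi.const_mul _) (herri.const_mul _), integral_const_mul,
          integral_const_mul]
        have h1 := integral_incrCov_weight_le (p := p) hq hq2 hT
        have h2 : 0 ≤ 1 + ε := by linarith
        have := mul_le_mul_of_nonneg_left h1 h2
        have := mul_le_mul_of_nonneg_left herr hC₁.le
        linarith

/-- The mean square distance between the rescaled functional and its limit vanishes. -/
theorem eventually_chaos_error_le {q p : ℝ} (hq : 1 < q) (hq2 : q < 2) (hp : 2 ≤ p) {ε : ℝ}
    (hε : 0 < ε) : ∀ᶠ T : ℝ in atTop,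
      ∫ x, incrCov q x.1.2 x.2.2 (centreDiff x) *
          covDet q x.1.2 x.2.2 (centreDiff x) ^ (-p) ∂(incrMeasure T).prod (incrMeasure T) -
        2 * (∫ u in Set.Ioi (0 : ℝ), u * (1 + u ^ q) ^ (-p)) *
          (∫ z, chaosWeight q p z.2 * (fbmCov q z.1 T - fbmCov q (z.1 - z.2) T) ∂incrMeasure T) +
        (∫ u in Set.Ioi (0 : ℝ), u * (1 + u ^ q) ^ (-p)) ^ 2 * T ^ q ≤ ε * T ^ q := by
  set m := ∫ u in Set.Ioi (0 : ℝ), u * (1 + u ^ q) ^ (-p) with hm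
  have hm0 : 0 ≤ m := setIntegral_nonneg measurableSet_Ioi fun u hu ↦ by
    have : 0 < u := hu
    positivity
  obtain ⟨δ, hδ, hδε⟩ : ∃ δ : ℝ, 0 < δ ∧ δ * m ^ 2 < ε := by
    refine ⟨ε / (2 * (m ^ 2 + 1)), by positivity, ?_⟩
    rw [div_mul_eq_mul_div, div_lt_iff₀ (by positivity)]
    nlinarith [sq_nonneg m]
  obtain ⟨C, hC⟩ := exists_integral_covKernel_le hq hq2 hp hδ
  set M : ℝ → ℝ := fun T ↦ ∫ u in (0 : ℝ)..T, u * chaosWeight q p u with hM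
  set N : ℝ → ℝ := fun T ↦ ∫ u in (0 : ℝ)..T, u * chaosWeight q p u * (u * T) ^ (q / 2) with hN
  have hMt : Tendsto M atTop (𝓝 m) := tendsto_integral_mul_chaosWeight hq hq2.le hp
  have hNt : Tendsto (fun T ↦ T ^ (-q) * N T) atTop (𝓝 0) :=
    tendsto_integral_mul_chaosWeight_rpow hq hq2.le hp
  have hlin : Tendsto (fun T : ℝ ↦ T ^ (1 - q)) atTop (𝓝 0) := by
    have := tendsto_rpow_neg_atTop (show 0 < q - 1 by linarith)
    simpa using this
  -- This is the bound divided by `T^q`; its limit is `(1 + δ) m² - 2 m² + m² = δ m²`.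
  have hlim : Tendsto (fun T ↦ (1 + δ) * M T ^ 2 + C * T ^ (1 - q) -
      2 * m * (M T - 2 * (T ^ (-q) * N T)) + m ^ 2) atTop (𝓝 (δ * m ^ 2)) := by
    have := ((((hMt.pow 2).const_mul (1 + δ)).add (hlin.const_mul C)).sub
      ((hMt.sub (hNt.const_mul 2)).const_mul (2 * m))).add_const (m ^ 2)
    convert! this using 2
    ring
  filter_upwards [hlim.eventually_le_const hδε, eventually_gt_atTop 0] with T hT hT0
  have h1 := hC T hT0.le
  have h2 := le_integral_fbmCov_weight (p := p) hq hq2 hT0.le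
  have h3 := mul_le_mul_of_nonneg_left h2 (show 0 ≤ 2 * m by linarith)
  have hTq : 0 < T ^ q := by positivity
  have h4 := mul_le_mul_of_nonneg_right hT hTq.le
  have e1 : T ^ (1 - q) * T ^ q = T := by rw [← Real.rpow_add hT0]; simp
  have e2 : T ^ (-q) * T ^ q = 1 := by rw [← Real.rpow_add hT0]; simp
  have e3 : ((1 + δ) * M T ^ 2 + C * T ^ (1 - q) -
      2 * m * (M T - 2 * (T ^ (-q) * N T)) + m ^ 2) * T ^ q =
      (1 + δ) * (T ^ q * M T ^ 2) + C * T - 2 * m * (T ^ q * M T - 2 * N T) + m ^ 2 * T ^ q := by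
    linear_combination C * e1 + 4 * m * N T * e2
  rw [e3] at h4
  simp only [hM, hN] at h4
  linarith

/-! ### Gaussian expectations in `d` dimensions. -/

section GaussianVector

variable {Ω : Type*} [MeasurableSpace Ω] {P : Measure Ω} [IsProbabilityMeasure P] {d : ℕ}

/-- The function `x_j exp(-|x|^2 / 2)`. -/
noncomputable def coordGaussian (j : Fin d) (x : EuclideanSpace ℝ (Fin d)) : ℝ :=
  x j * Real.exp (-(‖x‖ ^ 2 / 2))

theorem continuous_coordGaussian (j : Fin d) : Continuous (coordGaussian j) := by
  unfold coordGaussian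
  fun_prop

theorem abs_coordGaussian_le_one (j : Fin d) (x : EuclideanSpace ℝ (Fin d)) :
    |coordGaussian j x| ≤ 1 := by
  have h1 : |x j| ≤ ‖x‖ := by simpa using PiLp.norm_apply_le x j
  have h2 := abs_mul_exp_neg_sq_le_one ‖x‖
  rw [abs_mul, abs_norm] at h2
  rw [coordGaussian, abs_mul]
  exact (mul_le_mul_of_nonneg_right h1 (abs_nonneg _)).trans h2

theorem exp_neg_norm_sq (x : EuclideanSpace ℝ (Fin d)) :
    Real.exp (-(‖x‖ ^ 2 / 2)) = ∏ i, Real.exp (-(x i ^ 2 / 2)) := by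
  rw [← Real.exp_sum, EuclideanSpace.real_norm_sq_eq, Finset.sum_neg_distrib, Finset.sum_div]

theorem inv_sqrt_pow_mul {D : ℝ} (hD : 0 < D) (c : ℝ) (d : ℕ) :
    (c / D) * (√D)⁻¹ ^ d = c * D ^ (-((d : ℝ) / 2 + 1)) := by
  rw [Real.rpow_neg hD.le, Real.rpow_add_one hD.ne', Real.sqrt_eq_rpow, inv_pow,
    ← Real.rpow_natCast, ← Real.rpow_mul hD.le]
  rw [show 1 / 2 * (d : ℝ) = d / 2 by ring]
  field_simp

/-- Independence of the coordinates factorises the expectation. Each coordinate contributes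
`D^(-1/2)` and the `j`-th a further `c / D`, which produces the exponent `-(d/2 + 1)`. -/
theorem integral_coordGaussian_mul {X Y : Ω → EuclideanSpace ℝ (Fin d)} (j : Fin d) {a b c : ℝ}
    (hind : iIndepFun (fun i ω ↦ (X ω i, Y ω i)) P)
    (hlaw : ∀ i, HasGaussianLaw (fun ω ↦ (X ω i, Y ω i)) P)
    (hX : ∀ i, ∫ ω, X ω i ∂P = 0) (hY : ∀ i, ∫ ω, Y ω i ∂P = 0)
    (ha : ∀ i, ∫ ω, X ω i * X ω i ∂P = a) (hb : ∀ i, ∫ ω, Y ω i * Y ω i ∂P = b)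
    (hc : ∀ i, ∫ ω, X ω i * Y ω i ∂P = c) :
    ∫ ω, coordGaussian j (X ω) * coordGaussian j (Y ω) ∂P =
      c * ((1 + a) * (1 + b) - c ^ 2) ^ (-((d : ℝ) / 2 + 1)) := by
  set G : Fin d → ℝ × ℝ → ℝ := fun i z ↦ (if j = i then z.1 * z.2 else 1) *
    (Real.exp (-(z.1 ^ 2 / 2)) * Real.exp (-(z.2 ^ 2 / 2))) with hG
  have hGc : ∀ i, Continuous (G i) := fun i ↦ by
    simp only [hG]
    split_ifs <;> fun_prop
  have hprod : ∀ ω, coordGaussian j (X ω) * coordGaussian j (Y ω) =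
      ∏ i, G i (X ω i, Y ω i) := fun ω ↦ by
    simp only [hG, coordGaussian, exp_neg_norm_sq, Finset.prod_mul_distrib]
    rw [Finset.prod_ite_eq, if_pos (Finset.mem_univ j)]
    ring
  have hGind : iIndepFun (fun i ω ↦ G i (X ω i, Y ω i)) P :=
    hind.comp G fun i ↦ (hGc i).measurable
  have hD := (integral_exp_gaussian_pair (hlaw j) (hX j) (hY j) (ha j) (hb j) (hc j)).1
  have hGi : ∀ i, ∫ ω, G i (X ω i, Y ω i) ∂P = (if j = i then c / ((1 + a) * (1 + b) - c ^ 2)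
      else 1) * (√((1 + a) * (1 + b) - c ^ 2))⁻¹ := fun i ↦ by
    obtain ⟨-, h1, h2⟩ := integral_exp_gaussian_pair (hlaw i) (hX i) (hY i) (ha i) (hb i) (hc i)
    simp only [hG]
    split_ifs
    · rw [mul_comm, ← h2]
      congr 1 with ω
      ring
    · simpa using h1
  simp_rw [hprod]
  rw [hGind.integral_fun_prod_eq_prod_integral fun i ↦
    ((hGc i).measurable.comp_aemeasurable (hlaw i).aemeasurable).aestronglyMeasurable]
  simp_rw [hGi]
  rw [Finset.prod_mul_distrib, Finset.prod_ite_eq, if_pos (Finset.mem_univ j),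
    Finset.prod_const, Finset.card_univ, Fintype.card_fin, inv_sqrt_pow_mul hD]

theorem integral_coordGaussian_mul_apply {X Y : Ω → EuclideanSpace ℝ (Fin d)} (j : Fin d)
    {a b c : ℝ}
    (hind : iIndepFun (fun i ω ↦ (X ω i, Y ω i)) P)
    (hlaw : ∀ i, HasGaussianLaw (fun ω ↦ (X ω i, Y ω i)) P)
    (hX : ∀ i, ∫ ω, X ω i ∂P = 0) (hY : ∀ i, ∫ ω, Y ω i ∂P = 0)
    (ha : ∀ i, ∫ ω, X ω i * X ω i ∂P = a) (hb : ∀ i, ∫ ω, Y ω i * Y ω i ∂P = b)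
    (hc : ∀ i, ∫ ω, X ω i * Y ω i ∂P = c) :
    ∫ ω, coordGaussian j (X ω) * Y ω j ∂P = c * (1 + a) ^ (-((d : ℝ) / 2 + 1)) := by
  set G : Fin d → ℝ × ℝ → ℝ := fun i z ↦ (if j = i then z.1 * z.2 else 1) *
    Real.exp (-(z.1 ^ 2 / 2)) with hG
  have hGc : ∀ i, Continuous (G i) := fun i ↦ by
    simp only [hG]
    split_ifs <;> fun_prop
  have hprod : ∀ ω, coordGaussian j (X ω) * Y ω j = ∏ i, G i (X ω i, Y ω i) := fun ω ↦ by
    simp only [hG, coordGaussian, exp_neg_norm_sq, Finset.prod_mul_distrib]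
    rw [Finset.prod_ite_eq, if_pos (Finset.mem_univ j)]
    ring
  have hGind : iIndepFun (fun i ω ↦ G i (X ω i, Y ω i)) P :=
    hind.comp G fun i ↦ (hGc i).measurable
  have ha0 : 0 ≤ a := ha j ▸ integral_nonneg fun ω ↦ mul_self_nonneg _
  have hGi : ∀ i, ∫ ω, G i (X ω i, Y ω i) ∂P = (if j = i then c / (1 + a) else 1) *
      (√(1 + a))⁻¹ := fun i ↦ by
    obtain ⟨h1, h2⟩ := integral_exp_gaussian (hlaw i) (hX i) (hY i) (ha i) (hb i) (hc i)
    simp only [hG]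
    split_ifs
    · rw [mul_comm, ← h2]
      congr 1 with ω
      ring
    · simpa using h1
  simp_rw [hprod]
  rw [hGind.integral_fun_prod_eq_prod_integral fun i ↦
    ((hGc i).measurable.comp_aemeasurable (hlaw i).aemeasurable).aestronglyMeasurable]
  simp_rw [hGi]
  rw [Finset.prod_mul_distrib, Finset.prod_ite_eq, if_pos (Finset.mem_univ j),
    Finset.prod_const, Finset.card_univ, Fintype.card_fin, inv_sqrt_pow_mul (by linarith)]

end GaussianVector

/-! ### Second moments of the functional of fractional Brownian motion. -/

namespace IsFractionalBrownianMotion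

variable {Ω : Type*} [MeasurableSpace Ω] {P : Measure Ω} {d : ℕ} {H : ℝ}
  {B : ℝ≥0 → Ω → EuclideanSpace ℝ (Fin d)}

theorem memLp_apply (hB : IsFractionalBrownianMotion H B P) (s : ℝ≥0) (i : Fin d) :
    MemLp (fun ω ↦ B s ω i) 2 P :=
  ((hB.isGaussianProcess.hasGaussianLaw_eval s).map_fun (EuclideanSpace.proj i)).memLp_two

theorem hasGaussianLaw_sub_pair (hB : IsFractionalBrownianMotion H B P) (s r s' r' : ℝ≥0)
    (i : Fin d) :
    HasGaussianLaw (fun ω ↦ ((B s ω - B r ω) i, (B s' ω - B r' ω) i)) P := by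
  classical
  set I : Finset ℝ≥0 := {s, r, s', r'} with hI
  let π (t : ℝ≥0) (ht : t ∈ I) : (I → EuclideanSpace ℝ (Fin d)) →L[ℝ] EuclideanSpace ℝ (Fin d) :=
    ContinuousLinearMap.proj ⟨t, ht⟩
  let pr : EuclideanSpace ℝ (Fin d) →L[ℝ] ℝ := EuclideanSpace.proj i
  exact (hB.isGaussianProcess.hasGaussianLaw I).map_fun
    ((pr.comp (π s (by simp [hI]) - π r (by simp [hI]))).prod
      (pr.comp (π s' (by simp [hI]) - π r' (by simp [hI]))))

theorem iIndepFun_sub_pair (hB : IsFractionalBrownianMotion H B P) (s r s' r' : ℝ≥0) :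
    iIndepFun (fun i ω ↦ ((B s ω - B r ω) i, (B s' ω - B r' ω) i)) P :=
  hB.iIndepFun_components.comp (fun _ φ ↦ (φ s - φ r, φ s' - φ r')) fun _ ↦ by fun_prop

theorem integral_sub_apply (hB : IsFractionalBrownianMotion H B P) [IsProbabilityMeasure P]
    (s r : ℝ≥0) (i : Fin d) : ∫ ω, (B s ω - B r ω) i ∂P = 0 := by
  simp only [PiLp.sub_apply]
  rw [integral_sub ((hB.memLp_apply s i).integrable one_le_two)
    ((hB.memLp_apply r i).integrable one_le_two), hB.centered, hB.centered, sub_zero]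

theorem integral_apply_mul_apply (hB : IsFractionalBrownianMotion H B P) (s r : ℝ≥0) (i : Fin d) :
    ∫ ω, B s ω i * B r ω i ∂P = fbmCov (2 * H) s r := by
  rw [hB.covariance, fbmCov, NNReal.abs_eq, NNReal.abs_eq]

theorem integral_sub_mul_sub (hB : IsFractionalBrownianMotion H B P) (s r s' r' : ℝ≥0)
    (i : Fin d) :
    ∫ ω, (B s ω - B r ω) i * (B s' ω - B r' ω) i ∂P =
      (fbmCov (2 * H) s s' - fbmCov (2 * H) r s') -
        (fbmCov (2 * H) s r' - fbmCov (2 * H) r r') := by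
  have hi : ∀ t t' : ℝ≥0, Integrable (fun ω ↦ B t ω i * B t' ω i) P := fun t t' ↦
    (hB.memLp_apply t i).integrable_mul (hB.memLp_apply t' i)
  have h : ∀ ω, (B s ω - B r ω) i * (B s' ω - B r' ω) i =
      (B s ω i * B s' ω i - B r ω i * B s' ω i) - (B s ω i * B r' ω i - B r ω i * B r' ω i) :=
    fun ω ↦ by simp only [PiLp.sub_apply]; ring
  simp_rw [h]
  rw [integral_sub (f := fun ω ↦ B s ω i * B s' ω i - B r ω i * B s' ω i)
    (g := fun ω ↦ B s ω i * B r' ω i - B r ω i * B r' ω i)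
    ((hi _ _).sub (hi _ _)) ((hi _ _).sub (hi _ _)), integral_sub (hi _ _) (hi _ _),
    integral_sub (hi _ _) (hi _ _)]
  simp only [hB.integral_apply_mul_apply]

/-- The definition does not fix the starting point; it follows almost surely because the variance at
time zero vanishes. -/
theorem ae_zero_eq_zero (hB : IsFractionalBrownianMotion H B P) (hH : 0 < H) (i : Fin d) :
    ∀ᵐ ω ∂P, B 0 ω i = 0 := by
  have h1 : ∫ ω, B 0 ω i * B 0 ω i ∂P = 0 := by
    rw [hB.integral_apply_mul_apply, NNReal.coe_zero, fbmCov_zero_left (by linarith)]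
  have h2 := (integral_eq_zero_iff_of_nonneg (fun ω ↦ mul_self_nonneg (B 0 ω i))
    ((hB.memLp_apply 0 i).integrable_mul (hB.memLp_apply 0 i))).1 h1
  filter_upwards [h2] with ω hω
  simpa using hω

/-- The increment of the path over `[z.1 - z.2, z.1]`. -/
noncomputable def pathIncr (B : ℝ≥0 → Ω → EuclideanSpace ℝ (Fin d)) (z : ℝ × ℝ) (ω : Ω) :
    EuclideanSpace ℝ (Fin d) :=
  B z.1.toNNReal ω - B (z.1 - z.2).toNNReal ω

variable {T : ℝ} {z z' : ℝ × ℝ}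

theorem integral_pathIncr_mul (hB : IsFractionalBrownianMotion H B P) (hz : z ∈ incrDomain T)
    (hz' : z' ∈ incrDomain T) (i : Fin d) :
    ∫ ω, pathIncr B z ω i * pathIncr B z' ω i ∂P =
      incrCov (2 * H) z.2 z'.2 (centreDiff (z, z')) := by
  simp only [pathIncr]
  rw [hB.integral_sub_mul_sub, Real.coe_toNNReal _ (hz.1.le.trans hz.2.1),
    Real.coe_toNNReal _ (sub_nonneg.2 hz.2.1), Real.coe_toNNReal _ (hz'.1.le.trans hz'.2.1),
    Real.coe_toNNReal _ (sub_nonneg.2 hz'.2.1)]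
  exact (incrCov_centreDiff _ z.1 z.2 z'.1 z'.2).symm

theorem _root_.incrCov_self {q u : ℝ} (hq : 0 < q) (hu : 0 ≤ u) (z : ℝ) :
    incrCov q u u (centreDiff ((z, u), (z, u))) = u ^ q := by
  simp only [incrCov, centreDiff, sub_self, zero_div]
  rw [show (u + u) / 2 = u by ring, evenPow_zero_left q hu, evenPow_zero_left q le_rfl,
    Real.zero_rpow hq.ne']
  ring

theorem integral_coordGaussian_pathIncr (hB : IsFractionalBrownianMotion H B P)
    [IsProbabilityMeasure P] (hH : 0 < H) (hz : z ∈ incrDomain T) (hz' : z' ∈ incrDomain T)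
    (j : Fin d) :
    ∫ ω, coordGaussian j (pathIncr B z ω) * coordGaussian j (pathIncr B z' ω) ∂P =
      incrCov (2 * H) z.2 z'.2 (centreDiff (z, z')) *
        covDet (2 * H) z.2 z'.2 (centreDiff (z, z')) ^ (-((d : ℝ) / 2 + 1)) := by
  refine integral_coordGaussian_mul j (hB.iIndepFun_sub_pair _ _ _ _)
    (hB.hasGaussianLaw_sub_pair _ _ _ _) (hB.integral_sub_apply _ _) (hB.integral_sub_apply _ _)
    (fun i ↦ ?_) (fun i ↦ ?_) (hB.integral_pathIncr_mul hz hz')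
  · rw [← incrCov_self (by linarith : 0 < 2 * H) hz.1.le z.1]
    exact hB.integral_pathIncr_mul hz hz i
  · rw [← incrCov_self (by linarith : 0 < 2 * H) hz'.1.le z'.1]
    exact hB.integral_pathIncr_mul hz' hz' i

/-- The end point is viewed as the increment over `[0, T]`, so the formula for pairs of increments
applies. -/
theorem integral_coordGaussian_pathIncr_mul_apply (hB : IsFractionalBrownianMotion H B P)
    [IsProbabilityMeasure P] (hH : 0 < H) (hz : z ∈ incrDomain T) (j : Fin d) :
    ∫ ω, coordGaussian j (pathIncr B z ω) * B T.toNNReal ω j ∂P =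
      chaosWeight (2 * H) ((d : ℝ) / 2 + 1) z.2 *
        (fbmCov (2 * H) z.1 T - fbmCov (2 * H) (z.1 - z.2) T) := by
  have hH2 : 0 < 2 * H := by linarith
  have hT : 0 ≤ T := (hz.1.le.trans hz.2.1).trans hz.2.2
  have h := integral_coordGaussian_mul_apply (P := P) (X := pathIncr B z)
    (Y := fun ω ↦ B T.toNNReal ω - B 0 ω) j (hB.iIndepFun_sub_pair _ _ _ _)
    (hB.hasGaussianLaw_sub_pair _ _ _ _) (hB.integral_sub_apply _ _) (hB.integral_sub_apply _ _)
    (hB.integral_pathIncr_mul hz hz) (hB.integral_sub_mul_sub _ _ _ _)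
    (hB.integral_sub_mul_sub _ _ _ _)
  have h0 : ∫ ω, coordGaussian j (pathIncr B z ω) * B T.toNNReal ω j ∂P =
      ∫ ω, coordGaussian j (pathIncr B z ω) * (B T.toNNReal ω - B 0 ω) j ∂P := by
    refine integral_congr_ae ?_
    filter_upwards [hB.ae_zero_eq_zero hH j] with ω hω
    rw [PiLp.sub_apply, hω, sub_zero]
  rw [h0, h, incrCov_self hH2 hz.1.le z.1, chaosWeight_of_pos hz.1,
    Real.coe_toNNReal _ (hz.1.le.trans hz.2.1), Real.coe_toNNReal _ (sub_nonneg.2 hz.2.1),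
    Real.coe_toNNReal _ hT, NNReal.coe_zero, fbmCov_zero_right hH2, fbmCov_zero_right hH2]
  ring

/-- The self-intersection functional at unit regularisation. -/
noncomputable def selfIntersection (B : ℝ≥0 → Ω → EuclideanSpace ℝ (Fin d)) (j : Fin d) (T : ℝ)
    (ω : Ω) : ℝ :=
  ∫ z, coordGaussian j (pathIncr B z ω) ∂incrMeasure T

theorem measurable_coordGaussian_pathIncr (hm : Measurable fun x : ℝ≥0 × Ω ↦ B x.1 x.2)
    (j : Fin d) : Measurable fun x : Ω × (ℝ × ℝ) ↦ coordGaussian j (pathIncr B x.2 x.1) := by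
  refine (continuous_coordGaussian j).measurable.comp (Measurable.sub ?_ ?_)
  · exact hm.comp (f := fun x : Ω × (ℝ × ℝ) ↦ (x.2.1.toNNReal, x.1)) (by fun_prop)
  · exact hm.comp (f := fun x : Ω × (ℝ × ℝ) ↦ ((x.2.1 - x.2.2).toNNReal, x.1)) (by fun_prop)

theorem memLp_selfIntersection [IsProbabilityMeasure P]
    (hm : Measurable fun x : ℝ≥0 × Ω ↦ B x.1 x.2) (j : Fin d) (T : ℝ) :
    MemLp (selfIntersection B j T) 2 P := by
  refine MemLp.of_bound (C := (incrMeasure T).real Set.univ)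
    (measurable_coordGaussian_pathIncr hm j).stronglyMeasurable.integral_prod_right.aestronglyMeasurable
    (Eventually.of_forall fun ω ↦ ?_)
  have := norm_integral_le_of_norm_le_const (μ := incrMeasure T) (C := 1)
    (f := fun z ↦ coordGaussian j (pathIncr B z ω))
    (Eventually.of_forall fun z ↦ abs_coordGaussian_le_one j _)
  rwa [one_mul] at this

/-- The exact mean square distance between the functional and a multiple of the end point. -/
theorem integral_selfIntersection_sub_sq (hB : IsFractionalBrownianMotion H B P)
    [IsProbabilityMeasure P] (hm : Measurable fun x : ℝ≥0 × Ω ↦ B x.1 x.2) (hH : 0 < H)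
    (hT : 0 ≤ T) (j : Fin d) (m : ℝ) :
    ∫ ω, (selfIntersection B j T ω - m * B T.toNNReal ω j) ^ 2 ∂P =
      ∫ x, incrCov (2 * H) x.1.2 x.2.2 (centreDiff x) *
          covDet (2 * H) x.1.2 x.2.2 (centreDiff x) ^ (-((d : ℝ) / 2 + 1))
          ∂(incrMeasure T).prod (incrMeasure T) -
        2 * m * (∫ z, chaosWeight (2 * H) ((d : ℝ) / 2 + 1) z.2 *
          (fbmCov (2 * H) z.1 T - fbmCov (2 * H) (z.1 - z.2) T) ∂incrMeasure T) +
        m ^ 2 * T ^ (2 * H) := by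
  have hg := measurable_coordGaussian_pathIncr hm j
  have hA := memLp_selfIntersection (P := P) hm j T
  have hb := hB.memLp_apply T.toNNReal j
  have hAA : Integrable (fun ω ↦ selfIntersection B j T ω * selfIntersection B j T ω) P :=
    hA.integrable_mul hA
  have hAb : Integrable (fun ω ↦ selfIntersection B j T ω * B T.toNNReal ω j) P :=
    hA.integrable_mul hb
  have hbb : Integrable (fun ω ↦ B T.toNNReal ω j * B T.toNNReal ω j) P := hb.integrable_mul hb
  have h1 : ∫ ω, selfIntersection B j T ω * selfIntersection B j T ω ∂P =
      ∫ x, incrCov (2 * H) x.1.2 x.2.2 (centreDiff x) *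
          covDet (2 * H) x.1.2 x.2.2 (centreDiff x) ^ (-((d : ℝ) / 2 + 1))
          ∂(incrMeasure T).prod (incrMeasure T) := by
    -- The square is a double integral over pairs of intervals; boundedness of the integrand allows
    -- the expectation to be taken inside.
    have e1 : ∀ ω, selfIntersection B j T ω * selfIntersection B j T ω =
        ∫ x : (ℝ × ℝ) × (ℝ × ℝ), coordGaussian j (pathIncr B x.1 ω) *
          coordGaussian j (pathIncr B x.2 ω) ∂(incrMeasure T).prod (incrMeasure T) := fun ω ↦
      (integral_prod_mul (fun z ↦ coordGaussian j (pathIncr B z ω))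
        (fun z ↦ coordGaussian j (pathIncr B z ω))).symm
    simp_rw [e1]
    rw [integral_integral_swap]
    · refine integral_congr_ae ?_
      filter_upwards [ae_incrMeasure_prod T] with x hx
      exact hB.integral_coordGaussian_pathIncr hH hx.1 hx.2 j
    · refine Integrable.of_bound (C := 1) (Measurable.aestronglyMeasurable ?_)
        (Eventually.of_forall fun x ↦ ?_)
      · exact (hg.comp (f := fun x : Ω × ((ℝ × ℝ) × (ℝ × ℝ)) ↦ (x.1, x.2.1)) (by fun_prop)).mul
          (hg.comp (f := fun x : Ω × ((ℝ × ℝ) × (ℝ × ℝ)) ↦ (x.1, x.2.2)) (by fun_prop))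
      · rw [Function.uncurry, norm_mul]
        exact mul_le_one₀ (abs_coordGaussian_le_one j _) (norm_nonneg _)
          (abs_coordGaussian_le_one j _)
  have h2 : ∫ ω, selfIntersection B j T ω * B T.toNNReal ω j ∂P =
      ∫ z, chaosWeight (2 * H) ((d : ℝ) / 2 + 1) z.2 *
          (fbmCov (2 * H) z.1 T - fbmCov (2 * H) (z.1 - z.2) T) ∂incrMeasure T := by
    simp_rw [selfIntersection, ← integral_mul_const]
    rw [integral_integral_swap]
    · refine integral_congr_ae ?_
      filter_upwards [ae_incrMeasure T] with z hz
      exact hB.integral_coordGaussian_pathIncr_mul_apply hH hz j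
    · have hbi : Integrable (fun x : Ω × (ℝ × ℝ) ↦ B T.toNNReal x.1 j)
          (P.prod (incrMeasure T)) := (hb.integrable one_le_two).comp_fst _
      exact hbi.bdd_mul (c := 1) hg.aestronglyMeasurable
        (Eventually.of_forall fun x ↦ abs_coordGaussian_le_one j _)
  have h3 : ∫ ω, B T.toNNReal ω j * B T.toNNReal ω j ∂P = T ^ (2 * H) := by
    rw [hB.integral_apply_mul_apply, Real.coe_toNNReal _ hT, fbmCov_self (by linarith) hT]
  have h4 : ∀ ω, (selfIntersection B j T ω - m * B T.toNNReal ω j) ^ 2 =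
      selfIntersection B j T ω * selfIntersection B j T ω -
        2 * m * (selfIntersection B j T ω * B T.toNNReal ω j) +
        m ^ 2 * (B T.toNNReal ω j * B T.toNNReal ω j) := fun ω ↦ by ring
  simp_rw [h4]
  rw [integral_add (f := fun ω ↦ selfIntersection B j T ω * selfIntersection B j T ω -
      2 * m * (selfIntersection B j T ω * B T.toNNReal ω j)) (hAA.sub (hAb.const_mul _))
    (hbb.const_mul _), integral_sub hAA (hAb.const_mul _), integral_const_mul,
    integral_const_mul, h1, h2, h3]

end IsFractionalBrownianMotion

/-! ### Derivative of the heat kernel and self-similar scaling. -/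

theorem heatKernelPartial_eq {d : ℕ} {ε : ℝ} (hε : 0 < ε) (j : Fin d)
    (x : EuclideanSpace ℝ (Fin d)) :
    heatKernelPartial ε j x = -(x j / ε) * heatKernel ε x := by
  have hnorm : ∀ t : ℝ, ‖x + t • EuclideanSpace.single j (1 : ℝ)‖ ^ 2 =
      ‖x‖ ^ 2 + 2 * t * x j + t ^ 2 := fun t ↦ by
    rw [norm_add_sq_real, inner_smul_right, norm_smul, EuclideanSpace.inner_single_right]
    simp
    ring
  have h : HasDerivAt (fun t : ℝ ↦ heatKernel ε (x + t • EuclideanSpace.single j (1 : ℝ)))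
      (-(x j / ε) * heatKernel ε x) 0 := by
    simp only [heatKernel, hnorm]
    have h1 : HasDerivAt (fun t : ℝ ↦ ‖x‖ ^ 2 + 2 * t * x j + t ^ 2)
        (2 * 1 * x j + ((2 : ℕ) : ℝ) * 0 ^ (2 - 1) * 1) 0 :=
      ((((hasDerivAt_id (0 : ℝ)).const_mul 2).mul_const (x j)).const_add (‖x‖ ^ 2)).add
        ((hasDerivAt_id (0 : ℝ)).pow 2)
    have h2 := ((h1.div_const (2 * ε)).neg.exp).const_mul
      ((2 * Real.pi * ε) ^ (-((d : ℝ) / 2)))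
    convert! h2 using 1
    simp
    field_simp
  rw [heatKernelPartial, lineDeriv, h.deriv]

theorem heatKernelPartial_smul {d : ℕ} {ε : ℝ} (hε : 0 < ε) (j : Fin d)
    (y : EuclideanSpace ℝ (Fin d)) :
    heatKernelPartial ε j (√ε • y) =
      -((2 * Real.pi) ^ (-((d : ℝ) / 2)) * ε ^ (-((d : ℝ) / 2 + 1 / 2)) * coordGaussian j y) := by
  have h1 : ‖√ε • y‖ ^ 2 / (2 * ε) = ‖y‖ ^ 2 / 2 := by
    rw [norm_smul, mul_pow, Real.norm_of_nonneg (Real.sqrt_nonneg ε), Real.sq_sqrt hε.le]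
    field_simp
  have h2 : √ε / ε = ε ^ (-(1 / 2 : ℝ)) := by
    rw [Real.sqrt_div_self', Real.sqrt_eq_rpow, Real.rpow_neg hε.le, one_div]
  have h3 : (√ε • y) j / ε = ε ^ (-(1 / 2 : ℝ)) * y j := by
    rw [← h2, PiLp.smul_apply, smul_eq_mul]
    ring
  rw [heatKernelPartial_eq hε, heatKernel, h1, h3, coordGaussian,
    Real.mul_rpow (by positivity) hε.le, neg_add, Real.rpow_add hε]
  ring

namespace IsFractionalBrownianMotion

variable {Ω : Type*} [MeasurableSpace Ω] {P : Measure Ω} {d : ℕ} {H : ℝ}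
  {B : ℝ≥0 → Ω → EuclideanSpace ℝ (Fin d)}

/-- The self-similar rescaling `s ↦ δ^(-H) B_{δ s}`. -/
noncomputable def rescale (H : ℝ) (δ : ℝ≥0) (B : ℝ≥0 → Ω → EuclideanSpace ℝ (Fin d)) (s : ℝ≥0)
    (ω : Ω) : EuclideanSpace ℝ (Fin d) :=
  (δ : ℝ) ^ (-H) • B (δ * s) ω

theorem isFractionalBrownianMotion_rescale (hB : IsFractionalBrownianMotion H B P) {δ : ℝ≥0}
    (hδ : 0 < δ) : IsFractionalBrownianMotion H (rescale H δ B) P where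
  isGaussianProcess :=
    (hB.isGaussianProcess.comp_right fun s ↦ δ * s).smul fun _ ↦ (δ : ℝ) ^ (-H)
  centered s i := by
    simp only [rescale, PiLp.smul_apply, smul_eq_mul]
    rw [integral_const_mul, hB.centered, mul_zero]
  covariance s r i := by
    have hδ' : (0 : ℝ) < δ := hδ
    have h : ∀ ω, rescale H δ B s ω i * rescale H δ B r ω i =
        (δ : ℝ) ^ (-(2 * H)) * (B (δ * s) ω i * B (δ * r) ω i) := fun ω ↦ by
      simp only [rescale, PiLp.smul_apply, smul_eq_mul]
      rw [show -(2 * H) = -H + -H by ring, Real.rpow_add hδ']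
      ring
    simp_rw [h]
    have h2 : (δ : ℝ) ^ (-(2 * H)) * (δ : ℝ) ^ (2 * H) = 1 := by
      rw [← Real.rpow_add hδ']; simp
    rw [integral_const_mul, hB.covariance, NNReal.coe_mul, NNReal.coe_mul, ← mul_sub, abs_mul,
      abs_of_pos hδ', Real.mul_rpow hδ'.le s.coe_nonneg, Real.mul_rpow hδ'.le r.coe_nonneg,
      Real.mul_rpow hδ'.le (abs_nonneg _)]
    linear_combination (1 / 2 * ((s : ℝ) ^ (2 * H) + (r : ℝ) ^ (2 * H) -
      |(s : ℝ) - (r : ℝ)| ^ (2 * H))) * h2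
  iIndepFun_components :=
    hB.iIndepFun_components.comp (fun _ φ t ↦ (δ : ℝ) ^ (-H) * φ (δ * t)) fun _ ↦ by fun_prop

theorem measurable_rescale (hm : Measurable fun x : ℝ≥0 × Ω ↦ B x.1 x.2) (δ : ℝ≥0) :
    Measurable fun x : ℝ≥0 × Ω ↦ rescale H δ B x.1 x.2 := by
  have h : Measurable fun x : ℝ≥0 × Ω ↦ B (δ * x.1) x.2 :=
    hm.comp (f := fun x : ℝ≥0 × Ω ↦ (δ * x.1, x.2)) (by fun_prop)
  exact h.const_smul ((δ : ℝ) ^ (-H))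

theorem rpow_smul_rescale {Ω : Type*} {B : ℝ≥0 → Ω → EuclideanSpace ℝ (Fin d)} {δ : ℝ≥0} (hδ : 0 < δ) (s : ℝ≥0) (ω : Ω) :
    (δ : ℝ) ^ H • rescale H δ B s ω = B (δ * s) ω := by
  have hδ' : (0 : ℝ) < δ := hδ
  rw [rescale, smul_smul, ← Real.rpow_add hδ', add_neg_cancel, Real.rpow_zero, one_smul]

theorem selfIntersection_eq (hm : Measurable fun x : ℝ≥0 × Ω ↦ B x.1 x.2) (j : Fin d) {T : ℝ}
    (hT : 0 ≤ T) (ω : Ω) :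
    selfIntersection B j T ω = ∫ s in (0 : ℝ)..T, ∫ r in (0 : ℝ)..s,
      coordGaussian j (B s.toNNReal ω - B r.toNNReal ω) := by
  have hi : Integrable (fun z ↦ coordGaussian j (pathIncr B z ω)) (incrMeasure T) :=
    Integrable.of_bound (C := 1)
      ((measurable_coordGaussian_pathIncr hm j).comp
        (measurable_prodMk_left (x := ω))).aestronglyMeasurable
      (Eventually.of_forall fun z ↦ abs_coordGaussian_le_one j _)
  rw [selfIntersection, integral_incrMeasure_swap hT hi]
  congr 1 with s
  have := intervalIntegral.integral_comp_sub_left (a := 0) (b := s)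
    (fun r ↦ coordGaussian j (B s.toNNReal ω - B r.toNNReal ω)) s
  rw [sub_self, sub_zero] at this
  rw [← this]
  rfl

/-- Scaling relation between the approximation at level `ε` and the functional at level one. -/
theorem rpow_mul_approxDSLT (hm : Measurable fun x : ℝ≥0 × Ω ↦ B x.1 x.2) (hH : 0 < H)
    (j : Fin d) {t ε : ℝ} (ht : 0 ≤ t) (hε : 0 < ε) {δ : ℝ≥0} (hδε : (δ : ℝ) = ε ^ (1 / (2 * H)))
    (ω : Ω) :
    ε ^ ((d : ℝ) / 2 + 1 - 1 / H) * approxDSLT B j t ε 0 ω =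
      (2 * Real.pi) ^ (-((d : ℝ) / 2)) *
        ((δ : ℝ) ^ H * selfIntersection (rescale H δ B) j (t / δ) ω) := by
  have hδ' : (0 : ℝ) < δ := hδε ▸ by positivity
  have hδ : 0 < δ := hδ'
  have hδH : (δ : ℝ) ^ H = √ε := by
    rw [hδε, ← Real.rpow_mul hε.le, Real.sqrt_eq_rpow]
    congr 1
    field_simp
  have hδ2 : (δ : ℝ) * δ = ε ^ (1 / H) := by
    rw [hδε, ← Real.rpow_add hε]
    congr 1
    field_simp
    norm_num
  rw [selfIntersection_eq (measurable_rescale hm δ) j (by positivity)]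
  set F : ℝ → ℝ → ℝ := fun s r ↦
    heatKernelPartial ε j (B s.toNNReal ω - B r.toNNReal ω - 0) with hF
  set G : ℝ → ℝ → ℝ := fun s r ↦
    coordGaussian j (rescale H δ B s.toNNReal ω - rescale H δ B r.toNNReal ω) with hG
  have hFG : ∀ s r : ℝ, F (δ * s) (δ * r) =
      -((2 * Real.pi) ^ (-((d : ℝ) / 2)) * ε ^ (-((d : ℝ) / 2 + 1 / 2))) * G s r := fun s r ↦ by
    simp only [hF, hG]
    rw [Real.toNNReal_mul hδ'.le, Real.toNNReal_mul hδ'.le, Real.toNNReal_coe,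
      ← rpow_smul_rescale (H := H) (B := B) hδ s.toNNReal ω,
      ← rpow_smul_rescale (H := H) (B := B) hδ r.toNNReal ω, ← smul_sub, sub_zero, hδH,
      heatKernelPartial_smul hε]
    ring
  have hscale : ∫ s in (0 : ℝ)..t, ∫ r in (0 : ℝ)..s, F s r =
      δ * ∫ s in (0 : ℝ)..(t / δ), δ * ∫ r in (0 : ℝ)..s, F (δ * s) (δ * r) := by
    have h1 := intervalIntegral.smul_integral_comp_mul_left (a := 0) (b := t / δ)
      (fun s ↦ ∫ r in (0 : ℝ)..s, F s r) (δ : ℝ)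
    rw [mul_zero, mul_div_cancel₀ t hδ'.ne'] at h1
    rw [← h1, smul_eq_mul]
    congr 2 with s
    have h2 := intervalIntegral.smul_integral_comp_mul_left (a := 0) (b := s)
      (fun r ↦ F (δ * s) r) (δ : ℝ)
    rw [mul_zero] at h2
    rw [← h2, smul_eq_mul]
  rw [approxDSLT, hscale]
  simp only [hFG, intervalIntegral.integral_const_mul]
  -- The two time substitutions give `δ² = ε^(1/H)`, cancelling `-1/H`; the kernel leaves `ε^(1/2) =
  -- δ^H`.
  have hpow : ε ^ ((d : ℝ) / 2 + 1 - 1 / H) * (δ * δ) * ε ^ (-((d : ℝ) / 2 + 1 / 2)) =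
      (δ : ℝ) ^ H := by
    rw [hδ2, hδH, ← Real.rpow_add hε, ← Real.rpow_add hε, Real.sqrt_eq_rpow]
    congr 1
    ring
  rw [← hpow]
  ring

/-! ### Mean square convergence and the limit law. -/

/-- For each `ε` the process is replaced by its rescaling, again a fractional Brownian motion on the
same space. The error estimate uses only its covariance and Gaussian structure, so it holds although
the rescaled process varies with `ε`. -/
theorem tendsto_integral_sub_sq (hB : IsFractionalBrownianMotion H B P) [IsProbabilityMeasure P]
    (hm : Measurable fun x : ℝ≥0 × Ω ↦ B x.1 x.2) (hd : 2 ≤ d) (hH : 1 / 2 < H) (hH1 : H < 1)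
    (j : Fin d) {t : ℝ} (ht : 0 ≤ t) {m c : ℝ}
    (hmdef : m = ∫ u in Set.Ioi (0 : ℝ), u * (1 + u ^ (2 * H)) ^ (-((d : ℝ) / 2 + 1)))
    (hc : c = (2 * Real.pi) ^ (-((d : ℝ) / 2)) * m) :
    Tendsto (fun ε : ℝ ↦ ∫ ω, (ε ^ ((d : ℝ) / 2 + 1 - 1 / H) * approxDSLT B j t ε 0 ω -
      c * B t.toNNReal ω j) ^ 2 ∂P) (𝓝[>] 0) (𝓝 0) := by
  have hH0 : 0 < H := by linarith
  -- For `t = 0` the rescaled horizon `t / δ` does not tend to infinity; both variables then vanish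
  -- almost surely.
  rcases eq_or_lt_of_le ht with rfl | ht
  · refine tendsto_const_nhds.congr fun ε ↦ ?_
    symm
    refine integral_eq_zero_of_ae ?_
    filter_upwards [hB.ae_zero_eq_zero hH0 j] with ω hω
    simp [approxDSLT, hω]
  set κ : ℝ := (2 * Real.pi) ^ (-((d : ℝ) / 2)) with hκ
  have hκ0 : 0 < κ := by positivity
  have hp : (2 : ℝ) ≤ (d : ℝ) / 2 + 1 := by
    have : (2 : ℝ) ≤ d := by exact_mod_cast hd
    linarith
  have hδ0 : Tendsto (fun ε : ℝ ↦ t / ε ^ (1 / (2 * H))) (𝓝[>] 0) atTop := by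
    have h1 : Tendsto (fun ε : ℝ ↦ ε ^ (1 / (2 * H))) (𝓝[>] 0) (𝓝[>] 0) := by
      refine tendsto_nhdsWithin_iff.2 ⟨?_, ?_⟩
      · have h2 : 0 < 1 / (2 * H) := by positivity
        have := (Real.continuousAt_rpow_const 0 (1 / (2 * H)) (Or.inr h2.le)).tendsto
        rw [Real.zero_rpow h2.ne'] at this
        exact this.mono_left nhdsWithin_le_nhds
      · filter_upwards [self_mem_nhdsWithin] with ε hε
        have : 0 < ε := hε
        exact Set.mem_Ioi.2 (by positivity)
    simp_rw [div_eq_mul_inv]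
    exact (tendsto_inv_nhdsGT_zero.comp h1).const_mul_atTop ht
  have key : ∀ η : ℝ, 0 < η → ∀ᶠ ε : ℝ in 𝓝[>] 0,
      ∫ ω, (ε ^ ((d : ℝ) / 2 + 1 - 1 / H) * approxDSLT B j t ε 0 ω -
        c * B t.toNNReal ω j) ^ 2 ∂P ≤ κ ^ 2 * (η * t ^ (2 * H)) := by
    intro η hη
    filter_upwards [hδ0.eventually (eventually_chaos_error_le (by linarith : 1 < 2 * H)
      (by linarith : 2 * H < 2) hp hη), self_mem_nhdsWithin] with ε hε hε0
    have hε0' : 0 < ε := hε0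
    obtain ⟨δ, hδε⟩ : ∃ δ : ℝ≥0, (δ : ℝ) = ε ^ (1 / (2 * H)) := ⟨⟨_, by positivity⟩, rfl⟩
    rw [← hδε] at hε
    have hδ' : (0 : ℝ) < δ := hδε ▸ by positivity
    have hδ : 0 < δ := hδ'
    have hT : 0 ≤ t / δ := by positivity
    have hend : ∀ ω, B t.toNNReal ω j =
        (δ : ℝ) ^ H * rescale H δ B (t / δ).toNNReal ω j := fun ω ↦ by
      have h1 := rpow_smul_rescale (H := H) (B := B) hδ (t / δ).toNNReal ω
      have h2 : δ * (t / δ).toNNReal = t.toNNReal := by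
        rw [← Real.toNNReal_coe (r := δ), ← Real.toNNReal_mul δ.coe_nonneg, Real.toNNReal_coe,
          mul_div_cancel₀ t hδ'.ne']
      rw [h2] at h1
      rw [← h1, PiLp.smul_apply, smul_eq_mul]
    have heq : ∀ ω, (ε ^ ((d : ℝ) / 2 + 1 - 1 / H) * approxDSLT B j t ε 0 ω -
        c * B t.toNNReal ω j) ^ 2 = κ ^ 2 * (δ : ℝ) ^ (2 * H) *
        (selfIntersection (rescale H δ B) j (t / δ) ω -
          m * rescale H δ B (t / δ).toNNReal ω j) ^ 2 := fun ω ↦ by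
      rw [rpow_mul_approxDSLT hm hH0 j ht.le hε0' hδε, hend, hc, ← hκ,
        show 2 * H = H + H by ring, Real.rpow_add hδ']
      ring
    simp_rw [heq]
    rw [integral_const_mul, (hB.isFractionalBrownianMotion_rescale hδ).integral_selfIntersection_sub_sq
      (measurable_rescale hm δ) hH0 hT, mul_assoc]
    refine mul_le_mul_of_nonneg_left ?_ (sq_nonneg κ)
    rw [← hmdef] at hε
    -- The prefactor `δ^(2H)` exactly cancels the growth of `(t/δ)^(2H)`, so an error `o(T^q)`
    -- suffices.
    calc _ ≤ (δ : ℝ) ^ (2 * H) * (η * (t / δ) ^ (2 * H)) :=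
          mul_le_mul_of_nonneg_left hε (by positivity)
      _ = η * t ^ (2 * H) := by
          rw [Real.div_rpow ht.le hδ'.le]
          field_simp
  refine tendsto_order.2 ⟨fun a ha ↦ Eventually.of_forall fun ε ↦
    ha.trans_le (integral_nonneg fun ω ↦ sq_nonneg _), fun a ha ↦ ?_⟩
  have htq : 0 < t ^ (2 * H) := by positivity
  filter_upwards [key (a / (2 * (κ ^ 2 * t ^ (2 * H)))) (by positivity)] with ε hε
  refine hε.trans_lt ?_
  have : κ ^ 2 * (a / (2 * (κ ^ 2 * t ^ (2 * H))) * t ^ (2 * H)) = a / 2 := by field_simp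
  rw [this]
  linarith

end IsFractionalBrownianMotion

/-- The Beta integral at `q = 2H` carries the prefactor `1/(2H)`; its square supplies `4H²` in the
denominator, and the heat kernel constant supplies `(2π)^d`. -/
theorem limitVariance_eq {d : ℕ} {H t m c : ℝ} (hd : 2 ≤ d) (hH : 1 / 2 < H)
    (hmdef : m = ∫ u in Set.Ioi (0 : ℝ), u * (1 + u ^ (2 * H)) ^ (-((d : ℝ) / 2 + 1)))
    (hc : c = (2 * Real.pi) ^ (-((d : ℝ) / 2)) * m) :
    limitVariance d H t = c ^ 2 * t ^ (2 * H) := by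
  have hH0 : 0 < H := by linarith
  have hd' : (2 : ℝ) ≤ d := by exact_mod_cast hd
  have h2H : 2 / (2 * H) = 1 / H := by field_simp
  have h1H : 1 / H < 2 := by rw [div_lt_iff₀ hH0]; linarith
  rw [integral_id_mul_one_add_rpow_neg (by linarith) (by rw [h2H]; linarith), h2H] at hmdef
  have hpow : ((2 * Real.pi) ^ (-((d : ℝ) / 2))) ^ 2 = ((2 * Real.pi) ^ d)⁻¹ := by
    rw [← Real.rpow_natCast, ← Real.rpow_mul (by positivity),
      show -((d : ℝ) / 2) * (2 : ℕ) = -(d : ℝ) by push_cast; ring,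
      Real.rpow_neg (by positivity), Real.rpow_natCast]
  rw [limitVariance, hc, hmdef, mul_pow, hpow, mul_pow, pow_add]
  field_simp

theorem theorem1p3 {Ω : Type*} [MeasurableSpace Ω] (P : Measure Ω) [IsProbabilityMeasure P]
    (d : ℕ) (hd : 2 ≤ d) (H : ℝ) (hH : 1 / 2 < H) (hH1 : H < 1)
    (B : ℝ≥0 → Ω → EuclideanSpace ℝ (Fin d))
    (hB : IsFractionalBrownianMotion H B P)
    (hB_meas : Measurable (fun q : ℝ≥0 × Ω ↦ B q.1 q.2))
    (j : Fin d) (t : ℝ) (ht : 0 ≤ t) :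
    TendstoInDistribution
      (fun (ε : Set.Ioi (0 : ℝ)) (ω : Ω) ↦
        (ε : ℝ) ^ ((d : ℝ) / 2 + 1 - 1 / H) * approxDSLT B j t (ε : ℝ) 0 ω)
      (comap (fun ε : Set.Ioi (0 : ℝ) ↦ (ε : ℝ)) (𝓝 0))
      (fun z : ℝ ↦ z) (fun _ ↦ P) (gaussianReal 0 (limitVariance d H t).toNNReal) := by
  have hH0 : 0 < H := by linarith
  obtain ⟨m, hm⟩ : ∃ m : ℝ,
    m = ∫ u in Set.Ioi (0 : ℝ), u * (1 + u ^ (2 * H)) ^ (-((d : ℝ) / 2 + 1)) := ⟨_, rfl⟩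
  obtain ⟨c, hc⟩ : ∃ c : ℝ, c = (2 * Real.pi) ^ (-((d : ℝ) / 2)) * m := ⟨_, rfl⟩
  set X : Set.Ioi (0 : ℝ) → Ω → ℝ := fun ε ω ↦
    (ε : ℝ) ^ ((d : ℝ) / 2 + 1 - 1 / H) * approxDSLT B j t (ε : ℝ) 0 ω with hX
  -- The explicit mean square limit, on the same probability space.
  set Z : Ω → ℝ := fun ω ↦ c * B t.toNNReal ω j with hZ
  have hZ2 : MemLp Z 2 P := (hB.memLp_apply t.toNNReal j).const_mul c
  have hX2 : ∀ ε, MemLp (X ε) 2 P := fun ε ↦ by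
    have hε : (0 : ℝ) < ε := ε.2
    obtain ⟨δ, hδε⟩ : ∃ δ : ℝ≥0, (δ : ℝ) = (ε : ℝ) ^ (1 / (2 * H)) := ⟨⟨_, by positivity⟩, rfl⟩
    have h : X ε = fun ω ↦ (2 * Real.pi) ^ (-((d : ℝ) / 2)) * ((δ : ℝ) ^ H *
        IsFractionalBrownianMotion.selfIntersection
          (IsFractionalBrownianMotion.rescale H δ B) j (t / δ) ω) :=
      funext fun ω ↦ IsFractionalBrownianMotion.rpow_mul_approxDSLT hB_meas hH0 j ht hε hδε ω
    rw [h]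
    exact ((IsFractionalBrownianMotion.memLp_selfIntersection
      (IsFractionalBrownianMotion.measurable_rescale hB_meas δ) j (t / δ)).const_mul _).const_mul _
  have hcomap : comap (fun ε : Set.Ioi (0 : ℝ) ↦ (ε : ℝ)) (𝓝 0) =
      comap (fun ε : Set.Ioi (0 : ℝ) ↦ (ε : ℝ)) (𝓝[>] 0) := by
    rw [nhdsWithin, comap_inf, comap_principal]
    simp
  have htend : Tendsto (fun ε : Set.Ioi (0 : ℝ) ↦ (ε : ℝ))
      (comap (fun ε : Set.Ioi (0 : ℝ) ↦ (ε : ℝ)) (𝓝 0)) (𝓝[>] 0) := by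
    rw [hcomap]
    exact tendsto_comap
  have hne : (comap (fun ε : Set.Ioi (0 : ℝ) ↦ (ε : ℝ)) (𝓝 0)).NeBot := by
    rw [← mem_closure_iff_comap_neBot, closure_Ioi]
    exact Set.mem_Ici.2 le_rfl
  have hL2 := (hB.tendsto_integral_sub_sq hB_meas hd hH hH1 j ht hm hc).comp htend
  have hmeasure : TendstoInMeasure P X (comap (fun ε : Set.Ioi (0 : ℝ) ↦ (ε : ℝ)) (𝓝 0)) Z := by
    refine tendstoInMeasure_of_tendsto_eLpNorm (p := 2) two_ne_zero
      (fun ε ↦ (hX2 ε).aestronglyMeasurable) hZ2.aestronglyMeasurable ?_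
    have h1 : ∀ ε, eLpNorm (X ε - Z) 2 P =
        ENNReal.ofReal ((∫ ω, (X ε ω - Z ω) ^ 2 ∂P) ^ (2⁻¹ : ℝ)) := fun ε ↦ by
      rw [((hX2 ε).sub hZ2).eLpNorm_eq_integral_rpow_norm two_ne_zero ENNReal.ofNat_ne_top]
      simp
    simp_rw [h1]
    have h2 := (hL2.rpow_const (p := (2⁻¹ : ℝ)) (Or.inr (by norm_num)))
    rw [Real.zero_rpow (by norm_num)] at h2
    have h3 := ENNReal.tendsto_ofReal h2
    rw [ENNReal.ofReal_zero] at h3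
    exact h3
  have hdist := hmeasure.tendstoInDistribution fun ε ↦ (hX2 ε).aestronglyMeasurable.aemeasurable
  have hlaw : P.map Z = gaussianReal 0 (limitVariance d H t).toNNReal := by
    have hG : HasGaussianLaw Z P :=
      (((hB.isGaussianProcess.hasGaussianLaw_eval t.toNNReal).map_fun
        (EuclideanSpace.proj j)).fun_smul c)
    have hZ0 : ∫ ω, Z ω ∂P = 0 := by
      rw [hZ, integral_const_mul, hB.centered, mul_zero]
    have hvar : Var[Z; P] = c ^ 2 * t ^ (2 * H) := by
      rw [variance_of_integral_eq_zero hG.aemeasurable hZ0]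
      have h1 : ∀ ω, Z ω ^ 2 = c ^ 2 * (B t.toNNReal ω j * B t.toNNReal ω j) := fun ω ↦ by
        simp only [hZ]; ring
      simp_rw [h1]
      rw [integral_const_mul, hB.integral_apply_mul_apply, Real.coe_toNNReal _ ht,
        fbmCov_self (by linarith) ht]
    rw [hG.map_eq_gaussianReal, hZ0, hvar, limitVariance_eq hd hH hm hc]
  refine ⟨hdist.forall_aemeasurable, by fun_prop, ?_⟩
  convert! hdist.tendsto using 2
  -- Convergence in distribution depends on the limit only through its law, so `Z` may be replaced
  -- by the identity under the Gaussian measure.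
  refine congrArg 𝓝 (Subtype.ext ?_)
  change Measure.map (fun z ↦ z) _ = Measure.map Z P
  rw [Measure.map_id', hlaw]
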